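/- Let $n\ge 3$, $k\ge 2$, let $G=\mathrm{SO}(n+k)$ and let $H=\mathrm{SO}(n)$ be embedded in $G$ as the lower right $(n\times n)$-block. Let $\mathfrak h=\mathfrak{so}(n)\subset\mathfrak g=\mathfrak{so}(n+k)$ be the Lie algebras, $Q(X,Y)=-\mathrm{tr}(XY)$ the bi-invariant inner product on $\mathfrak g$ (unique up to scaling), $\mathfrak m$ the $Q$-orthogonal complement of $\mathfrak h$ in $\mathfrak g$, and $\mathrm{Sym}_{\mathfrak g}^{H}$ the space of $Q$-self-adjoint, $\mathrm{Ad}(H)$-equivariant endomorphisms of $\mathfrak g$. A Lie subalgebra $\mathfrak k$ with $\mathfrak h\subsetneq\mathfrak k\subsetneq\mathfrak g$ is called non-toral if $\mathfrak m\cap\mathfrak k$ is not abelian, i.e. $[X,Y]\neq 0$ for some $X,Y\in\mathfrak m\cap\mathfrak k$. Let $\mathrm P_s$ be the set of all $P\in \mathrm{Sym}_{\mathfrak g}^{H}$ with $P^2=P$ whose kernel is a non-toral Lie subalgebra $\mathfrak k$ with $\mathfrak h\subsetneq\mathfrak k\subsetneq\mathfrak g$. The nerve of $G/H$ is the topological subspace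 of $\mathrm{End}(\mathfrak g)$ $$X_{G/H}=\Big\{\sum_{i=1}^r\lambda_iP_i \;\Big|\; r\ge 1,\ P_i\in \mathrm P_s,\ \ker P_1\subsetneq\dots\subsetneq\ker P_r,\ \lambda_i\ge 0,\ \sum_{i=1}^r\lambda_i=1\Big\}.$$ Put $q(k)=\tfrac12k(k+1)-2$. Then there is a subset $A\subset X_{G/H}$, homeomorphic to the sphere $S^{q(k)}$, which contains a non-empty open subset of $X_{G/H}$ and which is non-contractible in $X_{G/H}$, i.e. the inclusion $A\hookrightarrow X_{G/H}$ is not homotopic to a constant map. Moreover, the singular homology $H_{q(k)}(X_{G/H};R)$ is non-zero for every non-zero commutative coefficient ring $R$ (in particular for $R=\mathbb Z$), and the nerve $X_{G/H}$ is not contractible. -/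

import Mathlib

open CategoryTheory

/-! ## The nerve of a homogeneous space

The data are: the Lie algebra `𝔤` of `G`, an inner product `Q` on `𝔤`, the Lie algebra `𝔥 ⊆ 𝔤` of
`H`, and the adjoint representation `Ad` of `H` on `𝔤`. -/

namespace Homogeneous

section Nerve

variable {𝔤 : Type*} [LieRing 𝔤] [LieAlgebra ℝ 𝔤]
  [TopologicalSpace 𝔤] [IsTopologicalAddGroup 𝔤] [ContinuousSMul ℝ 𝔤]
  (Q : LinearMap.BilinForm ℝ 𝔤) (𝔥 : LieSubalgebra ℝ 𝔤)
  {H : Type*} [Group H] (Ad : Representation ℝ H 𝔤)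

/-- The space of `Q`-self-adjoint, `Ad(H)`-equivariant endomorphisms of `𝔤`. -/
def symEnd : Set (𝔤 →L[ℝ] 𝔤) :=
  {A | (∀ X Y, Q (A X) Y = Q X (A Y)) ∧ ∀ (a : H) (X : 𝔤), A (Ad a X) = Ad a (A X)}

/-- The projections in `symEnd` whose kernel `𝔨` is a Lie subalgebra of `𝔤` with
`𝔥 ⊊ 𝔨 ⊊ 𝔤`. -/
def projAlg : Set (𝔤 →L[ℝ] 𝔤) :=
  {P | P ∈ symEnd Q Ad ∧ (∀ X, P (P X) = P X) ∧
    𝔥.toSubmodule < LinearMap.ker (P : 𝔤 →ₗ[ℝ] 𝔤) ∧ LinearMap.ker (P : 𝔤 →ₗ[ℝ] 𝔤) < ⊤ ∧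
    ∀ X Y, P X = 0 → P Y = 0 → P ⁅X, Y⁆ = 0}

/-- The projections in `projAlg` whose kernel `𝔨` is non-toral: `𝔨 ∩ 𝔪` is not abelian, where `𝔪`
is the `Q`-orthogonal complement of `𝔥` in `𝔤`. -/
def projNontoral : Set (𝔤 →L[ℝ] 𝔤) :=
  {P | P ∈ projAlg Q 𝔥 Ad ∧ ∃ X Y : 𝔤, P X = 0 ∧ (∀ Z ∈ 𝔥, Q Z X = 0) ∧
    P Y = 0 ∧ (∀ Z ∈ 𝔥, Q Z Y = 0) ∧ ⁅X, Y⁆ ≠ 0}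

/-- The nerve: all convex combinations of projections along flags
`ker P₁ ⊊ ⋯ ⊊ ker Pᵣ` of non-toral subalgebras, as a subset of the endomorphisms of `𝔤`. -/
def nerve : Set (𝔤 →L[ℝ] 𝔤) :=
  {B | B ∈ symEnd Q Ad ∧ ∃ (r : ℕ) (P : Fin r → 𝔤 →L[ℝ] 𝔤) (c : Fin r → ℝ),
    (∀ i, P i ∈ projNontoral Q 𝔥 Ad) ∧
    StrictMono (fun i => LinearMap.ker (P i : 𝔤 →ₗ[ℝ] 𝔤)) ∧
    (∀ i, 0 ≤ c i) ∧ ∑ i, c i = 1 ∧ B = ∑ i, c i • P i}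

end Nerve

/-! ## The special orthogonal groups and their Lie algebras -/

section Orthogonal

open Matrix

attribute [local instance] LieRing.ofAssociativeRing

variable {ι : Type*} [Fintype ι] [DecidableEq ι]

/-- The Lie algebra `𝔰𝔬(ι)` of real skew-symmetric matrices. -/
abbrev soAlg (ι : Type*) [Fintype ι] [DecidableEq ι] : LieSubalgebra ℝ (Matrix ι ι ℝ) :=
  LieAlgebra.Orthogonal.so ι ℝ

instance : IsTopologicalAddGroup (soAlg ι) :=
  inferInstanceAs (IsTopologicalAddGroup (soAlg ι).toSubmodule)

instance : ContinuousSMul ℝ (soAlg ι) :=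
  inferInstanceAs (ContinuousSMul ℝ (soAlg ι).toSubmodule)

/-- The bi-invariant inner product `Q(X, Y) = -tr(XY)` on `𝔰𝔬(ι)`. -/
noncomputable def traceForm (ι : Type*) [Fintype ι] [DecidableEq ι] :
    LinearMap.BilinForm ℝ (soAlg ι) :=
  LinearMap.mk₂ ℝ (fun X Y => -Matrix.trace ((X : Matrix ι ι ℝ) * (Y : Matrix ι ι ℝ)))
    (fun X X' Y => by simp [add_mul]; ring) (fun c X Y => by simp)
    (fun X Y Y' => by simp [mul_add]; ring) (fun c X Y => by simp)

/-- The adjoint representation of `SO(ι)` on `𝔰𝔬(ι)`, `Ad(g) X = g X g⁻¹ = g X gᵀ`. -/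
def adSO (ι : Type*) [Fintype ι] [DecidableEq ι] :
    Representation ℝ (specialOrthogonalGroup ι ℝ) (soAlg ι) where
  toFun g :=
    { toFun X := ⟨(g : Matrix ι ι ℝ) * X * (g : Matrix ι ι ℝ)ᵀ, by
        have hX := (LieAlgebra.Orthogonal.mem_so ι ℝ (X : Matrix ι ι ℝ)).1 X.2
        rw [LieAlgebra.Orthogonal.mem_so]
        simp [Matrix.transpose_mul, hX, Matrix.mul_assoc]⟩
      map_add' X Y := by
        apply Subtype.ext; simp [Matrix.mul_add, Matrix.add_mul]
      map_smul' c X := by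
        apply Subtype.ext; simp }
  map_one' := by
    ext1 X; apply Subtype.ext; simp
  map_mul' g h := by
    ext1 X; apply Subtype.ext; simp [Matrix.mul_assoc]

variable (k n : ℕ)

/-- The embedding of `SO(n)` into `SO(k + n)` as the lower right block. -/
def blockSO : specialOrthogonalGroup (Fin n) ℝ →*
    specialOrthogonalGroup (Fin k ⊕ Fin n) ℝ where
  toFun A := ⟨fromBlocks 1 0 0 (A : Matrix (Fin n) (Fin n) ℝ), by
    obtain ⟨h1, h2⟩ := mem_specialOrthogonalGroup_iff.1 A.2
    rw [mem_orthogonalGroup_iff] at h1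
    rw [mem_specialOrthogonalGroup_iff, mem_orthogonalGroup_iff]
    refine ⟨?_, by simp [h2]⟩
    rw [fromBlocks_transpose, fromBlocks_multiply]
    simp [h1]⟩
  map_one' := by apply Subtype.ext; simp
  map_mul' A B := by apply Subtype.ext; simp [fromBlocks_multiply]

/-- The Lie algebra `𝔰𝔬(n)` of the subgroup `SO(n)`, embedded into `𝔰𝔬(k + n)` as the lower right
block. -/
def blockAlg : LieSubalgebra ℝ (soAlg (Fin k ⊕ Fin n)) where
  carrier := {X | ∃ Y ∈ soAlg (Fin n),
    (X : Matrix (Fin k ⊕ Fin n) (Fin k ⊕ Fin n) ℝ) = fromBlocks 0 0 0 Y}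
  add_mem' := by
    rintro X X' ⟨Y, hY, h⟩ ⟨Y', hY', h'⟩
    exact ⟨Y + Y', add_mem hY hY', by simp [h, h', fromBlocks_add]⟩
  zero_mem' := ⟨0, zero_mem _, by simp⟩
  smul_mem' := by
    rintro c X ⟨Y, hY, h⟩
    exact ⟨c • Y, (soAlg (Fin n)).smul_mem c hY, by simp [h, fromBlocks_smul]⟩
  lie_mem' := by
    rintro X X' ⟨Y, hY, h⟩ ⟨Y', hY', h'⟩
    refine ⟨⁅Y, Y'⁆, (soAlg (Fin n)).lie_mem hY hY', ?_⟩
    rw [LieSubalgebra.coe_bracket, h, h']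
    simp [Ring.lie_def, fromBlocks_multiply, sub_eq_add_neg, fromBlocks_neg, fromBlocks_add]

/-- The nerve of `SO(n + k) / SO(n)`, a subset of the endomorphisms of `𝔰𝔬(n + k)`. -/
noncomputable def nerveSO :
    Set (soAlg (Fin k ⊕ Fin n) →L[ℝ] soAlg (Fin k ⊕ Fin n)) :=
  nerve (traceForm (Fin k ⊕ Fin n)) (blockAlg k n)
    ((adSO (Fin k ⊕ Fin n)).comp (blockSO k n))

end Orthogonal

/-- Singular homology `H_q(X; R)` of a topological space with coefficients in a ring. -/
noncomputable def singularHomology (R : Type) [CommRing R] (q : ℕ) (X : Type)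
    [TopologicalSpace X] : ModuleCat.{0} R :=
  (((AlgebraicTopology.singularHomologyFunctor (ModuleCat.{0} R) q).obj
    (ModuleCat.of R R)).obj (TopCat.of X))

end Homogeneous

/-! Let W be a proper non-zero subspace of ℝᵏ and p the orthogonal projection with kernel W. Then
𝔰𝔬(W ⊕ ℝⁿ) is a non-toral intermediate subalgebra, and its projection is `projOf (hat p)`. Convex
combinations of these along flags of subspaces form the compact set `frameSphere`, which is the
required sphere.

To see that it is a sphere, look at the block ℝᵏ ⊗ ℝⁿ of 𝔪. A projection of the nerve commutes with
𝔰𝔬(n), and for n ≥ 3 it therefore acts there as a symmetric k × k matrix on the left factor, its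
`symbol`. A point of `frameSphere` with frame g and weights c has as symbol the matrix with
eigenvectors g and eigenvalues the partial sums of c, so its least eigenvalue is 0 and its greatest
is 1. The symbol determines the point (`flagEnd_eq_of_symbol_eq`). By the spectral theorem every
non-scalar symmetric matrix is, up to adding scalars and positive rescaling, exactly one such symbol
(`exists_partialSum`, `eq_of_symCoord_smul`). Hence `frameSphere` meets each open ray of Sym(k)/ℝ·1
once, and this space has dimension k(k+1)/2 - 1.

To find interior points, note that a simple spectrum of the symbol is an open condition. Suppose a
point ∑ cᵢPᵢ of the nerve satisfies it. The symbols pᵢ form a decreasing chain of commuting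
idempotents, diagonal in one eigenframe. An upper left block X lying in ker Pᵢ also lies in ker Pⱼ
for j ≥ i, so it commutes with all these pⱼ; simplicity of the spectrum and skewness force pᵢX = 0
(`mul_eq_zero_of_commute`). So ker Pᵢ is exactly 𝔰𝔬(ker pᵢ ⊕ ℝⁿ), and the point belongs to
`frameSphere` (`mem_frameSphere_of_symbol_notMem`).

The rest is topology. If a sphere A in a Hausdorff space X has an interior point, then collapsing
the complement of a small cap around it extends to all of X and gives X → ℝᴺ ∖ 0. Its restriction to
A is homotopic to the standard inclusion of the sphere (`exists_domination`). The homology of ℝᴺ ∖ 0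
is thus a retract of that of X, which yields all the claims once ℝᴺ ∖ 0 is known to carry homology.
That is proved with explicit singular chains, by induction on N via subdivision and a Mayer–Vietoris
argument (`hasHole_punctured`), and then transported to categorical singular homology. -/

namespace SingularChains

/-! ### Augmented singular chains and abstract cones. -/

noncomputable section

open Finset

variable {R : Type} [CommRing R] {X Y Z : Type} [TopologicalSpace X] [TopologicalSpace Y]
  [TopologicalSpace Z] {n : ℕ}

/-- The topological simplex with `n` vertices (empty for `n = 0`). -/
abbrev Simp (n : ℕ) : Type := stdSimplex ℝ (Fin n)

/-- Singular chains on simplices with `n` vertices; `n = 0` gives the augmentation. -/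
abbrev Chain (R : Type) [CommRing R] (n : ℕ) (X : Type) [TopologicalSpace X] : Type :=
  C(Simp n, X) →₀ R

/-- The affine map of simplices induced by a map of the vertices. -/
def simpMap {m : ℕ} (f : Fin m → Fin n) : C(Simp m, Simp n) :=
  ⟨stdSimplex.map f, stdSimplex.continuous_map f⟩

lemma simpMap_comp {l m : ℕ} (g : Fin m → Fin n) (f : Fin l → Fin m) :
    (simpMap g).comp (simpMap f) = simpMap (g ∘ f) := by
  ext1 t; exact stdSimplex.map_comp_apply f g t

/-- The `i`-th face inclusion. -/
def face (i : Fin (n + 1)) : C(Simp n, Simp (n + 1)) := simpMap i.succAbove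

/-- The boundary of singular chains. -/
def bd : Chain R (n + 1) X →ₗ[R] Chain R n X :=
  Finsupp.linearCombination R fun σ : C(Simp (n + 1), X) =>
    ∑ i : Fin (n + 1), (-1 : R) ^ (i : ℕ) • Finsupp.single (σ.comp (face i)) 1

/-- The map on chains induced by a continuous map. -/
def push (f : C(X, Y)) : Chain R n X →ₗ[R] Chain R n Y := Finsupp.lmapDomain R R fun σ => f.comp σ

@[simp] lemma push_single (f : C(X, Y)) (σ : C(Simp n, X)) (r : R) :
    push f (Finsupp.single σ r) = Finsupp.single (f.comp σ) r := by simp [push]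

lemma bd_single (σ : C(Simp (n + 1), X)) :
    bd (Finsupp.single σ (1 : R)) =
      ∑ i : Fin (n + 1), (-1 : R) ^ (i : ℕ) • Finsupp.single (σ.comp (face i)) 1 := by
  simp [bd]

lemma push_push (g : C(Y, Z)) (f : C(X, Y)) (c : Chain R n X) :
    push g (push f c) = push (g.comp f) c := by
  suffices h : (push g).comp (push f) = push (R := R) (n := n) (g.comp f) from
    LinearMap.congr_fun h c
  ext σ : 2; simp [ContinuousMap.comp_assoc]

@[simp] lemma push_id (c : Chain R n X) : push (ContinuousMap.id X) c = c := by
  suffices h : push (ContinuousMap.id X) = (LinearMap.id : Chain R n X →ₗ[R] _) from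
    LinearMap.congr_fun h c
  ext σ : 2; simp

lemma bd_push (f : C(X, Y)) (c : Chain R (n + 1) X) : bd (push f c) = push f (bd c) := by
  suffices h : bd.comp (push f) = (push f).comp (bd (R := R) (n := n)) from LinearMap.congr_fun h c
  ext σ : 2; simp [bd_single, map_sum, ContinuousMap.comp_assoc]

lemma succAbove_comp_succAbove {i : Fin (n + 2)} {j : Fin (n + 1)} (h : (i : ℕ) ≤ j) :
    i.succAbove ∘ j.succAbove = j.succ.succAbove ∘ (i.castLT (by omega)).succAbove := by
  funext x
  simp only [Function.comp, Fin.ext_iff, Fin.succAbove, Fin.lt_def]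
  split_ifs <;> simp_all <;> omega

/-- The double faces cancel in pairs: (i, j) with i ≤ j and (j + 1, i) give the same face with
opposite signs. -/
lemma bd_bd (c : Chain R (n + 2) X) : bd (bd c) = 0 := by
  suffices h : bd.comp (bd (R := R) (n := n + 1) (X := X)) = 0 from LinearMap.congr_fun h c
  ext σ : 2
  simp only [LinearMap.comp_apply, Finsupp.lsingle_apply, bd_single, map_sum, map_smul,
    LinearMap.zero_apply, Finset.smul_sum, smul_smul, face, ContinuousMap.comp_assoc, simpMap_comp]
  rw [← Finset.sum_product' (f := fun (i : Fin (n + 2)) (j : Fin (n + 1)) =>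
    ((-1 : R) ^ (i : ℕ) * (-1) ^ (j : ℕ)) •
      Finsupp.single (σ.comp (simpMap (i.succAbove ∘ j.succAbove))) (1 : R))]
  let S : Finset (Fin (n + 2) × Fin (n + 1)) := {ij | (ij.1 : ℕ) ≤ (ij.2 : ℕ)}
  rw [Finset.univ_product_univ, ← Finset.sum_add_sum_compl S, ← eq_neg_iff_add_eq_zero,
    ← Finset.sum_neg_distrib]
  have hlt : ∀ ij ∈ S, (ij.1 : ℕ) < n + 1 := fun ij h => by
    have := (Finset.mem_filter.mp h).2; omega
  refine Finset.sum_bij (fun ij h => (ij.2.succ, ij.1.castLT (hlt ij h))) ?_ ?_ ?_ ?_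
  · intro ij h
    have := (Finset.mem_filter.mp h).2
    simp [S]; omega
  · rintro ⟨i, j⟩ h ⟨i', j'⟩ h' e
    simp only [Prod.mk.injEq, Fin.ext_iff, Fin.val_succ, Fin.val_castLT] at e ⊢
    omega
  · rintro ⟨i, j⟩ h
    have h' : (j : ℕ) < i := by simpa [S] using h
    refine ⟨(j.castSucc, i.pred (by rintro rfl; simp at h')), ?_, ?_⟩
    · simp [S]; omega
    · simp
  · rintro ⟨i, j⟩ h
    have h' := (Finset.mem_filter.mp h).2
    dsimp only
    rw [succAbove_comp_succAbove h', ← neg_smul]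
    congr 1
    simp only [Fin.val_succ, Fin.val_castLT]; ring

/-- The chains all of whose simplices have image in `S`. -/
def chainsIn (R : Type) [CommRing R] (n : ℕ) (S : Set X) : Submodule R (Chain R n X) :=
  Finsupp.supported R R {σ | Set.range σ ⊆ S}

lemma chainsIn_mono {S S' : Set X} (h : S ⊆ S') : chainsIn R n S ≤ chainsIn R n S' :=
  Finsupp.supported_mono fun _ hσ => hσ.trans h

lemma mem_chainsIn_inter {S S' : Set X} {c : Chain R n X} (h : c ∈ chainsIn R n S)
    (h' : c ∈ chainsIn R n S') : c ∈ chainsIn R n (S ∩ S') := by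
  rw [chainsIn, Finsupp.mem_supported] at *
  exact fun σ hσ => Set.subset_inter (h hσ) (h' hσ)

lemma single_mem_chainsIn {S : Set X} {σ : C(Simp n, X)} (h : Set.range σ ⊆ S) (r : R) :
    Finsupp.single σ r ∈ chainsIn R n S := Finsupp.single_mem_supported _ _ h

lemma mem_chainsIn_of_basis {M : Type*} [AddCommGroup M] [Module R M] {S : Set X} {c : Chain R n X}
    (hc : c ∈ chainsIn R n S) (f : Chain R n X →ₗ[R] M) (N : Submodule R M)
    (h : ∀ σ : C(Simp n, X), Set.range σ ⊆ S → f (Finsupp.single σ 1) ∈ N) : f c ∈ N := by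
  suffices chainsIn R n S ≤ N.comap f from this hc
  rw [chainsIn, Finsupp.supported_eq_span_single, Submodule.span_le]
  rintro _ ⟨σ, hσ, rfl⟩
  exact h σ hσ

lemma push_mem_chainsIn {f : C(X, Y)} {S : Set X} {S' : Set Y} (h : Set.MapsTo f S S')
    {c : Chain R n X} (hc : c ∈ chainsIn R n S) : push f c ∈ chainsIn R n S' := by
  refine mem_chainsIn_of_basis hc _ _ fun σ hσ => ?_
  rw [push_single]
  refine single_mem_chainsIn ?_ _
  rintro _ ⟨t, rfl⟩
  exact h (hσ ⟨t, rfl⟩)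

lemma push_mem_chainsIn_of_range {f : C(X, Y)} {S : Set Y} (h : Set.range f ⊆ S)
    (c : Chain R n X) : push f c ∈ chainsIn R n S :=
  push_mem_chainsIn (S := Set.univ) (fun x _ => h ⟨x, rfl⟩) (by
    rw [chainsIn, Finsupp.mem_supported]; exact fun _ _ => Set.subset_univ _)

lemma bd_mem_chainsIn {S : Set X} {c : Chain R (n + 1) X} (hc : c ∈ chainsIn R (n + 1) S) :
    bd c ∈ chainsIn R n S := by
  refine mem_chainsIn_of_basis hc _ _ fun σ hσ => ?_
  rw [bd_single]
  refine Submodule.sum_mem _ fun i _ => Submodule.smul_mem _ _ (single_mem_chainsIn ?_ _)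
  rintro _ ⟨t, rfl⟩
  exact hσ ⟨_, rfl⟩

/-- Cycles for the augmented complex. -/
def IsCycle : ∀ {n : ℕ}, Chain R n X → Prop
  | 0, _ => True
  | _ + 1, z => bd z = 0

lemma IsCycle.push {f : C(X, Y)} {z : Chain R n X} (h : IsCycle z) : IsCycle (push f z) := by
  cases n with
  | zero => trivial
  | succ n => simp only [IsCycle] at *; rw [bd_push, h, map_zero]

lemma isCycle_bd (c : Chain R (n + 1) X) : IsCycle (bd c) := by
  cases n with
  | zero => trivial
  | succ n => exact bd_bd c

/-! ### Cones -/

/-- A way of coning off singular simplices. -/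
structure Coning (X : Type) [TopologicalSpace X] where
  /-- the cone over a simplex -/
  cone : ∀ {n : ℕ}, C(Simp n, X) → C(Simp (n + 1), X)
  cone_face_zero : ∀ {n : ℕ} (σ : C(Simp n, X)), (cone σ).comp (face 0) = σ
  cone_face_succ : ∀ {n : ℕ} (σ : C(Simp (n + 1), X)) (i : Fin (n + 1)),
    (cone σ).comp (face i.succ) = cone (σ.comp (face i))

/-- The cone operator on chains. -/
def Coning.map (K : Coning X) : Chain R n X →ₗ[R] Chain R (n + 1) X :=
  Finsupp.lmapDomain R R fun σ => K.cone σ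

@[simp] lemma Coning.map_single (K : Coning X) (σ : C(Simp n, X)) (r : R) :
    K.map (Finsupp.single σ r) = Finsupp.single (K.cone σ) r := by simp [Coning.map]

lemma Coning.bd_map (K : Coning X) (c : Chain R (n + 1) X) : bd (K.map c) = c - K.map (bd c) := by
  suffices h : bd.comp (K.map (R := R) (n := n + 1)) = LinearMap.id - K.map.comp bd from
    LinearMap.congr_fun h c
  ext σ : 2
  simp only [LinearMap.comp_apply, Finsupp.lsingle_apply, K.map_single, bd_single, map_sum,
    map_smul, LinearMap.sub_apply, LinearMap.id_apply]
  rw [Fin.sum_univ_succ]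
  simp only [K.cone_face_zero, K.cone_face_succ, Fin.val_zero, pow_zero, one_smul, Fin.val_succ,
    pow_succ, mul_neg, mul_one, neg_smul, Finset.sum_neg_distrib, sub_eq_add_neg]

/-- In the augmented degree there is no boundary term: the cone over the empty simplex is a point,
whose only face is the empty simplex. -/
lemma Coning.bd_map_zero (K : Coning X) (c : Chain R 0 X) : bd (K.map c) = c := by
  suffices h : bd.comp (K.map (R := R) (n := 0)) = LinearMap.id from LinearMap.congr_fun h c
  ext σ : 2
  simp [bd_single, K.cone_face_zero]

lemma Coning.bd_map_of_isCycle (K : Coning X) {c : Chain R n X} (hc : IsCycle c) :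
    bd (K.map c) = c := by
  cases n with
  | zero => exact K.bd_map_zero c
  | succ n => rw [K.bd_map, show bd c = 0 from hc]; simp

end

end SingularChains

/-! ### Cones in normed spaces and barycentric subdivision. -/

namespace SingularChains

noncomputable section

open Finset Filter Topology

variable {R : Type} [CommRing R] {X Y Z : Type} [TopologicalSpace X] [TopologicalSpace Y]
  [TopologicalSpace Z] {n : ℕ}
variable {E F : Type} [NormedAddCommGroup E] [NormedSpace ℝ E]
  [NormedAddCommGroup F] [NormedSpace ℝ F]

lemma simpMap_apply_of_injective {m : ℕ} {f : Fin m → Fin n} (hf : Function.Injective f) (t : Simp m)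
    (j : Fin m) : simpMap f t (f j) = t j := by
  change FunOnFinite.linearMap ℝ ℝ f t (f j) = t j
  rw [FunOnFinite.linearMap_apply_apply, Finset.sum_eq_single j] <;> simp +contextual [hf.eq_iff]

lemma simpMap_apply_of_notMem {m : ℕ} {f : Fin m → Fin n} {i : Fin n} (h : ∀ j, f j ≠ i)
    (t : Simp m) : simpMap f t i = 0 := by
  change FunOnFinite.linearMap ℝ ℝ f t i = 0
  rw [FunOnFinite.linearMap_apply_apply]
  exact Finset.sum_eq_zero fun j hj => by simp [h j] at hj

lemma face_apply_succAbove (i : Fin (n + 1)) (t : Simp n) (j : Fin n) :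
    face i t (i.succAbove j) = t j := simpMap_apply_of_injective Fin.succAbove_right_injective t j

lemma face_apply_self (i : Fin (n + 1)) (t : Simp n) : face i t i = 0 :=
  simpMap_apply_of_notMem (fun j => Fin.succAbove_ne i j) t

lemma face_zero_apply_succ (t : Simp n) (j : Fin n) : face 0 t j.succ = t j := by
  simpa using face_apply_succAbove 0 t j

lemma sum_tail (t : Simp (n + 1)) : ∑ j : Fin n, t j.succ = 1 - t 0 := by
  have := stdSimplex.sum_eq_one t
  rw [Fin.sum_univ_succ] at this
  linarith

/-- Projection of a simplex from its first vertex to the opposite face. -/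
def tailProj (t : Simp (n + 1)) (h : t 0 ≠ 1) : Simp n :=
  ⟨fun j => t j.succ / (1 - t 0), fun j =>
    div_nonneg (stdSimplex.zero_le t _) (sub_nonneg.2 (stdSimplex.le_one t _)), by
    rw [← Finset.sum_div, sum_tail, div_self (sub_ne_zero.2 h.symm)]⟩

@[simp] lemma tailProj_apply (t : Simp (n + 1)) (h : t 0 ≠ 1) (j : Fin n) :
    tailProj t h j = t j.succ / (1 - t 0) := rfl

open Classical in
/-- The point set map of a cone. -/
def coneFun (b : E) (σ : C(Simp n, E)) (t : Simp (n + 1)) : E :=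
  if h : t 0 = 1 then b else t 0 • b + (1 - t 0) • σ (tailProj t h)

lemma coneFun_of_ne (b : E) (σ : C(Simp n, E)) {t : Simp (n + 1)} (h : t 0 ≠ 1) :
    coneFun b σ t = t 0 • b + (1 - t 0) • σ (tailProj t h) := dif_neg h

lemma continuous_coord (i : Fin n) : Continuous fun t : Simp n => t i :=
  (continuous_apply i).comp continuous_subtype_val

lemma continuous_coneFun (b : E) (σ : C(Simp n, E)) : Continuous (coneFun b σ) := by
  rw [continuous_iff_continuousAt]
  intro t
  by_cases h : t 0 = 1
  -- At the apex the projection to the opposite face has no limit, but `σ` is bounded on the compact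
  -- simplex and its weight `1 - t 0` tends to 0.
  · obtain ⟨M, hM⟩ := (isCompact_range ((σ.continuous.sub continuous_const).norm
      (E := E) (f := fun x => σ x - b))).bddAbove
    have hbound : ∀ s : Simp (n + 1), ‖coneFun b σ s - b‖ ≤ (1 - s 0) * max M 0 := by
      intro s
      have h1 : 0 ≤ 1 - s 0 := sub_nonneg.2 (stdSimplex.le_one s _)
      by_cases hs : s 0 = 1
      · simp [coneFun, hs]
      · rw [coneFun_of_ne b σ hs, show s 0 • b + (1 - s 0) • σ (tailProj s hs) - b =
          (1 - s 0) • (σ (tailProj s hs) - b) by module, norm_smul, Real.norm_of_nonneg h1]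
        exact mul_le_mul_of_nonneg_left ((hM ⟨_, rfl⟩).trans (le_max_left _ _)) h1
    have ht : coneFun b σ t = b := dif_pos h
    rw [ContinuousAt, ht, tendsto_iff_norm_sub_tendsto_zero]
    refine squeeze_zero (fun _ => norm_nonneg _) hbound ?_
    have : Tendsto (fun s : Simp (n + 1) => (1 - s 0) * max M 0) (𝓝 t)
        (𝓝 ((1 - t 0) * max M 0)) :=
      (((continuous_const.sub (continuous_coord 0)).mul continuous_const).tendsto t)
    simpa [h] using this
  · have hopen : IsOpen {s : Simp (n + 1) | s 0 ≠ 1} :=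
      isOpen_ne_fun (continuous_coord 0) continuous_const
    refine ContinuousOn.continuousAt (s := {s | s 0 ≠ 1}) ?_ (hopen.mem_nhds h)
    rw [continuousOn_iff_continuous_domRestrict]
    have : Set.domRestrict {s : Simp (n + 1) | s 0 ≠ 1} (coneFun b σ) = fun s =>
        s.1 0 • b + (1 - s.1 0) • σ (tailProj s.1 s.2) := by
      funext s; exact coneFun_of_ne b σ s.2
    rw [this]
    have hc : ∀ i : Fin (n + 1), Continuous fun s : {s : Simp (n + 1) | s 0 ≠ 1} =>
      (s : Simp (n + 1)) i := fun i => (continuous_coord i).comp continuous_subtype_val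
    refine ((hc 0).smul continuous_const).add ((continuous_const.sub (hc 0)).smul
      (σ.continuous.comp ?_))
    refine Continuous.subtype_mk (continuous_pi fun j => ?_) _
    exact (hc j.succ).div (continuous_const.sub (hc 0)) fun s => sub_ne_zero.2 (Ne.symm s.2)

lemma coneFun_mem {S : Set E} {b : E} (hS : StarConvex ℝ b S) (hb : b ∈ S) {σ : C(Simp n, E)}
    (hσ : Set.range σ ⊆ S) (t : Simp (n + 1)) : coneFun b σ t ∈ S := by
  by_cases h : t 0 = 1
  · simpa [coneFun, h] using hb
  · rw [coneFun_of_ne b σ h]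
    exact hS (hσ ⟨_, rfl⟩) (stdSimplex.zero_le t _) (sub_nonneg.2 (stdSimplex.le_one t _)) (by ring)

lemma coneFun_face_zero (b : E) (σ : C(Simp n, E)) (t : Simp n) :
    coneFun b σ (face 0 t) = σ t := by
  have h : face 0 t 0 = 0 := face_apply_self 0 t
  have h' : face 0 t 0 ≠ 1 := by rw [h]; exact zero_ne_one
  rw [coneFun_of_ne b σ h', show tailProj (face 0 t) h' = t from ?_, h]
  · simp
  · ext j; rw [tailProj_apply, h, face_zero_apply_succ]; simp

lemma coneFun_face_succ (b : E) (σ : C(Simp (n + 1), E)) (i : Fin (n + 1)) (t : Simp (n + 1)) :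
    coneFun b σ (face i.succ t) = coneFun b (σ.comp (face i)) t := by
  have h : face i.succ t 0 = t 0 := by simpa using face_apply_succAbove i.succ t 0
  by_cases ht : t 0 = 1
  · simp [coneFun, h, ht]
  · have h' : face i.succ t 0 ≠ 1 := by rwa [h]
    rw [coneFun_of_ne b σ h', coneFun_of_ne b _ ht, h, ContinuousMap.comp_apply]
    congr 3
    ext j
    rw [tailProj_apply, h]
    rcases Fin.eq_self_or_eq_succAbove i j with rfl | ⟨j', rfl⟩
    · rw [face_apply_self, face_apply_self]; simp
    · rw [face_apply_succAbove, tailProj_apply, ← Fin.succ_succAbove_succ, face_apply_succAbove]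

/-- Coning to a point in a set that is star-shaped about it. -/
def starConing {S : Set E} {b : E} (hS : StarConvex ℝ b S) (hb : b ∈ S) : Coning S where
  cone σ := ⟨fun t => ⟨coneFun b ((⟨Subtype.val, continuous_subtype_val⟩ : C(S, E)).comp σ) t,
    coneFun_mem hS hb (by rintro _ ⟨t, rfl⟩; exact (σ t).2) t⟩, (continuous_coneFun _ _).subtype_mk _⟩
  cone_face_zero σ := by
    ext t; exact coneFun_face_zero b _ t
  cone_face_succ σ i := by
    ext t; exact coneFun_face_succ b _ i t

/-- Coning to a point of a normed space. -/
def coning (b : E) : Coning E where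
  cone σ := ⟨coneFun b σ, continuous_coneFun _ _⟩
  cone_face_zero σ := by ext t; exact coneFun_face_zero b _ t
  cone_face_succ σ i := by ext t; exact coneFun_face_succ b _ i t

lemma coning_map_mem_chainsIn {S : Set E} {b : E} (hS : StarConvex ℝ b S) (hb : b ∈ S)
    {c : Chain R n E} (hc : c ∈ chainsIn R n S) : (coning b).map c ∈ chainsIn R (n + 1) S := by
  refine mem_chainsIn_of_basis hc _ _ fun σ hσ => ?_
  rw [Coning.map_single]
  refine single_mem_chainsIn ?_ _
  rintro _ ⟨t, rfl⟩
  exact coneFun_mem hS hb hσ t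

/-! ### Barycentric subdivision -/

/-- Coning to the barycenter of a simplex. -/
def baryConing (n : ℕ) : Coning (Simp (n + 1)) :=
  starConing ((convex_stdSimplex ℝ (Fin (n + 1))).starConvex (stdSimplex.barycenter).2)
    (stdSimplex.barycenter (𝕜 := ℝ) (X := Fin (n + 1))).2

/-- The subdivided simplex. -/
def subdivSimp (R : Type) [CommRing R] : ∀ n, Chain R n (Simp n)
  | 0 => Finsupp.single (ContinuousMap.id _) 1
  | n + 1 => (baryConing n).map (∑ i : Fin (n + 1), (-1 : R) ^ (i : ℕ) •
      push (face i) (subdivSimp R n))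

/-- The natural operator on singular chains with given values on the standard simplices. -/
def natOp {m : ℕ} (s : Chain R m (Simp n)) : Chain R n X →ₗ[R] Chain R m X :=
  Finsupp.linearCombination R fun σ : C(Simp n, X) => push σ s

@[simp] lemma natOp_single {m : ℕ} (s : Chain R m (Simp n)) (σ : C(Simp n, X)) :
    natOp s (Finsupp.single σ (1 : R)) = push σ s := by simp [natOp]

lemma natOp_push {m : ℕ} (s : Chain R m (Simp n)) (f : C(X, Y)) (c : Chain R n X) :
    natOp s (push f c) = push f (natOp s c) := by
  suffices h : (natOp s).comp (push f) = (push f).comp (natOp s) from LinearMap.congr_fun h c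
  ext σ : 2; simp [push_push]

lemma natOp_mem_chainsIn {m : ℕ} (s : Chain R m (Simp n)) {S : Set X} {c : Chain R n X}
    (hc : c ∈ chainsIn R n S) : natOp s c ∈ chainsIn R m S := by
  refine mem_chainsIn_of_basis hc _ _ fun σ hσ => ?_
  rw [natOp_single]
  exact push_mem_chainsIn_of_range hσ _

lemma natOp_bd_single {m : ℕ} (s : Chain R m (Simp n)) (σ : C(Simp (n + 1), X)) :
    natOp s (bd (Finsupp.single σ (1 : R))) =
      push σ (∑ i : Fin (n + 1), (-1 : R) ^ (i : ℕ) • push (face i) s) := by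
  simp only [bd_single, map_sum, map_smul, natOp_single, push_push]

/-- Barycentric subdivision of singular chains. -/
def subdiv : Chain R n X →ₗ[R] Chain R n X := natOp (subdivSimp R n)

lemma single_eq_push {m : ℕ} (σ : C(Simp m, X)) :
    Finsupp.single σ (1 : R) = push σ (Finsupp.single (ContinuousMap.id _) 1) := by simp

lemma subdivSimp_succ (n : ℕ) : subdivSimp R (n + 1) =
    (baryConing n).map (subdiv (bd (Finsupp.single (ContinuousMap.id _) 1))) := by
  rw [subdiv, natOp_bd_single, push_id, subdivSimp]

/-- By naturality, a boundary formula for such an operator need only be checked on the universal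
simplex and pushed forward along each `σ`. -/
lemma bd_natOp_of_bd {m : ℕ} {s : Chain R (m + 1) (Simp n)} {T : Chain R n X →ₗ[R] Chain R m X}
    (h : ∀ σ : C(Simp n, X), push σ (bd s) = T (Finsupp.single σ 1)) (c : Chain R n X) :
    bd (natOp s c) = T c := by
  suffices h : bd.comp (natOp s) = T from LinearMap.congr_fun h c
  ext σ : 2; simp [← h, bd_push]

lemma bd_subdiv (c : Chain R (n + 1) X) : bd (subdiv c) = subdiv (bd c) := by
  induction n generalizing X with
  | zero =>
    refine bd_natOp_of_bd (T := subdiv.comp bd) (fun σ => ?_) c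
    rw [subdivSimp_succ, Coning.bd_map_zero, LinearMap.comp_apply, single_eq_push σ, bd_push]
    exact (natOp_push _ _ _).symm
  | succ n ih =>
    refine bd_natOp_of_bd (T := subdiv.comp bd) (fun σ => ?_) c
    rw [subdivSimp_succ, Coning.bd_map, ih, bd_bd, LinearMap.comp_apply, single_eq_push σ, bd_push]
    simp only [map_zero, sub_zero]
    exact (natOp_push _ _ _).symm

lemma subdiv_zero (c : Chain R 0 X) : subdiv c = c := by
  suffices h : subdiv (R := R) (X := X) (n := 0) = LinearMap.id from LinearMap.congr_fun h c
  ext σ : 2; simp [subdiv, subdivSimp]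

lemma IsCycle.subdiv {c : Chain R n X} (hc : IsCycle c) : IsCycle (subdiv c) := by
  cases n with
  | zero => trivial
  | succ n => simp only [IsCycle] at *; rw [bd_subdiv, hc, map_zero]

/-- The homotopy between subdivision and the identity, on the standard simplices. -/
def subdivHomotopySimp (R : Type) [CommRing R] : ∀ n, Chain R (n + 1) (Simp n)
  | 0 => 0
  -- The coned chain is a cycle by the homotopy formula one degree lower, so its cone has it as
  -- boundary; this is the formula in the present degree.
  | n + 1 => (baryConing n).map (subdivSimp R (n + 1) - Finsupp.single (ContinuousMap.id _) 1 -
      natOp (subdivHomotopySimp R n) (bd (Finsupp.single (ContinuousMap.id _) 1)))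

/-- The homotopy between subdivision and the identity. -/
def subdivHomotopy : Chain R n X →ₗ[R] Chain R (n + 1) X := natOp (subdivHomotopySimp R n)

lemma subdivHomotopySimp_succ : subdivHomotopySimp R (n + 1) = (baryConing n).map
    (subdiv (Finsupp.single (ContinuousMap.id _) 1) - Finsupp.single (ContinuousMap.id _) 1 -
      subdivHomotopy (bd (Finsupp.single (ContinuousMap.id _) 1))) := by
  rw [subdivHomotopySimp, subdiv, natOp_single, push_id, subdivHomotopy]

lemma bd_subdivHomotopy_zero (c : Chain R 0 X) : bd (subdivHomotopy c) = 0 := by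
  refine bd_natOp_of_bd (T := 0) (fun σ => ?_) c
  simp [subdivHomotopySimp]

lemma bd_subdivHomotopy (c : Chain R (n + 1) X) :
    bd (subdivHomotopy c) = subdiv c - c - subdivHomotopy (bd c) := by
  induction n generalizing X with
  | zero =>
    refine bd_natOp_of_bd (T := subdiv - LinearMap.id - subdivHomotopy.comp bd) (fun σ => ?_) c
    rw [subdivHomotopySimp_succ, Coning.bd_map]
    simp only [map_sub, bd_subdivHomotopy_zero, bd_subdiv, subdiv_zero, sub_self, map_zero,
      sub_zero, LinearMap.sub_apply, LinearMap.comp_apply, LinearMap.id_apply]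
    rw [single_eq_push σ, bd_push]
    simp only [subdiv, subdivHomotopy, natOp_push]
  | succ n ih =>
    refine bd_natOp_of_bd (T := subdiv - LinearMap.id - subdivHomotopy.comp bd) (fun σ => ?_) c
    rw [subdivHomotopySimp_succ, Coning.bd_map]
    simp only [map_sub, ih, bd_subdiv, bd_bd, sub_self, map_zero,
      sub_zero, LinearMap.sub_apply, LinearMap.comp_apply, LinearMap.id_apply]
    rw [single_eq_push σ, bd_push]
    simp only [subdiv, subdivHomotopy, natOp_push]

lemma subdiv_mem_chainsIn {S : Set X} {c : Chain R n X} (hc : c ∈ chainsIn R n S) :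
    subdiv c ∈ chainsIn R n S := natOp_mem_chainsIn _ hc

lemma iterate_subdiv_mem_chainsIn {S : Set X} {c : Chain R n X} (hc : c ∈ chainsIn R n S) (m : ℕ) :
    subdiv^[m] c ∈ chainsIn R n S := by
  induction m with
  | zero => exact hc
  | succ m ih => rw [Function.iterate_succ_apply']; exact subdiv_mem_chainsIn ih

lemma bd_iterate_subdiv (c : Chain R (n + 1) X) (m : ℕ) :
    bd (subdiv^[m] c) = subdiv^[m] (bd c) := by
  induction m with
  | zero => rfl
  | succ m ih => rw [Function.iterate_succ_apply', Function.iterate_succ_apply', bd_subdiv, ih]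

lemma exists_bd_eq_subdiv_sub {S : Set X} {c : Chain R n X} (hc : c ∈ chainsIn R n S)
    (h : IsCycle c) : ∃ w ∈ chainsIn R (n + 1) S, bd w = subdiv c - c := by
  refine ⟨subdivHomotopy c, natOp_mem_chainsIn _ hc, ?_⟩
  cases n with
  | zero => rw [bd_subdivHomotopy_zero, subdiv_zero, sub_self]
  | succ n => rw [bd_subdivHomotopy, show bd c = 0 from h]; simp

lemma exists_bd_eq_iterate_subdiv_sub {S : Set X} {c : Chain R n X} (hc : c ∈ chainsIn R n S)
    (h : IsCycle c) (m : ℕ) : ∃ w ∈ chainsIn R (n + 1) S, bd w = subdiv^[m] c - c := by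
  induction m generalizing c with
  | zero => exact ⟨0, Submodule.zero_mem _, by simp⟩
  | succ m ih =>
    obtain ⟨w, hw, e⟩ := ih (subdiv_mem_chainsIn hc) h.subdiv
    obtain ⟨w', hw', e'⟩ := exists_bd_eq_subdiv_sub hc h
    exact ⟨w + w', Submodule.add_mem _ hw hw', by rw [map_add, e, e', Function.iterate_succ_apply]; abel⟩

end

end SingularChains

/-! ### Small simplices, Mayer–Vietoris and the homology of the punctured space. -/

namespace SingularChains

noncomputable section

open Finset Filter Topology

variable {R : Type} [CommRing R] {X Y Z : Type} [TopologicalSpace X] [TopologicalSpace Y]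
  [TopologicalSpace Z] {n : ℕ}
variable {E F : Type} [NormedAddCommGroup E] [NormedSpace ℝ E]
  [NormedAddCommGroup F] [NormedSpace ℝ F]

/-! ### Small simplices -/

/-- The affine simplex with given vertices. -/
def affSimplex (v : Fin n → E) : C(Simp n, E) :=
  ⟨fun t => ∑ i, t i • v i,
    continuous_finsetSum _ fun i _ => (continuous_coord i).smul continuous_const⟩

lemma affSimplex_apply (v : Fin n → E) (t : Simp n) : affSimplex v t = ∑ i, t i • v i := rfl

lemma affSimplex_comp_face (v : Fin (n + 1) → E) (i : Fin (n + 1)) :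
    (affSimplex v).comp (face i) = affSimplex (v ∘ i.succAbove) := by
  ext t
  simp [affSimplex_apply, Fin.sum_univ_succAbove _ i, face_apply_self, face_apply_succAbove]

lemma affSimplex_mem_convexHull (v : Fin n → E) (t : Simp n) :
    affSimplex v t ∈ convexHull ℝ (Set.range v) :=
  (convex_convexHull ℝ _).sum_mem (fun i _ => stdSimplex.zero_le t i) (stdSimplex.sum_eq_one t)
    fun i _ => subset_convexHull ℝ _ ⟨i, rfl⟩

lemma coning_cone_affSimplex (b : E) (w : Fin n → E) :
    (coning b).cone (affSimplex w) = affSimplex (Fin.cons b w : Fin (n + 1) → E) := by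
  ext t
  change coneFun b (affSimplex w) t = _
  rw [affSimplex_apply, Fin.sum_univ_succ]
  by_cases h : t 0 = 1
  · have h0 : ∀ j : Fin n, t j.succ = 0 := by
      have := sum_tail t
      rw [h, sub_self, Finset.sum_eq_zero_iff_of_nonneg fun j _ => stdSimplex.zero_le t _] at this
      exact fun j => this j (Finset.mem_univ j)
    simp [coneFun, h, h0]
  · rw [coneFun_of_ne _ _ h, affSimplex_apply, Finset.smul_sum]
    simp [smul_smul, mul_div_cancel₀ _ (sub_ne_zero.2 (Ne.symm h))]

lemma affSimplex_coneFun (v : Fin (n + 1) → E) {m : ℕ} (b : Simp (n + 1))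
    (τ : C(Simp m, Simp (n + 1))) (t : Simp (m + 1)) (s : Simp (n + 1))
    (hs : (s : Fin (n + 1) → ℝ) = coneFun (b : Fin (n + 1) → ℝ)
      ((⟨Subtype.val, continuous_subtype_val⟩ : C(Simp (n + 1), Fin (n + 1) → ℝ)).comp τ) t) :
    affSimplex v s = coneFun (affSimplex v b) ((affSimplex v).comp τ) t := by
  have hs' : ∀ i, s i = coneFun (b : Fin (n + 1) → ℝ)
    ((⟨Subtype.val, continuous_subtype_val⟩ : C(Simp (n + 1), Fin (n + 1) → ℝ)).comp τ) t i :=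
    congrFun hs
  simp only [affSimplex_apply, hs']
  by_cases h : t 0 = 1
  · simp only [coneFun, h, dif_pos]
  · simp only [coneFun_of_ne _ _ h, Pi.add_apply, Pi.smul_apply, smul_eq_mul, add_smul, mul_smul,
      Finset.sum_add_distrib, ← Finset.smul_sum]
    rfl

lemma push_affSimplex_baryConing_map (v : Fin (n + 1) → E) {m : ℕ} (c : Chain R m (Simp (n + 1))) :
    push (affSimplex v) ((baryConing n).map c) =
      (coning (affSimplex v stdSimplex.barycenter)).map (push (affSimplex v) c) := by
  suffices h : (push (affSimplex v)).comp ((baryConing n).map) =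
      ((coning (affSimplex v stdSimplex.barycenter)).map).comp
        (push (R := R) (n := m) (affSimplex v)) from LinearMap.congr_fun h c
  ext τ : 2
  simp only [LinearMap.comp_apply, Finsupp.lsingle_apply, Coning.map_single, push_single]
  congr 1
  ext t
  exact affSimplex_coneFun v stdSimplex.barycenter τ t _ rfl

/-- Affine simplices with vertices in `S` at pairwise distance at most `d`. -/
def affSet (n : ℕ) (S : Set E) (d : ℝ) : Set C(Simp n, E) :=
  {σ | ∃ v : Fin n → E, σ = affSimplex v ∧ (∀ j, v j ∈ S) ∧ ∀ i j, ‖v i - v j‖ ≤ d}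

lemma mem_supported_lmapDomain {α β : Type*} (f : α → β) {P : Set α} {Q : Set β}
    (h : ∀ a ∈ P, f a ∈ Q) {c : α →₀ R} (hc : c ∈ Finsupp.supported R R P) :
    Finsupp.lmapDomain R R f c ∈ Finsupp.supported R R Q := by
  have : Finsupp.lmapDomain R R f c ∈ (Finsupp.supported R R P).map (Finsupp.lmapDomain R R f) :=
    Submodule.mem_map_of_mem hc
  rw [Finsupp.lmapDomain_supported] at this
  exact Finsupp.supported_mono (by rintro _ ⟨a, ha, rfl⟩; exact h a ha) this

/-- The barycenter minus a vertex is 1/(n+1) times a sum of n edge vectors. Balls are convex, so the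
bound at the vertices extends to the hull. -/
lemma norm_barycenter_sub_le {v : Fin (n + 1) → E} {d : ℝ} (hv : ∀ i j, ‖v i - v j‖ ≤ d) {x : E}
    (hx : x ∈ convexHull ℝ (Set.range v)) :
    ‖affSimplex v stdSimplex.barycenter - x‖ ≤ n / (n + 1) * d := by
  have hn : (0 : ℝ) < n + 1 := by positivity
  suffices h : convexHull ℝ (Set.range v) ⊆
      Metric.closedBall (affSimplex v stdSimplex.barycenter) (n / (n + 1) * d) by
    have := h hx
    rwa [mem_closedBall_iff_norm'] at this
  refine convexHull_min ?_ (convex_closedBall _ _)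
  rintro _ ⟨k, rfl⟩
  rw [mem_closedBall_iff_norm']
  have hb : ∀ i, (stdSimplex.barycenter : Simp (n + 1)) i = ((n : ℝ) + 1)⁻¹ := fun i => by
    have := stdSimplex.barycenter_apply (𝕜 := ℝ) i
    rw [Fintype.card_fin] at this
    exact_mod_cast this
  have e : affSimplex v stdSimplex.barycenter - v k =
      ((n : ℝ) + 1)⁻¹ • ∑ j : Fin n, (v (k.succAbove j) - v k) := by
    rw [affSimplex_apply]
    simp only [hb, ← Finset.smul_sum, Finset.sum_sub_distrib]
    rw [Fin.sum_univ_succAbove _ k, Finset.sum_const, Finset.card_univ, Fintype.card_fin]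
    have : v k = ((n : ℝ) + 1)⁻¹ • ((n + 1 : ℝ) • v k) := by
      rw [smul_smul, inv_mul_cancel₀ hn.ne', one_smul]
    nth_rw 2 [this]
    rw [← smul_sub, ← Nat.cast_smul_eq_nsmul ℝ]
    congr 1; module
  rw [e, norm_smul, Real.norm_of_nonneg (by positivity), div_mul_eq_mul_div, inv_mul_eq_div]
  gcongr
  calc ‖∑ j : Fin n, (v (k.succAbove j) - v k)‖ ≤ ∑ j : Fin n, ‖v (k.succAbove j) - v k‖ :=
        norm_sum_le _ _
    _ ≤ ∑ _j : Fin n, d := Finset.sum_le_sum fun j _ => hv _ _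
    _ = n * d := by simp

/-- The sharp contraction factor for n + 1 vertices is n/(n+1). The weaker factor n/(n+1) is used
for n vertices, as it makes sense at n = 0; this is the loss incurred. -/
lemma div_succ_mul_le_div_succ_mul {d : ℝ} (hd : 0 ≤ d) :
    (n : ℝ) / (n + 1) * d ≤ ((n + 1 : ℕ) : ℝ) / ((n + 1 : ℕ) + 1) * d := by
  gcongr ?_ * d
  push_cast
  rw [div_le_div_iff₀ (by positivity) (by positivity)]
  nlinarith

lemma push_affSimplex_subdivSimp {v : Fin n → E} {d : ℝ} (hd : 0 ≤ d)
    (hv : ∀ i j, ‖v i - v j‖ ≤ d) : push (affSimplex v) (subdivSimp R n) ∈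
      Finsupp.supported R R (affSet n (convexHull ℝ (Set.range v)) (n / (n + 1) * d)) := by
  induction n with
  | zero =>
    rw [subdivSimp, push_single]
    exact Finsupp.single_mem_supported _ _ ⟨v, rfl, fun j => j.elim0, fun j => j.elim0⟩
  | succ n ih =>
    rw [subdivSimp, push_affSimplex_baryConing_map]
    refine mem_supported_lmapDomain (P := affSet n (convexHull ℝ (Set.range v)) (n / (n + 1) * d))
      _ ?_ ?_
    · rintro _ ⟨w, rfl, hw, hw'⟩
      refine ⟨_, coning_cone_affSimplex _ w, fun j => ?_, fun i j => ?_⟩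
      · refine Fin.cases ?_ (fun j => ?_) j
        · exact affSimplex_mem_convexHull v _
        · exact hw j
      · have hb := fun j => (norm_barycenter_sub_le hv (hw j)).trans (div_succ_mul_le_div_succ_mul hd)
        refine Fin.cases (Fin.cases ?_ (fun j => ?_) j) (fun i => Fin.cases ?_ (fun j => ?_) j) i
        · simp only [Fin.cons_zero, sub_self, norm_zero]; positivity
        · simpa using hb j
        · simpa [norm_sub_rev] using hb i
        · simpa using (hw' i j).trans (div_succ_mul_le_div_succ_mul hd)
    · rw [map_sum]
      refine Submodule.sum_mem _ fun i _ => ?_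
      rw [map_smul, push_push, affSimplex_comp_face]
      refine Submodule.smul_mem _ _ (Finsupp.supported_mono ?_
        (ih (v := v ∘ i.succAbove) fun j l => hv _ _))
      rintro _ ⟨w, rfl, hw, hw'⟩
      exact ⟨w, rfl, fun j => convexHull_mono (Set.range_comp_subset_range _ _) (hw j), hw'⟩

lemma subdiv_mem_supported_affSet {S : Set E} (hS : Convex ℝ S) {d : ℝ} (hd : 0 ≤ d)
    {c : Chain R n E} (hc : c ∈ Finsupp.supported R R (affSet n S d)) :
    subdiv c ∈ Finsupp.supported R R (affSet n S (n / (n + 1) * d)) := by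
  suffices h : Finsupp.supported R R (affSet n S d) ≤
      (Finsupp.supported R R (affSet n S (n / (n + 1) * d))).comap subdiv from h hc
  rw [Finsupp.supported_eq_span_single, Submodule.span_le]
  rintro _ ⟨_, ⟨v, rfl, hv, hv'⟩, rfl⟩
  rw [SetLike.mem_coe, Submodule.mem_comap, subdiv, natOp_single]
  refine Finsupp.supported_mono ?_ (push_affSimplex_subdivSimp hd hv')
  rintro _ ⟨w, rfl, hw, hw'⟩
  exact ⟨w, rfl, fun j => convexHull_min (by rintro _ ⟨i, rfl⟩; exact hv i) hS (hw j), hw'⟩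

lemma iterate_subdiv_mem_supported_affSet {S : Set E} (hS : Convex ℝ S) {d : ℝ} (hd : 0 ≤ d)
    {c : Chain R n E} (hc : c ∈ Finsupp.supported R R (affSet n S d)) (m : ℕ) :
    subdiv^[m] c ∈ Finsupp.supported R R (affSet n S ((n / (n + 1)) ^ m * d)) := by
  induction m with
  | zero => simpa using hc
  | succ m ih =>
    rw [Function.iterate_succ_apply', pow_succ', mul_assoc]
    exact subdiv_mem_supported_affSet hS (by positivity) ih

lemma iterate_subdiv_push (f : C(X, Y)) (c : Chain R n X) (m : ℕ) :
    subdiv^[m] (push f c) = push f (subdiv^[m] c) := by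
  induction m with
  | zero => rfl
  | succ m ih =>
    rw [Function.iterate_succ_apply', Function.iterate_succ_apply', ih]
    exact natOp_push _ _ _

/-- The inclusion of a simplex in its ambient space. -/
def simpIncl (n : ℕ) : C(Simp n, Fin n → ℝ) := ⟨Subtype.val, continuous_subtype_val⟩

lemma simpIncl_eq_affSimplex : simpIncl n = affSimplex fun i => Pi.single i 1 := by
  ext t i
  rw [affSimplex_apply, Finset.sum_apply]
  simp [simpIncl, Pi.single_apply]
  rfl

-- The estimates hold for affine simplices in the ambient normed space. They descend to the simplex
-- because subdivision commutes with the inclusion, and the inclusion is injective on singular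
-- simplices, so no simplex cancels when pushed forward. The initial mesh 2 is a crude bound for
-- distances of vertices.
open Classical in
lemma exists_iterate_subdiv_small (n : ℕ) {δ : ℝ} (hδ : 0 < δ) : ∃ m₀, ∀ m ≥ m₀,
    subdiv^[m] (Finsupp.single (ContinuousMap.id (Simp n)) (1 : R)) ∈
      Finsupp.supported R R {τ : C(Simp n, Simp n) | ∀ s t, dist (τ s) (τ t) < δ} := by
  have hr : ((n : ℝ) / (n + 1)) < 1 := by rw [div_lt_one (by positivity)]; linarith
  have hlim : Tendsto (fun m : ℕ => ((n : ℝ) / (n + 1)) ^ m * 2) atTop (𝓝 (0 * 2)) :=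
    (tendsto_pow_atTop_nhds_zero_of_lt_one (by positivity) hr).mul_const 2
  rw [zero_mul] at hlim
  obtain ⟨m₀, hm₀⟩ := eventually_atTop.1 (hlim.eventually (gt_mem_nhds hδ))
  refine ⟨m₀, fun m hm => ?_⟩
  have h0 : push (simpIncl n) (Finsupp.single (ContinuousMap.id (Simp n)) (1 : R)) ∈
      Finsupp.supported R R (affSet n Set.univ 2) := by
    rw [push_single]
    refine Finsupp.single_mem_supported _ _ ⟨fun i => Pi.single i 1, ?_, fun _ => Set.mem_univ _,
      fun i j => ?_⟩
    · rw [ContinuousMap.comp_id]; exact simpIncl_eq_affSimplex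
    · have h : ∀ i : Fin n, ‖(Pi.single i 1 : Fin n → ℝ)‖ ≤ 1 := fun i => by
        rw [pi_norm_le_iff_of_nonneg zero_le_one]
        intro j
        rcases eq_or_ne j i with rfl | hji <;> simp [*]
      linarith [norm_sub_le (Pi.single i 1 : Fin n → ℝ) (Pi.single j 1), h i, h j]
  have h1 := iterate_subdiv_mem_supported_affSet convex_univ (by norm_num) h0 m
  rw [iterate_subdiv_push, Finsupp.mem_supported] at h1
  rw [Finsupp.mem_supported]
  intro τ hτ
  have hinj : Function.Injective fun σ : C(Simp n, Simp n) => (simpIncl n).comp σ := by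
    intro σ σ' h
    ext t : 1
    exact Subtype.ext (ContinuousMap.congr_fun h t)
  obtain ⟨w, hw, -, hw'⟩ := h1 (show (simpIncl n).comp τ ∈ _ by
    rw [push, Finsupp.lmapDomain_apply, Finset.mem_coe,
      Finsupp.mapDomain_support_of_injective hinj]
    exact Finset.mem_image_of_mem _ hτ)
  intro s t
  have hst : ∀ s, (τ s).1 = affSimplex w s := fun s => ContinuousMap.congr_fun hw s
  rw [Subtype.dist_eq, hst, hst]
  obtain ⟨_, ⟨i, rfl⟩, _, ⟨j, rfl⟩, h⟩ := convexHull_exists_dist_ge2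
    (affSimplex_mem_convexHull w s) (affSimplex_mem_convexHull w t)
  rw [dist_eq_norm (w i)] at h
  exact (h.trans (hw' i j)).trans_lt (hm₀ m hm)

/-- A Lebesgue number of the cover of the simplex by the preimages of `U` and `V` tells how fine the
subdivision has to be. -/
lemma exists_iterate_subdiv_single_mem {U V : Set X} (hU : IsOpen U) (hV : IsOpen V)
    {σ : C(Simp n, X)} (hσ : Set.range σ ⊆ U ∪ V) : ∃ m₀, ∀ m ≥ m₀,
      subdiv^[m] (Finsupp.single σ (1 : R)) ∈ chainsIn R n U ⊔ chainsIn R n V := by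
  obtain ⟨δ, hδ, h⟩ := lebesgue_number_lemma_of_metric (s := (Set.univ : Set (Simp n)))
    (c := fun b : Bool => σ ⁻¹' (if b then U else V)) isCompact_univ
    (fun b => by cases b <;> simp [hU.preimage, hV.preimage, σ.continuous])
    (fun t _ => by
      rcases hσ ⟨t, rfl⟩ with h | h
      · exact Set.mem_iUnion.2 ⟨true, h⟩
      · exact Set.mem_iUnion.2 ⟨false, h⟩)
  obtain ⟨m₀, hm₀⟩ := exists_iterate_subdiv_small (R := R) n hδ
  refine ⟨m₀, fun m hm => ?_⟩
  rw [single_eq_push σ, iterate_subdiv_push, chainsIn, chainsIn, ← Finsupp.supported_union]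
  refine mem_supported_lmapDomain _ (fun τ hτ => ?_) (hm₀ m hm)
  rcases isEmpty_or_nonempty (Simp n) with he | ⟨⟨t₀⟩⟩
  · exact Or.inl (by rintro _ ⟨t, rfl⟩; exact he.elim t)
  · obtain ⟨b, hb⟩ := h (τ t₀) (Set.mem_univ _)
    have : Set.range (σ.comp τ) ⊆ if b then U else V := by
      rintro _ ⟨t, rfl⟩
      exact hb (hτ t t₀)
    cases b
    · exact Or.inr (by simpa using this)
    · exact Or.inl (by simpa using this)

lemma exists_iterate_subdiv_mem {U V : Set X} (hU : IsOpen U) (hV : IsOpen V)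
    {c : Chain R n X} (hc : c ∈ chainsIn R n (U ∪ V)) : ∃ m₀, ∀ m ≥ m₀,
      subdiv^[m] c ∈ chainsIn R n U ⊔ chainsIn R n V := by
  have hit : ∀ m, (subdiv : Chain R n X → Chain R n X)^[m] =
      ((subdiv (R := R) (n := n) (X := X)) ^ m : Module.End R (Chain R n X)) := fun m =>
    (Module.End.coe_pow _ m).symm
  rw [chainsIn, Finsupp.supported_eq_span_single] at hc
  induction hc using Submodule.span_induction with
  | mem _ h =>
    obtain ⟨σ, hσ, rfl⟩ := h
    exact exists_iterate_subdiv_single_mem hU hV hσ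
  | zero => exact ⟨0, fun m _ => by rw [hit, map_zero]; exact Submodule.zero_mem _⟩
  | add x y _ _ hx hy =>
    obtain ⟨m₁, h₁⟩ := hx
    obtain ⟨m₂, h₂⟩ := hy
    refine ⟨max m₁ m₂, fun m hm => ?_⟩
    rw [hit, map_add, ← hit]
    exact Submodule.add_mem _ (h₁ m (le_of_max_le_left hm)) (h₂ m (le_of_max_le_right hm))
  | smul r x _ hx =>
    obtain ⟨m₁, h₁⟩ := hx
    refine ⟨m₁, fun m hm => ?_⟩
    rw [hit, map_smul, ← hit]
    exact Submodule.smul_mem _ _ (h₁ m hm)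

/-- The part of the Mayer–Vietoris sequence used below: a cycle in `U ∩ V` is a boundary if the
difference of fillings in `U` and in `V` is a boundary in `U ∪ V`. -/
lemma exists_bd_eq_of_mayerVietoris {U V : Set X} (hU : IsOpen U) (hV : IsOpen V)
    {a b : Chain R (n + 1) X} {c : Chain R (n + 2) X} (ha : a ∈ chainsIn R (n + 1) U)
    (hb : b ∈ chainsIn R (n + 1) V) (hc : c ∈ chainsIn R (n + 2) (U ∪ V)) (hab : bd a = bd b)
    (h : bd c = a - b) : ∃ w ∈ chainsIn R (n + 1) (U ∩ V), bd w = bd a := by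
  obtain ⟨m, hm⟩ := exists_iterate_subdiv_mem hU hV hc
  obtain ⟨cU, hcU, cV, hcV, e⟩ := Submodule.mem_sup.1 (hm m le_rfl)
  have hsub : subdiv^[m] a - subdiv^[m] b = bd cU + bd cV := by
    rw [← map_add, e, bd_iterate_subdiv, h, ← Module.End.coe_pow, map_sub]
  have hza : bd a ∈ chainsIn R n (U ∩ V) :=
    mem_chainsIn_inter (bd_mem_chainsIn ha) (hab ▸ bd_mem_chainsIn hb)
  obtain ⟨w', hw', e'⟩ := exists_bd_eq_iterate_subdiv_sub hza (isCycle_bd a) m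
  -- This chain lies in `U` as written and equals `subdiv^[m] b + bd cV`, which lies in `V`. Its
  -- boundary is the subdivided cycle, and `w'` undoes the subdivision inside the intersection.
  have hw : subdiv^[m] a - bd cU ∈ chainsIn R (n + 1) (U ∩ V) := by
    refine mem_chainsIn_inter
      (Submodule.sub_mem _ (iterate_subdiv_mem_chainsIn ha m) (bd_mem_chainsIn hcU)) ?_
    rw [show subdiv^[m] a - bd cU = subdiv^[m] b + bd cV by
      rw [sub_eq_iff_eq_add, add_right_comm, add_assoc, ← hsub]; abel]
    exact Submodule.add_mem _ (iterate_subdiv_mem_chainsIn hb m) (bd_mem_chainsIn hcV)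
  refine ⟨subdiv^[m] a - bd cU - w', Submodule.sub_mem _ hw hw', ?_⟩
  rw [map_sub, map_sub, bd_bd, bd_iterate_subdiv, e']
  abel

/-! ### The punctured space -/

/-- Some cycle in `S` on simplices with `n` vertices does not bound in `S`. -/
def HasHole (R : Type) [CommRing R] (n : ℕ) (S : Set X) : Prop :=
  ∃ z ∈ chainsIn R n S, IsCycle z ∧ ∀ w ∈ chainsIn R (n + 1) S, bd w ≠ z

/-- The complement of the ray spanned by `s • e₀`. -/
def slit (n : ℕ) (s : ℝ) : Set (Fin (n + 1) → ℝ) := {x | Fin.tail x ≠ 0 ∨ s * x 0 < 0}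

lemma isOpen_slit (s : ℝ) : IsOpen (slit n s) := by
  have hs : slit n s = {x | Fin.tail x ≠ 0} ∪ {x | s * x 0 < 0} := rfl
  rw [hs]
  refine IsOpen.union (isOpen_ne_fun ?_ continuous_const) (isOpen_lt (by fun_prop) continuous_const)
  exact continuous_pi fun i => continuous_apply _

lemma mem_slit_center {s : ℝ} (hs : s ≠ 0) : (Fin.cons (-s) 0 : Fin (n + 1) → ℝ) ∈ slit n s := by
  right
  simp only [Fin.cons_zero]
  nlinarith [mul_self_pos.2 hs]

lemma starConvex_slit {s : ℝ} (hs : s ≠ 0) :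
    StarConvex ℝ (Fin.cons (-s) 0 : Fin (n + 1) → ℝ) (slit n s) := by
  intro y hy a b ha hb hab
  have ht : Fin.tail (a • (Fin.cons (-s) 0 : Fin (n + 1) → ℝ) + b • y) = b • Fin.tail y := by
    ext i; simp [Fin.tail]
  have h0 : s * (a • (Fin.cons (-s) 0 : Fin (n + 1) → ℝ) + b • y) 0 =
      -(a * (s * s)) + b * (s * y 0) := by simp; ring
  have hss := mul_self_pos.2 hs
  rcases eq_or_lt_of_le hb with rfl | hb
  · right; rw [h0]; obtain rfl : a = 1 := by linarith
    linarith
  · rcases hy with hy | hy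
    · left; rw [ht]; exact smul_ne_zero hb.ne' hy
    · right; rw [h0]
      have := mul_pos_of_neg_of_neg hy (neg_lt_zero.2 hb)
      nlinarith [mul_nonneg ha hss.le]

lemma slit_inter : slit n 1 ∩ slit n (-1) = {x | Fin.tail x ≠ 0} := by
  ext x
  simp only [slit, Set.mem_inter_iff, Set.mem_ofPred_eq]
  constructor
  · rintro ⟨h | h, h' | h'⟩
    · exact h
    · exact h
    · exact h'
    · linarith
  · exact fun h => ⟨Or.inl h, Or.inl h⟩

lemma slit_union : slit n 1 ∪ slit n (-1) = {x | x ≠ 0} := by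
  ext x
  simp only [slit, Set.mem_union, Set.mem_ofPred_eq]
  constructor
  · rintro ((h | h) | (h | h)) rfl
    · exact h rfl
    · simp at h
    · exact h rfl
    · simp at h
  · intro h
    by_contra! hc
    obtain ⟨⟨h1, h2⟩, -, h3⟩ := hc
    refine h ?_
    rw [← Fin.cons_self_tail x, h1, show x 0 = 0 by linarith]
    ext i; refine Fin.cases ?_ (fun i => ?_) i <;> simp

/-- Suspension: a cycle in the equator is coned off in both slit spaces, each star-shaped about a
point of the axis, and the two cones are glued. A filling of the result would by Mayer–Vietoris fill
the equatorial cycle away from the axis, and forgetting the first coordinate would then fill the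
original cycle. -/
lemma hasHole_succ (h : HasHole R n {x : Fin n → ℝ | x ≠ 0}) :
    HasHole R (n + 1) {x : Fin (n + 1) → ℝ | x ≠ 0} := by
  obtain ⟨z, hz, hcyc, hnb⟩ := h
  let i : C(Fin n → ℝ, Fin (n + 1) → ℝ) := ⟨fun x => Fin.cons 0 x,
    continuous_pi fun j => by refine Fin.cases ?_ (fun j => ?_) j <;> simp <;> fun_prop⟩
  let r : C(Fin (n + 1) → ℝ, Fin n → ℝ) := ⟨fun x => Fin.tail x,
    continuous_pi fun j => continuous_apply _⟩
  have hri : r.comp i = ContinuousMap.id _ := by ext x j; simp [i, r, Fin.tail]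
  have hz' : push i z ∈ chainsIn R n (slit n 1 ∩ slit n (-1)) := by
    rw [slit_inter]
    exact push_mem_chainsIn (fun x hx => by simpa [i] using hx) hz
  have fill : ∀ s : ℝ, s ≠ 0 → push i z ∈ chainsIn R n (slit n s) →
      ∃ a ∈ chainsIn R (n + 1) (slit n s), bd a = push i z := fun s hs hzs =>
    ⟨_, coning_map_mem_chainsIn (starConvex_slit hs) (mem_slit_center hs) hzs,
      Coning.bd_map_of_isCycle _ hcyc.push⟩
  obtain ⟨a, ha, ea⟩ := fill 1 one_ne_zero (chainsIn_mono Set.inter_subset_left hz')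
  obtain ⟨b, hb, eb⟩ := fill (-1) (by norm_num) (chainsIn_mono Set.inter_subset_right hz')
  refine ⟨a - b, ?_, ?_, fun w hw ew => ?_⟩
  · rw [← slit_union]
    exact Submodule.sub_mem _ (chainsIn_mono Set.subset_union_left ha)
      (chainsIn_mono Set.subset_union_right hb)
  · change bd (a - b) = 0
    rw [map_sub, ea, eb, sub_self]
  · rw [← slit_union] at hw
    obtain ⟨w', hw', e'⟩ := exists_bd_eq_of_mayerVietoris (isOpen_slit 1) (isOpen_slit (-1)) ha hb hw
      (ea.trans eb.symm) ew
    rw [slit_inter] at hw'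
    refine hnb (push r w') (push_mem_chainsIn (fun x hx => hx) hw') ?_
    rw [bd_push, e', ea, push_push, hri, push_id]

/-- The induction starts with the empty set ℝ⁰ ∖ 0, seen as S⁻¹: its hole is the empty simplex,
which cannot bound since there are no points. The augmentation is carried along for this reason. -/
lemma hasHole_punctured (R : Type) [CommRing R] [Nontrivial R] (n : ℕ) :
    HasHole R n {x : Fin n → ℝ | x ≠ 0} := by
  induction n with
  | zero =>
    have he : ∀ k : ℕ, {x : Fin 0 → ℝ | x ≠ 0} = ∅ := fun _ => by
      ext x; simp [Subsingleton.elim x 0]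
    have hemp : IsEmpty (Simp 0) := ⟨fun t => by simpa using stdSimplex.sum_eq_one t⟩
    refine ⟨Finsupp.single ⟨fun t => hemp.elim t, by fun_prop⟩ 1,
      single_mem_chainsIn (by rintro _ ⟨t, rfl⟩; exact hemp.elim t) _, trivial, fun w hw e => ?_⟩
    have hw0 : w = 0 := by
      rw [he 0, chainsIn, Finsupp.mem_supported] at hw
      refine Finsupp.support_eq_empty.1 (Finset.eq_empty_of_forall_notMem fun σ hσ => ?_)
      exact hw hσ ⟨stdSimplex.vertex 0, rfl⟩
    rw [hw0, map_zero, eq_comm, Finsupp.single_eq_zero] at e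
    exact one_ne_zero e
  | succ n ih => exact hasHole_succ ih

end

end SingularChains

/-! ### Comparison with categorical singular homology. -/

namespace SingularChains

noncomputable section

open Opposite Simplicial

variable (R : Type) [CommRing R] (X : Type) [TopologicalSpace X]

/-- The singular chain complex of `X`. -/
abbrev singComplex : ChainComplex (ModuleCat.{0} R) ℕ :=
  (TopCat.toSSet.obj (TopCat.of X)).chainComplex (ModuleCat.of R R)

variable {R X} {n : ℕ}

/-- The simplices of the singular simplicial set are continuous maps. -/
def simpEquiv (n : ℕ) : (TopCat.toSSet.obj (TopCat.of X)) _⦋n⦌ ≃ C(Simp (n + 1), X) :=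
  TopCat.toSSetObjEquiv (TopCat.of X) (op ⦋n⦌)

lemma simpEquiv_δ (i : Fin (n + 2)) (s : (TopCat.toSSet.obj (TopCat.of X)) _⦋n + 1⦌) :
    simpEquiv n ((TopCat.toSSet.obj (TopCat.of X)).δ i s) = (simpEquiv (n + 1) s).comp (face i) :=
  rfl

/-- Comparison of explicit chains with the singular chain complex. -/
def toComplex (n : ℕ) : Chain R (n + 1) X →ₗ[R] (singComplex R X).X n :=
  Finsupp.linearCombination R fun σ : C(Simp (n + 1), X) =>
    (SSet.ιChainComplex (R := ModuleCat.of R R) (TopCat.toSSet.obj (TopCat.of X)) ((simpEquiv n).symm σ)).hom (1 : R)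

lemma toComplex_single (σ : C(Simp (n + 1), X)) : toComplex n (Finsupp.single σ (1 : R)) =
    (SSet.ιChainComplex (R := ModuleCat.of R R) (TopCat.toSSet.obj (TopCat.of X)) ((simpEquiv n).symm σ)).hom (1 : R) := by
  simp [toComplex]

/-- The inverse comparison. -/
def ofComplex (n : ℕ) : (singComplex R X).X n ⟶ ModuleCat.of R (Chain R (n + 1) X) :=
  (SSet.isColimitChainComplexXCofan _ (ModuleCat.of R R) n).desc
    (Limits.Cofan.mk _ fun s => ModuleCat.ofHom (Finsupp.lsingle (simpEquiv n s)))

lemma ι_ofComplex (s : (TopCat.toSSet.obj (TopCat.of X)) _⦋n⦌) :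
    SSet.ιChainComplex (R := ModuleCat.of R R) (TopCat.toSSet.obj (TopCat.of X)) s ≫ ofComplex n =
      ModuleCat.ofHom (Finsupp.lsingle (simpEquiv n s)) :=
  (SSet.isColimitChainComplexXCofan _ (ModuleCat.of R R) n).fac _ ⟨s⟩

lemma ofComplex_toComplex (c : Chain R (n + 1) X) : (ofComplex n).hom (toComplex n c) = c := by
  suffices h : (ofComplex n).hom.comp (toComplex n) = (LinearMap.id : Chain R (n + 1) X →ₗ[R] _) from
    LinearMap.congr_fun h c
  ext σ : 2
  simp only [LinearMap.comp_apply, Finsupp.lsingle_apply, toComplex_single]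
  have := congr(ModuleCat.Hom.hom $(ι_ofComplex (R := R) ((simpEquiv n).symm σ)) (1 : R))
  simpa using this

lemma toComplex_ofComplex (x : (singComplex R X).X n) : toComplex n ((ofComplex n).hom x) = x := by
  suffices h : ofComplex n ≫ ModuleCat.ofHom (toComplex n) = 𝟙 ((singComplex R X).X n) from
    congr(ModuleCat.Hom.hom $h x)
  refine SSet.chainComplex_hom_ext fun s => ?_
  rw [← Category.assoc, ι_ofComplex, Category.comp_id]
  ext
  change toComplex n (Finsupp.single (simpEquiv n s) (1 : R)) = _
  rw [toComplex_single, Equiv.symm_apply_apply]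

lemma d_toComplex (c : Chain R (n + 2) X) :
    ((singComplex R X).d (n + 1) n).hom (toComplex (n + 1) c) = toComplex n (bd c) := by
  suffices h : ((singComplex R X).d (n + 1) n).hom.comp (toComplex (n + 1)) =
      (toComplex n).comp bd from LinearMap.congr_fun h c
  ext σ : 2
  simp only [LinearMap.comp_apply, Finsupp.lsingle_apply, toComplex_single, bd_single, map_sum,
    map_smul]
  have h := congr(ModuleCat.Hom.hom $(SSet.ιChainComplex_d (TopCat.toSSet.obj (TopCat.of X))
    (ModuleCat.of R R) ((simpEquiv (n + 1)).symm σ)) (1 : R))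
  rw [ModuleCat.hom_comp, LinearMap.comp_apply] at h
  refine h.trans ?_
  rw [ModuleCat.hom_sum, LinearMap.sum_apply]
  refine Finset.sum_congr rfl fun i _ => ?_
  have hδ : (simpEquiv n).symm (σ.comp (face i)) =
      (TopCat.toSSet.obj (TopCat.of X)).δ i ((simpEquiv (n + 1)).symm σ) := by
    rw [Equiv.symm_apply_eq, simpEquiv_δ, Equiv.apply_symm_apply]
  rw [hδ]
  -- The sign of a face may occur as an integer or as an element of `R`; splitting by parity
  -- reconciles the two.
  rcases neg_one_pow_eq_or ℤ (i : ℕ) with h | h <;>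
  rcases Nat.even_or_odd (i : ℕ) with h' | h' <;> simp_all [h'.neg_one_pow]

lemma exists_bd_eq_of_subsingleton (h : Subsingleton (Homogeneous.singularHomology R (n + 1) X))
    {z : Chain R (n + 2) X} (hz : bd z = 0) : ∃ w, bd w = z := by
  have hzero : Limits.IsZero ((singComplex R X).homology (n + 1)) :=
    ModuleCat.isZero_iff_subsingleton.2 h
  rw [← HomologicalComplex.exactAt_iff_isZero_homology,
    HomologicalComplex.exactAt_iff' _ (n + 2) (n + 1) n (by simp) (by simp),
    ShortComplex.moduleCat_exact_iff] at hzero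
  obtain ⟨y, hy⟩ : ∃ y : (singComplex R X).X (n + 2),
      ((singComplex R X).d (n + 2) (n + 1)).hom y = toComplex (n + 1) z := hzero _ (by
    change ((singComplex R X).d (n + 1) n).hom (toComplex (n + 1) z) = 0
    rw [d_toComplex, hz, map_zero])
  refine ⟨(ofComplex (n + 2)).hom y, ?_⟩
  rw [← ofComplex_toComplex (bd _), ← d_toComplex, toComplex_ofComplex, ← ofComplex_toComplex z]
  exact congrArg _ hy

/-- Simplices with n + 2 vertices have dimension n + 1 > 0, where augmented and ordinary cycles
agree. Chains with image in `S` lift to chains of the subspace, and pushing forward along the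
inclusion is injective. -/
lemma nontrivial_singularHomology_of_hasHole {X : Type} [TopologicalSpace X] {S : Set X}
    (h : HasHole R (n + 2) S) : Nontrivial (Homogeneous.singularHomology R (n + 1) S) := by
  obtain ⟨z, hz, hcyc, hnb⟩ := h
  by_contra hnt
  rw [not_nontrivial_iff_subsingleton] at hnt
  let i : C(S, X) := ⟨Subtype.val, continuous_subtype_val⟩
  have hlift : ∃ z', push i z' = z := by
    suffices chainsIn R (n + 2) S ≤ LinearMap.range (push (R := R) i) from this hz
    rw [chainsIn, Finsupp.supported_eq_span_single, Submodule.span_le]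
    rintro _ ⟨σ, hσ, rfl⟩
    exact ⟨Finsupp.single ⟨fun t => ⟨σ t, hσ ⟨t, rfl⟩⟩, by fun_prop⟩ 1, by
      rw [push_single]; rfl⟩
  obtain ⟨z', rfl⟩ := hlift
  have hinj : Function.Injective (push (R := R) (n := n + 1) i) :=
    Finsupp.mapDomain_injective fun σ τ e => by
      ext t; exact ContinuousMap.congr_fun e t
  have hz' : bd z' = 0 := hinj (by rw [← bd_push, map_zero]; exact hcyc)
  obtain ⟨w, rfl⟩ := exists_bd_eq_of_subsingleton hnt hz'
  exact hnb (push i w) (push_mem_chainsIn_of_range (by rintro _ ⟨x, rfl⟩; exact x.2) _) (bd_push _ _)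

/-! ### Functoriality of singular homology -/

/-- The identity of the homology of `Y` factors through that of `X`, so the latter cannot vanish
when the former does not. -/
lemma nontrivial_singularHomology_of_homotopic {X Y : Type} [TopologicalSpace X]
    [TopologicalSpace Y] {q : ℕ} (h : Nontrivial (Homogeneous.singularHomology R q Y))
    (f : C(Y, X)) (g : C(X, Y)) (hgf : (g.comp f).Homotopic (ContinuousMap.id Y)) :
    Nontrivial (Homogeneous.singularHomology R q X) := by
  by_contra hnt
  rw [not_nontrivial_iff_subsingleton] at hnt
  let Φ := (AlgebraicTopology.singularHomologyFunctor (ModuleCat.{0} R) q).obj (ModuleCat.of R R)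
  have hX : Limits.IsZero (Φ.obj (TopCat.of X)) := ModuleCat.isZero_iff_subsingleton.2 hnt
  obtain ⟨H⟩ := hgf
  have e : Φ.map (TopCat.ofHom f ≫ TopCat.ofHom g) = Φ.map (𝟙 (TopCat.of Y)) :=
    TopCat.Homotopy.congr_homologyMap_singularChainComplexFunctor
      (f := TopCat.ofHom f ≫ TopCat.ofHom g) (g := 𝟙 (TopCat.of Y)) H (ModuleCat.of R R) q
  rw [Φ.map_comp, hX.eq_of_tgt (Φ.map (TopCat.ofHom f)) 0, Limits.zero_comp, Φ.map_id] at e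
  have hY : Limits.IsZero (Φ.obj (TopCat.of Y)) :=
    (Limits.IsZero.iff_id_eq_zero _).2 e.symm
  have := ModuleCat.isZero_iff_subsingleton.1 hY
  exact not_subsingleton_iff_nontrivial.2 h this

lemma not_contractibleSpace_of_nontrivial {X : Type} [TopologicalSpace X]
    (h : Nontrivial (Homogeneous.singularHomology R (n + 1) X)) : ¬ ContractibleSpace X := by
  intro hc
  obtain ⟨e⟩ := hc.hequiv_unit
  have := nontrivial_singularHomology_of_homotopic h e.toFun e.invFun e.left_inv
  exact not_subsingleton_iff_nontrivial.2 this (ModuleCat.isZero_iff_subsingleton.1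
    (AlgebraicTopology.isZero_singularHomologyFunctor_of_totallyDisconnectedSpace
      (ModuleCat.{0} R) (n + 1) (ModuleCat.of R R) (TopCat.of Unit) n.succ_ne_zero))

end

end SingularChains

/-! ### Collapsing a space onto an embedded sphere with an interior point. -/

namespace SphereCollapse

open Metric Topology unitInterval

variable {N : Type} [NormedAddCommGroup N] [InnerProductSpace ℝ N]

noncomputable section

/-- The coefficient of the moving point in the collapse of a sphere onto a cap. -/
def capCoeff (c s : ℝ) : ℝ := max 0 (s - c)

/-- The coefficient of the base point in the collapse of a sphere onto a cap. -/
def baseCoeff (c c' s : ℝ) : ℝ := max 0 (c' - max s c)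

/-- The collapse of the complement of the cap `⟪y, x₀⟫ ≥ c`, into the punctured space. -/
def capCollapse (c c' : ℝ) (x₀ y : N) : N :=
  capCoeff c (inner ℝ y x₀) • y - baseCoeff c c' (inner ℝ y x₀) • x₀

lemma capCoeff_of_le {c s : ℝ} (h : s ≤ c) : capCoeff c s = 0 := max_eq_left (by linarith)

lemma baseCoeff_of_le {c c' s : ℝ} (hc : c < c') (h : s ≤ c) : baseCoeff c c' s = c' - c := by
  rw [baseCoeff, max_eq_right h, max_eq_right (by linarith)]

lemma continuous_capCollapse (c c' : ℝ) (x₀ : N) : Continuous (capCollapse c c' x₀) := by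
  unfold capCollapse capCoeff baseCoeff
  fun_prop

lemma capCollapse_of_le {c c' : ℝ} (hc : c < c') {x₀ y : N} (h : inner ℝ y x₀ ≤ c) :
    capCollapse c c' x₀ y = -(c' - c) • x₀ := by
  rw [capCollapse, capCoeff_of_le h, baseCoeff_of_le hc h]
  module

/-- Vanishing would make a non-negative multiple of `y` equal to one of `x₀`. If these are non-zero
then `y = x₀`, where the coefficient of `x₀` vanishes because c' < 1; if both are zero, the two
coefficients of the collapse vanish together, which c < c' excludes. With `r = 0` this says that the
collapse avoids 0; with general `r` and `t`, that its segment to a positive multiple of `y` does. -/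
lemma smul_add_capCollapse_ne_zero {c c' : ℝ} (hc : c < c') (hc' : c' < 1) {x₀ y : N}
    (hx₀ : ‖x₀‖ = 1) (hy : ‖y‖ = 1) {r t : ℝ} (hr : 0 ≤ r) (ht : 0 ≤ t) (hrt : 0 < r ∨ 0 < t) :
    r • y + t • capCollapse c c' x₀ y ≠ 0 := by
  intro h
  set s : ℝ := inner ℝ y x₀ with hs
  have hα : 0 ≤ capCoeff c s := le_max_left _ _
  have hβ : 0 ≤ baseCoeff c c' s := le_max_left _ _
  have e : (r + t * capCoeff c s) • y = (t * baseCoeff c c' s) • x₀ := by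
    rw [← sub_eq_zero, ← h, capCollapse]; module
  have hn := congrArg norm e
  rw [norm_smul, norm_smul, hx₀, hy, Real.norm_of_nonneg (by positivity),
    Real.norm_of_nonneg (by positivity), mul_one, mul_one] at hn
  rcases eq_or_ne (t * baseCoeff c c' s) 0 with h0 | h0
  · rw [h0] at hn
    have hr0 : r = 0 := by nlinarith [mul_nonneg ht hα]
    have ht0 : 0 < t := by rcases hrt with h | h <;> linarith
    have hα0 : capCoeff c s = 0 := by
      rw [hr0, zero_add] at hn
      exact (mul_eq_zero.1 hn).resolve_left ht0.ne'
    have hsc : s ≤ c := by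
      have := max_eq_left_iff.1 hα0; linarith
    rw [baseCoeff_of_le hc hsc] at h0
    rcases mul_eq_zero.1 h0 with h | h <;> linarith
  · rw [hn] at e
    have hyx : y = x₀ := smul_right_injective N h0 e
    have hs1 : s = 1 := by rw [hs, hyx, real_inner_self_eq_norm_sq, hx₀]; norm_num
    refine h0 ?_
    rw [baseCoeff, hs1, max_eq_left (by linarith : c ≤ 1), max_eq_left (by linarith), mul_zero]

variable {X : Type} [TopologicalSpace X]

open Classical in
/-- The extension of the collapse by a constant off an embedded sphere. -/
def collapseFun {A : Set X} (φ : A ≃ₜ sphere (0 : N) 1) (c c' : ℝ) (x₀ : N) (x : X) : N :=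
  if h : x ∈ A then capCollapse c c' x₀ (φ ⟨x, h⟩) else -(c' - c) • x₀

lemma collapseFun_ne_zero {A : Set X} (φ : A ≃ₜ sphere (0 : N) 1) {c c' : ℝ} (hc : c < c')
    (hc' : c' < 1) {x₀ : N} (hx₀ : ‖x₀‖ = 1) (x : X) : collapseFun φ c c' x₀ x ≠ 0 := by
  by_cases h : x ∈ A
  · have := smul_add_capCollapse_ne_zero hc hc' hx₀ (norm_eq_of_mem_sphere (φ ⟨x, h⟩)) le_rfl
      zero_le_one (Or.inr one_pos)
    simpa [collapseFun, h] using this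
  · rw [collapseFun, dif_neg h]
    refine smul_ne_zero (by linarith) ?_
    rintro rfl
    simp at hx₀

/-- The closed cap `K` is compact, hence closed in the Hausdorff space `X`. Off `K` the map is
constant, and near `K`, inside `interior A`, it is the collapse read through `φ`; these two open
sets cover `X`. -/
lemma continuous_collapseFun [T2Space X] [ProperSpace N] {A : Set X} (φ : A ≃ₜ sphere (0 : N) 1)
    {c c' : ℝ} (hc : c < c') {x₀ : N}
    (hA : ∀ y : sphere (0 : N) 1, c ≤ inner ℝ (y : N) x₀ → (φ.symm y : X) ∈ interior A) :
    Continuous (collapseFun φ c c' x₀) := by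
  let K : Set X := (fun y => (φ.symm y : X)) '' {y : sphere (0 : N) 1 | c ≤ inner ℝ (y : N) x₀}
  have hK : IsClosed K := by
    refine (IsCompact.image ?_ (by fun_prop)).isClosed
    exact (isClosed_le continuous_const (by fun_prop)).isCompact
  rw [continuous_iff_continuousAt]
  intro x
  by_cases hx : x ∈ K
  · have hxU : x ∈ interior A := by
      obtain ⟨y, hy, rfl⟩ := hx
      exact hA y hy
    refine ContinuousOn.continuousAt (s := interior A) ?_ (isOpen_interior.mem_nhds hxU)
    refine ContinuousOn.mono ?_ interior_subset
    rw [continuousOn_iff_continuous_domRestrict]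
    have : A.domRestrict (collapseFun φ c c' x₀) = fun a => capCollapse c c' x₀ (φ a) := by
      funext a; simp [collapseFun]
    rw [this]
    exact (continuous_capCollapse c c' x₀).comp (by fun_prop)
  · refine (continuousAt_const (y := -(c' - c) • x₀)).congr ?_
    filter_upwards [hK.isOpen_compl.mem_nhds hx] with z hz
    by_cases h : z ∈ A
    · rw [collapseFun, dif_pos h, capCollapse_of_le hc]
      by_contra! hlt
      exact hz ⟨φ ⟨z, h⟩, hlt.le, by simp⟩
    · rw [collapseFun, dif_neg h]

/-- Radial projection of the punctured space onto the unit sphere. -/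
def radial : C({v : N | v ≠ 0}, sphere (0 : N) 1) where
  toFun v := ⟨‖(v : N)‖⁻¹ • (v : N), by
    have : ‖(v : N)‖ ≠ 0 := norm_ne_zero_iff.2 v.2
    simp [norm_smul, this]⟩
  continuous_toFun := by
    refine Continuous.subtype_mk (Continuous.smul ?_ continuous_subtype_val) _
    exact continuous_subtype_val.norm.inv₀ fun v => norm_ne_zero_iff.2 v.2

lemma norm_smul_radial (v : {v : N | v ≠ 0}) : ‖(v : N)‖ • (radial v : N) = v :=
  smul_inv_smul₀ (norm_ne_zero_iff.2 v.2) _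

/-- A space containing a sphere with an interior point dominates the punctured Euclidean space. -/
lemma exists_domination [T2Space X] [ProperSpace N] {A : Set X} (φ : A ≃ₜ sphere (0 : N) 1)
    (hA : (interior A).Nonempty) : ∃ (f : C({v : N | v ≠ 0}, A)) (g : C(X, {v : N | v ≠ 0})),
      (g.comp ((⟨Subtype.val, continuous_subtype_val⟩ : C(A, X)).comp f)).Homotopic
        (ContinuousMap.id _) := by
  obtain ⟨a, ha⟩ := hA
  set x₀ := φ ⟨a, interior_subset ha⟩ with hx₀
  have hopen : IsOpen {y : sphere (0 : N) 1 | (φ.symm y : X) ∈ interior A} :=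
    isOpen_interior.preimage (by fun_prop)
  obtain ⟨ε, hε, hball⟩ := Metric.isOpen_iff.1 hopen x₀ (by simpa [hx₀] using ha)
  have hn : ‖(x₀ : N)‖ = 1 := norm_eq_of_mem_sphere x₀
  have hε2 : 0 < ε ^ 2 := by positivity
  -- For unit vectors ‖y - x₀‖² = 2 - 2⟪y, x₀⟫, so the cap ⟪y, x₀⟫ ≥ 1 - ε²/4 lies in the ball of
  -- radius ε; the second threshold is any number between the first and 1.
  have hc : 1 - ε ^ 2 / 4 < 1 - ε ^ 2 / 8 := by linarith
  have hc' : 1 - ε ^ 2 / 8 < 1 := by linarith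
  have hcap : ∀ y : sphere (0 : N) 1, 1 - ε ^ 2 / 4 ≤ inner ℝ (y : N) x₀ →
      (φ.symm y : X) ∈ interior A := fun y hy => hball <| by
    rw [mem_ball, Subtype.dist_eq, dist_eq_norm]
    have := norm_sub_sq_real (y : N) x₀
    rw [hn, norm_eq_of_mem_sphere y] at this
    exact lt_of_pow_lt_pow_left₀ 2 hε.le (by linarith)
  let g : C(X, {v : N | v ≠ 0}) := ⟨fun x => ⟨collapseFun φ _ _ x₀ x, collapseFun_ne_zero φ hc hc' hn x⟩,
    (continuous_collapseFun φ hc hcap).subtype_mk _⟩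
  let f : C({v : N | v ≠ 0}, A) := (⟨φ.symm, φ.symm.continuous⟩ : C(sphere (0 : N) 1, A)).comp radial
  refine ⟨f, g, ContinuousMap.Homotopic.symm ⟨⟨⟨fun p => ⟨(1 - (p.1 : ℝ)) • (p.2 : N) +
    (p.1 : ℝ) • capCollapse (1 - ε ^ 2 / 4) (1 - ε ^ 2 / 8) (x₀ : N) (radial p.2 : N), ?_⟩, ?_⟩, ?_, ?_⟩⟩⟩
  · have hv : 0 < ‖(p.2 : N)‖ := norm_pos_iff.2 p.2.2
    have h1 : 0 ≤ 1 - (p.1 : ℝ) := sub_nonneg.2 p.1.2.2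
    rw [← norm_smul_radial p.2, smul_smul]
    refine smul_add_capCollapse_ne_zero hc hc' hn (norm_eq_of_mem_sphere _)
      (mul_nonneg h1 hv.le) p.1.2.1 ?_
    rcases eq_or_lt_of_le p.1.2.1 with h | h
    · left; rw [← h]; simpa using hv
    · exact Or.inr h
  · refine Continuous.subtype_mk (Continuous.add (by fun_prop) (Continuous.smul (by fun_prop) ?_)) _
    exact (continuous_capCollapse _ _ _).comp
      (continuous_subtype_val.comp (radial.continuous.comp continuous_snd))
  · intro v; ext1; simp
  · intro v
    ext1
    simp [f, g, collapseFun]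

end

end SphereCollapse

/-! ### Homology and non-contractibility from a sphere with interior points. -/

open SphereCollapse SingularChains in
lemma nontrivial_singularHomology_punctured (R : Type) [CommRing R] [Nontrivial R] (q : ℕ) :
    Nontrivial (Homogeneous.singularHomology R (q + 1)
      {v : EuclideanSpace ℝ (Fin (q + 2)) | v ≠ 0}) := by
  refine nontrivial_singularHomology_of_homotopic
    (nontrivial_singularHomology_of_hasHole (hasHole_punctured R (q + 2)))
    ⟨fun x => ⟨WithLp.toLp 2 x.1, fun h => x.2 (by simpa using h)⟩, ?_⟩ ⟨fun v => ⟨WithLp.ofLp v.1, 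
      fun h => v.2 (by simpa using h)⟩, ?_⟩ ?_
  · exact Continuous.subtype_mk (by fun_prop) _
  · exact Continuous.subtype_mk (by fun_prop) _
  · exact ContinuousMap.Homotopic.refl _

open SphereCollapse SingularChains in
/-- A sphere with non-empty interior in a Hausdorff space carries homology. -/
theorem sphere_with_interior {X : Type} [TopologicalSpace X] [T2Space X] {q : ℕ} {A : Set X}
    (φ : A ≃ₜ Metric.sphere (0 : EuclideanSpace ℝ (Fin (q + 2))) 1) (hA : (interior A).Nonempty) :
    ¬ (⟨Subtype.val, continuous_subtype_val⟩ : C(A, X)).Nullhomotopic ∧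
    (∀ (R : Type) [CommRing R] [Nontrivial R],
      Nontrivial (Homogeneous.singularHomology R (q + 1) X)) ∧ ¬ ContractibleSpace X := by
  obtain ⟨f, g, hfg⟩ := exists_domination φ hA
  have hX : ∀ (R : Type) [CommRing R] [Nontrivial R],
      Nontrivial (Homogeneous.singularHomology R (q + 1) X) := fun R _ _ =>
    nontrivial_singularHomology_of_homotopic (nontrivial_singularHomology_punctured R q) _ g hfg
  refine ⟨fun hnull => ?_, hX, not_contractibleSpace_of_nontrivial (hX ℤ)⟩
  refine not_contractibleSpace_of_nontrivial (nontrivial_singularHomology_punctured ℤ q) ?_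
  rw [contractible_iff_id_nullhomotopic]
  -- A null-homotopy of the inclusion would pass to the composite through `f` and `g`, which is
  -- homotopic to the identity of the punctured space.
  obtain ⟨y, hy⟩ := (hnull.comp_left f).comp_right g
  exact ⟨y, hfg.symm.trans hy⟩

/-! ### Block decomposition and the projections of the subalgebras 𝔰𝔬(V ⊕ ℝⁿ). -/

namespace Homogeneous

open Matrix

attribute [local instance] LieRing.ofAssociativeRing

section Blocks

variable {k n : ℕ}

lemma so_transpose {ι : Type*} [Fintype ι] [DecidableEq ι] (W : soAlg ι) :
    W.1ᵀ = -W.1 :=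
  (LieAlgebra.Orthogonal.mem_so ι ℝ _).1 W.2

lemma traceForm_apply {ι : Type*} [Fintype ι] [DecidableEq ι] (X Y : soAlg ι) :
    traceForm ι X Y = -Matrix.trace (X.1 * Y.1) := rfl

lemma eq_zero_of_traceForm_self {ι : Type*} [Fintype ι] [DecidableEq ι] {X : soAlg ι}
    (h : traceForm ι X X = 0) : X = 0 := by
  rw [traceForm_apply, ← Matrix.trace_neg, ← Matrix.neg_mul, ← so_transpose,
    ← Matrix.conjTranspose_eq_transpose_of_trivial,
    Matrix.trace_conjTranspose_mul_self_eq_zero_iff] at h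
  exact Subtype.ext h

/-- The endomorphism `W ↦ W - (1 - M) W (1 - M)ᵀ`. -/
noncomputable def projOf {ι : Type*} [Fintype ι] [DecidableEq ι] (M : Matrix ι ι ℝ) :
    soAlg ι →L[ℝ] soAlg ι where
  toFun W := ⟨W.1 - (1 - M) * W.1 * (1 - M)ᵀ, by
    rw [LieAlgebra.Orthogonal.mem_so]
    simp only [transpose_sub, transpose_mul, so_transpose, transpose_transpose, Matrix.mul_neg,
      Matrix.neg_mul, Matrix.mul_assoc]
    abel⟩
  map_add' X Y := by
    apply Subtype.ext
    change X.1 + Y.1 - (1 - M) * (X.1 + Y.1) * (1 - M)ᵀ =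
      (X.1 - (1 - M) * X.1 * (1 - M)ᵀ) + (Y.1 - (1 - M) * Y.1 * (1 - M)ᵀ)
    rw [Matrix.mul_add, Matrix.add_mul]; abel
  map_smul' c X := by
    apply Subtype.ext
    change c • X.1 - (1 - M) * (c • X.1) * (1 - M)ᵀ =
      c • (X.1 - (1 - M) * X.1 * (1 - M)ᵀ)
    rw [Matrix.mul_smul, Matrix.smul_mul, smul_sub]
  cont := Continuous.subtype_mk (continuous_subtype_val.sub
    ((continuous_const.matrix_mul continuous_subtype_val).matrix_mul continuous_const)) _

lemma coe_projOf {ι : Type*} [Fintype ι] [DecidableEq ι] (M : Matrix ι ι ℝ) (W : soAlg ι) :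
    (projOf M W).1 = W.1 - (1 - M) * W.1 * (1 - M)ᵀ := rfl

lemma mul_coe_eq_zero_comm {ι : Type*} [Fintype ι] [DecidableEq ι] {M : Matrix ι ι ℝ} (hM : Mᵀ = M)
    {W : soAlg ι} (h : M * W.1 = 0) : W.1 * M = 0 := by
  have := congrArg Matrix.transpose h
  rwa [transpose_mul, hM, so_transpose, Matrix.neg_mul, transpose_zero, neg_eq_zero] at this

/-- The equation says that W equals its compression to ker M. By skewness, `M * W = 0` already
implies `W * M = 0`, so the kernel consists of the skew maps living on ker M. -/
lemma projOf_eq_zero_iff {ι : Type*} [Fintype ι] [DecidableEq ι] {M : Matrix ι ι ℝ} (hM : Mᵀ = M)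
    (hM' : M * M = M) {W : soAlg ι} : projOf M W = 0 ↔ M * W.1 = 0 := by
  rw [← Subtype.coe_inj, coe_projOf, transpose_sub, transpose_one, hM]
  constructor
  · intro h
    have h0 : M * (1 - M) = 0 := by rw [Matrix.mul_sub, hM', Matrix.mul_one, sub_self]
    have := congrArg (M * ·) h
    simpa [Matrix.mul_sub M W.1, ← Matrix.mul_assoc, h0] using this
  · intro h
    have h' := mul_coe_eq_zero_comm hM h
    rw [Matrix.sub_mul, h, Matrix.one_mul, sub_zero, Matrix.mul_sub, h', Matrix.mul_one, sub_zero,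
      sub_self]
    rfl

lemma projOf_projOf {ι : Type*} [Fintype ι] [DecidableEq ι] {M : Matrix ι ι ℝ} (hM : Mᵀ = M)
    (hM' : M * M = M) (W : soAlg ι) : projOf M (projOf M W) = projOf M W := by
  rw [← sub_eq_zero, ← map_sub, projOf_eq_zero_iff hM hM']
  have h0 : M * (1 - M) = 0 := by rw [Matrix.mul_sub, hM', Matrix.mul_one, sub_self]
  rw [AddSubgroupClass.coe_sub, coe_projOf, sub_sub_cancel_left, Matrix.mul_neg, ← Matrix.mul_assoc,
    ← Matrix.mul_assoc, h0]
  simp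

lemma traceForm_projOf {ι : Type*} [Fintype ι] [DecidableEq ι] {M : Matrix ι ι ℝ} (hM : Mᵀ = M)
    (X Y : soAlg ι) : traceForm ι (projOf M X) Y = traceForm ι X (projOf M Y) := by
  rw [traceForm_apply, traceForm_apply, coe_projOf, coe_projOf, transpose_sub, transpose_one, hM]
  generalize 1 - M = N
  rw [Matrix.sub_mul, Matrix.mul_sub, trace_sub, trace_sub]
  congr 2
  rw [Matrix.mul_assoc, Matrix.mul_assoc, Matrix.trace_mul_comm, Matrix.mul_assoc,
    Matrix.mul_assoc]

/-- A matrix in the upper left block. -/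
def hat (p : Matrix (Fin k) (Fin k) ℝ) : Matrix (Fin k ⊕ Fin n) (Fin k ⊕ Fin n) ℝ :=
  fromBlocks p 0 0 0

/-- The elements of `𝔰𝔬(k + n)` with vanishing diagonal blocks. -/
def off (M : Matrix (Fin k) (Fin n) ℝ) : soAlg (Fin k ⊕ Fin n) :=
  ⟨fromBlocks 0 M (-Mᵀ) 0, by
    rw [LieAlgebra.Orthogonal.mem_so]; simp [fromBlocks_transpose, fromBlocks_neg]⟩

/-- The elements of `𝔰𝔬(k + n)` supported in the upper left block. -/
def top (X : soAlg (Fin k)) : soAlg (Fin k ⊕ Fin n) :=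
  ⟨fromBlocks X 0 0 0, by
    rw [LieAlgebra.Orthogonal.mem_so]; simp [fromBlocks_transpose, fromBlocks_neg, so_transpose]⟩

/-- The elements of `𝔰𝔬(k + n)` supported in the lower right block. -/
def bot (Z : soAlg (Fin n)) : soAlg (Fin k ⊕ Fin n) :=
  ⟨fromBlocks 0 0 0 Z, by
    rw [LieAlgebra.Orthogonal.mem_so]; simp [fromBlocks_transpose, fromBlocks_neg, so_transpose]⟩

lemma coe_off (M : Matrix (Fin k) (Fin n) ℝ) :
    (off M : soAlg (Fin k ⊕ Fin n)).1 = fromBlocks 0 M (-Mᵀ) 0 := rfl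

lemma coe_top (X : soAlg (Fin k)) :
    (top X : soAlg (Fin k ⊕ Fin n)).1 = fromBlocks X 0 0 0 := rfl

lemma coe_bot (Z : soAlg (Fin n)) :
    (bot Z : soAlg (Fin k ⊕ Fin n)).1 = fromBlocks 0 0 0 Z := rfl

lemma bot_mem (Z : soAlg (Fin n)) : bot Z ∈ blockAlg k n := ⟨Z, Z.2, rfl⟩

lemma exists_eq_bot {X : soAlg (Fin k ⊕ Fin n)} (hX : X ∈ blockAlg k n) : ∃ Z, X = bot Z := by
  obtain ⟨Y, hY, h⟩ := hX
  exact ⟨⟨Y, hY⟩, Subtype.ext h⟩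

lemma exists_eq_top_add_off_add_bot (W : soAlg (Fin k ⊕ Fin n)) :
    ∃ X M Z, W = top X + off M + bot Z := by
  have h := so_transpose W
  rw [← fromBlocks_toBlocks W.1, fromBlocks_transpose,
    fromBlocks_neg, fromBlocks_inj] at h
  obtain ⟨h1, h2, -, h4⟩ := h
  refine ⟨⟨toBlocks₁₁ W.1, (LieAlgebra.Orthogonal.mem_so _ ℝ _).2 h1⟩,
    toBlocks₁₂ W.1, ⟨toBlocks₂₂ W.1,
      (LieAlgebra.Orthogonal.mem_so _ ℝ _).2 h4⟩, Subtype.ext ?_⟩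
  change W.1 = fromBlocks _ _ _ _ + fromBlocks _ _ _ _ + fromBlocks _ _ _ _
  rw [fromBlocks_add, fromBlocks_add]
  conv_lhs => rw [← fromBlocks_toBlocks W.1]
  congr 1
  · simp
  · simp
  · rw [← transpose_transpose (toBlocks₂₁ _), h2]; simp
  · simp

lemma trace_fromBlocks_eq (A : Matrix (Fin k) (Fin k) ℝ) (B C) (D : Matrix (Fin n) (Fin n) ℝ) :
    (fromBlocks A B C D).trace = A.trace + D.trace := by
  simp [Matrix.trace, Fintype.sum_sum_type]

lemma traceForm_off_top (M : Matrix (Fin k) (Fin n) ℝ) (X : soAlg (Fin k)) :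
    traceForm _ (off M) (top X) = 0 := by
  simp [traceForm_apply, coe_off, coe_top, fromBlocks_multiply, trace_fromBlocks_eq]

lemma traceForm_bot_off (Z : soAlg (Fin n)) (M : Matrix (Fin k) (Fin n) ℝ) :
    traceForm _ (bot Z) (off M) = 0 := by
  simp [traceForm_apply, coe_off, coe_bot, fromBlocks_multiply, trace_fromBlocks_eq]

lemma traceForm_bot_top (Z : soAlg (Fin n)) (X : soAlg (Fin k)) :
    traceForm _ (bot Z) (top X) = 0 := by
  simp [traceForm_apply, coe_top, coe_bot, fromBlocks_multiply]

lemma traceForm_bot_bot (Z Z' : soAlg (Fin n)) :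
    traceForm (Fin k ⊕ Fin n) (bot Z) (bot Z') = traceForm _ Z Z' := by
  simp [traceForm_apply, coe_bot, fromBlocks_multiply, trace_fromBlocks_eq]

lemma traceForm_top_top (X X' : soAlg (Fin k)) :
    traceForm (Fin k ⊕ Fin n) (top X) (top X') = traceForm _ X X' := by
  simp [traceForm_apply, coe_top, fromBlocks_multiply, trace_fromBlocks_eq]

lemma traceForm_off_off (M M' : Matrix (Fin k) (Fin n) ℝ) :
    traceForm _ (off M) (off M') = 2 * Matrix.trace (M * M'ᵀ) := by
  have : Matrix.trace (Mᵀ * M') = Matrix.trace (M * M'ᵀ) := by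
    rw [← Matrix.trace_transpose, transpose_mul, transpose_transpose, Matrix.trace_mul_comm]
  simp [traceForm_apply, coe_off, fromBlocks_multiply, trace_fromBlocks_eq, this]; ring

lemma hat_transpose {p : Matrix (Fin k) (Fin k) ℝ} (hp : pᵀ = p) :
    (hat p : Matrix (Fin k ⊕ Fin n) (Fin k ⊕ Fin n) ℝ)ᵀ = hat p := by
  simp [hat, fromBlocks_transpose, hp]

lemma hat_mul_hat (p q : Matrix (Fin k) (Fin k) ℝ) :
    (hat p : Matrix (Fin k ⊕ Fin n) (Fin k ⊕ Fin n) ℝ) * hat q = hat (p * q) := by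
  simp [hat, fromBlocks_multiply]

lemma projOf_mem_symEnd {p : Matrix (Fin k) (Fin k) ℝ} (hp : pᵀ = p) :
    projOf (hat p) ∈ symEnd (traceForm (Fin k ⊕ Fin n))
      ((adSO (Fin k ⊕ Fin n)).comp (blockSO k n)) := by
  refine ⟨traceForm_projOf (hat_transpose hp), fun a X => Subtype.ext ?_⟩
  set A : Matrix (Fin k ⊕ Fin n) (Fin k ⊕ Fin n) ℝ := fromBlocks 1 0 0 (a : Matrix _ _ ℝ)
  have h1 : (1 - hat p) * A = A * (1 - hat p) := by
    simp [A, hat, ← fromBlocks_one, fromBlocks_multiply, Matrix.sub_mul, Matrix.mul_sub]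
  have h2 : Aᵀ * (1 - hat p)ᵀ = (1 - hat p)ᵀ * Aᵀ := by
    rw [← transpose_mul, ← transpose_mul, h1]
  change A * X.1 * Aᵀ - (1 - hat p) * (A * X.1 * Aᵀ) * (1 - hat p)ᵀ =
    A * (X.1 - (1 - hat p) * X.1 * (1 - hat p)ᵀ) * Aᵀ
  simp only [Matrix.mul_sub A, Matrix.sub_mul _ _ Aᵀ]
  congr 1
  simp only [Matrix.mul_assoc]
  rw [h2, ← Matrix.mul_assoc, h1]
  simp only [Matrix.mul_assoc]

lemma hat_mul_off (p : Matrix (Fin k) (Fin k) ℝ) (M : Matrix (Fin k) (Fin n) ℝ) :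
    hat p * (off M : soAlg (Fin k ⊕ Fin n)).1 = fromBlocks 0 (p * M) 0 0 := by
  simp [hat, coe_off, fromBlocks_multiply]

lemma hat_mul_bot (p : Matrix (Fin k) (Fin k) ℝ) (Z : soAlg (Fin n)) :
    hat p * (bot Z : soAlg (Fin k ⊕ Fin n)).1 = 0 := by
  simp [hat, coe_bot, fromBlocks_multiply]

lemma fromBlocks_eq_zero_iff {A : Matrix (Fin k) (Fin n) ℝ} :
    (fromBlocks 0 A 0 0 : Matrix (Fin k ⊕ Fin n) (Fin k ⊕ Fin n) ℝ) = 0 ↔ A = 0 := by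
  rw [← fromBlocks_zero, fromBlocks_inj]; simp

lemma off_eq_bot_iff {M : Matrix (Fin k) (Fin n) ℝ} {Z : soAlg (Fin n)} :
    off M = bot Z → M = 0 := by
  intro h
  have := congrArg Subtype.val h
  change fromBlocks 0 M (-Mᵀ) 0 = fromBlocks 0 0 0 (Z : Matrix _ _ ℝ) at this
  exact (fromBlocks_inj.1 this).2.1

/-- The projections onto the complements of the subalgebras `𝔰𝔬(V ⊕ ℝⁿ)`. -/
lemma projOf_mem_projNontoral (hn : 2 ≤ n) {p : Matrix (Fin k) (Fin k) ℝ} (hp : pᵀ = p)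
    (hp' : p * p = p) (h0 : p ≠ 0) (h1 : p ≠ 1) :
    projOf (hat p) ∈ projNontoral (traceForm (Fin k ⊕ Fin n)) (blockAlg k n)
      ((adSO (Fin k ⊕ Fin n)).comp (blockSO k n)) := by
  have hh := hat_transpose (n := n) hp
  have hh' : (hat p : Matrix (Fin k ⊕ Fin n) (Fin k ⊕ Fin n) ℝ) * hat p = hat p := by
    rw [hat_mul_hat, hp']
  have hker : ∀ W : soAlg (Fin k ⊕ Fin n), projOf (hat p) W = 0 ↔ hat p * W.1 = 0 := fun W =>
    projOf_eq_zero_iff hh hh'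
  have hq : p * (1 - p) = 0 := by rw [Matrix.mul_sub, hp', Matrix.mul_one, sub_self]
  have hne : 1 - p ≠ 0 := sub_ne_zero.2 h1.symm
  obtain ⟨a, b, hab⟩ : ∃ a b, (1 - p) a b ≠ 0 := by
    by_contra! h; exact hne (Matrix.ext h)
  obtain ⟨a', b', hab'⟩ : ∃ a b, p a b ≠ 0 := by
    by_contra! h; exact h0 (Matrix.ext h)
  -- A non-zero column of `1 - p`, a vector in ker p, is placed in column `x`. Two different columns
  -- give non-commuting elements of the kernel orthogonal to 𝔥.
  let M : Fin n → Matrix (Fin k) (Fin n) ℝ := fun x => (1 - p) * Matrix.single b x (1 : ℝ)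
  have hM : ∀ x, projOf (hat p) (off (M x)) = 0 := fun x => by
    rw [hker]
    rw [hat_mul_off, ← Matrix.mul_assoc, hq, Matrix.zero_mul, fromBlocks_zero]
  let x : Fin n := ⟨0, by omega⟩
  let y : Fin n := ⟨1, by omega⟩
  have hxy : y ≠ x := by simp [x, y]
  refine ⟨⟨projOf_mem_symEnd hp, projOf_projOf hh hh', ?_, ?_, ?_⟩, off (M x), off (M y), hM x, ?_,
    hM y, ?_, ?_⟩
  · refine lt_of_le_of_ne (fun X hX => ?_) fun he => ?_
    · obtain ⟨Z, rfl⟩ := exists_eq_bot hX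
      exact (hker _).2 (hat_mul_bot p Z)
    · have : off (M x) ∈ (blockAlg k n).toSubmodule := by rw [he]; exact hM x
      obtain ⟨Z, hZ⟩ := exists_eq_bot this
      have := congrFun₂ (off_eq_bot_iff hZ) a x
      exact hab (by simpa [M] using this)
  · rw [lt_top_iff_ne_top]
    intro he
    have : off (Matrix.single b' x (1 : ℝ)) ∈ LinearMap.ker
        (projOf (hat p) : soAlg (Fin k ⊕ Fin n) →L[ℝ] soAlg (Fin k ⊕ Fin n)).toLinearMap := by
      rw [he]; trivial
    have h2 := (hker _).1 this
    change hat p * (off _).1 = 0 at h2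
    rw [hat_mul_off, fromBlocks_eq_zero_iff] at h2
    have := congrFun₂ h2 a' x
    exact hab' (by simpa using this)
  · intro X Y hX hY
    rw [hker] at *
    rw [LieSubalgebra.coe_bracket, Ring.lie_def, Matrix.mul_sub, ← Matrix.mul_assoc,
      ← Matrix.mul_assoc, hX, hY]
    simp
  · intro Z hZ
    obtain ⟨Z, rfl⟩ := exists_eq_bot hZ
    exact traceForm_bot_off _ _
  · intro Z hZ
    obtain ⟨Z, rfl⟩ := exists_eq_bot hZ
    exact traceForm_bot_off _ _
  · intro h
    -- This entry of the bracket is minus the squared length of column `b` of `1 - p`.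
    have h2 := congrFun₂ (congrArg Subtype.val h) (Sum.inr x) (Sum.inr y)
    change (⁅off (M x), off (M y)⁆ : soAlg (Fin k ⊕ Fin n)).1 (Sum.inr x) (Sum.inr y) = 0 at h2
    rw [LieSubalgebra.coe_bracket, Ring.lie_def, coe_off, coe_off, fromBlocks_multiply,
      fromBlocks_multiply] at h2
    simp only [Matrix.sub_apply, fromBlocks_apply₂₂, Matrix.neg_mul, Matrix.mul_zero,
      add_zero, Matrix.neg_apply, Matrix.mul_apply, transpose_apply] at h2
    have hMx : ∀ c z w, M z c w = if w = z then (1 - p) c b else 0 := fun c z w => by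
      split_ifs with hw
      · subst hw; simp [M]
      · simp [M, hw]
    simp only [hMx, if_true, if_neg hxy, if_neg hxy.symm, mul_zero,
      Finset.sum_const_zero] at h2
    have h3 : ∑ c, (1 - p) c b * (1 - p) c b = 0 := by linarith
    rw [Finset.sum_eq_zero_iff_of_nonneg fun c _ => mul_self_nonneg _] at h3
    exact hab (mul_self_eq_zero.1 (h3 a (Finset.mem_univ a)))

end Blocks

/-! ### Equivariance under 𝔰𝔬(n) and the symbol of a projection. -/

section Structure

variable {k n : ℕ}

lemma traceForm_lie {ι : Type*} [Fintype ι] [DecidableEq ι] (X Y Z : soAlg ι) :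
    traceForm ι ⁅Z, X⁆ Y = -traceForm ι X ⁅Z, Y⁆ := by
  simp only [traceForm_apply, LieSubalgebra.coe_bracket, Ring.lie_def, Matrix.sub_mul,
    Matrix.mul_sub, trace_sub]
  rw [Matrix.mul_assoc Z.1, Matrix.trace_mul_comm Z.1, Matrix.mul_assoc X.1, Matrix.mul_assoc X.1]
  ring

lemma bot_lie_off (Z : soAlg (Fin n)) (M : Matrix (Fin k) (Fin n) ℝ) :
    ⁅(bot Z : soAlg (Fin k ⊕ Fin n)), off M⁆ = off (-(M * Z.1)) := by
  apply Subtype.ext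
  rw [LieSubalgebra.coe_bracket, Ring.lie_def, coe_off, coe_off, coe_bot, fromBlocks_multiply,
    fromBlocks_multiply, sub_eq_add_neg, fromBlocks_neg, fromBlocks_add]
  simp [transpose_mul, so_transpose]

lemma bot_lie_top (Z : soAlg (Fin n)) (X : soAlg (Fin k)) :
    ⁅(bot Z : soAlg (Fin k ⊕ Fin n)), (top X : soAlg (Fin k ⊕ Fin n))⁆ = 0 := by
  apply Subtype.ext
  rw [LieSubalgebra.coe_bracket, Ring.lie_def, coe_top, coe_bot, fromBlocks_multiply,
    fromBlocks_multiply]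
  simp

lemma top_lie_off (X : soAlg (Fin k)) (M : Matrix (Fin k) (Fin n) ℝ) :
    ⁅(top X : soAlg (Fin k ⊕ Fin n)), off M⁆ = off (X.1 * M) := by
  apply Subtype.ext
  rw [LieSubalgebra.coe_bracket, Ring.lie_def, coe_off, coe_off, coe_top, fromBlocks_multiply,
    fromBlocks_multiply, sub_eq_add_neg, fromBlocks_neg, fromBlocks_add]
  simp [transpose_mul, so_transpose]

lemma off_injective : Function.Injective (off : Matrix (Fin k) (Fin n) ℝ → _) := fun _ _ h =>
  (fromBlocks_inj.1 (congrArg Subtype.val h)).2.1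

lemma off_add (M M' : Matrix (Fin k) (Fin n) ℝ) : off (M + M') = off M + off M' := by
  apply Subtype.ext
  change fromBlocks _ _ _ _ = fromBlocks _ _ _ _ + fromBlocks _ _ _ _
  rw [fromBlocks_add, transpose_add, neg_add, add_zero, add_zero]

lemma off_smul (c : ℝ) (M : Matrix (Fin k) (Fin n) ℝ) : off (c • M) = c • off M := by
  apply Subtype.ext
  change fromBlocks _ _ _ _ = c • fromBlocks _ _ _ _
  rw [fromBlocks_smul, transpose_smul, smul_zero, smul_zero, smul_neg]

lemma off_zero : off (0 : Matrix (Fin k) (Fin n) ℝ) = 0 := by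
  have := off_smul 0 (0 : Matrix (Fin k) (Fin n) ℝ)
  rwa [zero_smul, zero_smul] at this

lemma top_zero : (top 0 : soAlg (Fin k ⊕ Fin n)) = 0 := by
  apply Subtype.ext; exact fromBlocks_zero

lemma bot_zero : (bot 0 : soAlg (Fin k ⊕ Fin n)) = 0 := by
  apply Subtype.ext; exact fromBlocks_zero

/-- The skew matrix `E_{xy} - E_{yx}`. -/
def skewUnit (x y : Fin n) : soAlg (Fin n) :=
  ⟨Matrix.single x y 1 - Matrix.single y x (1 : ℝ), by
    rw [LieAlgebra.Orthogonal.mem_so]; simp [transpose_sub]⟩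

lemma coe_skewUnit (x y : Fin n) :
    (skewUnit x y).1 = Matrix.single x y 1 - Matrix.single y x (1 : ℝ) := rfl

variable {P : soAlg (Fin k ⊕ Fin n) →L[ℝ] soAlg (Fin k ⊕ Fin n)}
  {H : Type*} [Group H] {Ad : Representation ℝ H (soAlg (Fin k ⊕ Fin n))}

lemma map_bot_eq_zero (hP : P ∈ projAlg (traceForm (Fin k ⊕ Fin n)) (blockAlg k n) Ad)
    (Z : soAlg (Fin n)) : P (bot Z) = 0 := hP.2.2.1.le (bot_mem Z)

/-- The kernel is a subalgebra containing 𝔥, hence stable under ad 𝔥. Since ad is skew for the trace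
form, the orthogonal complement, which is the image of `P`, is stable too. No differentiation of the
`Ad`-equivariance is involved. -/
lemma map_bot_lie (hP : P ∈ projAlg (traceForm (Fin k ⊕ Fin n)) (blockAlg k n) Ad)
    (Z : soAlg (Fin n)) (X : soAlg (Fin k ⊕ Fin n)) :
    P ⁅(bot Z : soAlg (Fin k ⊕ Fin n)), X⁆ = ⁅(bot Z : soAlg (Fin k ⊕ Fin n)), P X⁆ := by
  have hid := hP.2.1
  have hlie := hP.2.2.2.2
  have hZ := map_bot_eq_zero hP Z
  have h1 : P ⁅(bot Z : soAlg (Fin k ⊕ Fin n)), X⁆ = P ⁅(bot Z : soAlg (Fin k ⊕ Fin n)), P X⁆ := by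
    rw [← sub_eq_zero, ← map_sub, ← lie_sub]
    exact hlie _ _ hZ (by rw [map_sub, hid, sub_self])
  rw [h1]
  set V := ⁅(bot Z : soAlg (Fin k ⊕ Fin n)), P X⁆ with hV
  have hW : P (V - P V) = 0 := by rw [map_sub, hid, sub_self]
  have h2 : traceForm _ V (V - P V) = 0 := by
    rw [hV, traceForm_lie, ← hV, hP.1.1, hlie _ _ hZ hW, map_zero, neg_zero]
  have h3 : traceForm _ (P V) (V - P V) = 0 := by rw [hP.1.1, hW, map_zero]
  exact (sub_eq_zero.1 (eq_zero_of_traceForm_self (by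
    rw [LinearMap.map_sub₂, h2, h3, sub_self]))).symm

lemma exists_map_eq_top_add_off
    (hP : P ∈ projAlg (traceForm (Fin k ⊕ Fin n)) (blockAlg k n) Ad)
    (W : soAlg (Fin k ⊕ Fin n)) : ∃ X M, P W = top X + off M := by
  obtain ⟨X, M, Z, h⟩ := exists_eq_top_add_off_add_bot (P W)
  have h0 : traceForm _ (bot Z) (P W) = 0 := by rw [← hP.1.1, map_bot_eq_zero hP, map_zero]; rfl
  rw [h, map_add, map_add, traceForm_bot_off, traceForm_bot_top, traceForm_bot_bot, zero_add,
    zero_add] at h0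
  refine ⟨X, M, ?_⟩
  rw [h, eq_zero_of_traceForm_self h0, bot_zero, add_zero]

/-- The upper left block is fixed by 𝔰𝔬(n), so its image is as well, and for n ≥ 2 the off-diagonal
block has no non-zero fixed vector. -/
lemma exists_map_top (hn : 2 ≤ n)
    (hP : P ∈ projAlg (traceForm (Fin k ⊕ Fin n)) (blockAlg k n) Ad)
    (X : soAlg (Fin k)) : ∃ X', P (top X) = top X' := by
  obtain ⟨X', M, h⟩ := exists_map_eq_top_add_off hP (top X)
  have hM : ∀ Z : soAlg (Fin n), M * Z.1 = 0 := fun Z => by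
    have := map_bot_lie hP Z (top X)
    rw [bot_lie_top, map_zero, h, lie_add, bot_lie_top, zero_add, bot_lie_off, ← off_zero] at this
    exact neg_eq_zero.1 (off_injective this).symm
  refine ⟨X', ?_⟩
  suffices M = 0 by rw [h, this, off_zero, add_zero]
  ext a x
  obtain ⟨y, hy⟩ : ∃ y : Fin n, y ≠ x := by
    have : Nontrivial (Fin n) := Fin.nontrivial_iff_two_le.2 hn
    exact exists_ne x
  have := congrFun₂ (hM (skewUnit x y)) a y
  rw [coe_skewUnit, Matrix.mul_sub] at this
  simpa [hy] using this

lemma exists_map_off (hn : 2 ≤ n)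
    (hP : P ∈ projAlg (traceForm (Fin k ⊕ Fin n)) (blockAlg k n) Ad)
    (M : Matrix (Fin k) (Fin n) ℝ) : ∃ M', P (off M) = off M' := by
  obtain ⟨X, M', h⟩ := exists_map_eq_top_add_off hP (off M)
  obtain ⟨X', hX'⟩ := exists_map_top hn hP X
  have h0 : traceForm _ (P (off M)) (top X) = 0 := by rw [hP.1.1, hX', traceForm_off_top]
  rw [h, map_add, LinearMap.add_apply, traceForm_off_top, add_zero, traceForm_top_top] at h0
  exact ⟨M', by rw [h, eq_zero_of_traceForm_self h0, top_zero, zero_add]⟩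

/-- The action of an endomorphism on the off-diagonal block. -/
noncomputable def offBlock (P : soAlg (Fin k ⊕ Fin n) →L[ℝ] soAlg (Fin k ⊕ Fin n)) :
    Matrix (Fin k) (Fin n) ℝ →ₗ[ℝ] Matrix (Fin k) (Fin n) ℝ where
  toFun M := toBlocks₁₂ (P (off M)).1
  map_add' M M' := by rw [off_add, map_add]; rfl
  map_smul' c M := by rw [off_smul, map_smul]; rfl

lemma map_off (hn : 2 ≤ n) (hP : P ∈ projAlg (traceForm (Fin k ⊕ Fin n)) (blockAlg k n) Ad)
    (M : Matrix (Fin k) (Fin n) ℝ) : P (off M) = off (offBlock P M) := by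
  obtain ⟨M', h⟩ := exists_map_off hn hP M
  have : offBlock P M = M' := by change toBlocks₁₂ (P (off M)).1 = M'; rw [h]; rfl
  rw [this, h]

lemma offBlock_mul_skew (hn : 2 ≤ n)
    (hP : P ∈ projAlg (traceForm (Fin k ⊕ Fin n)) (blockAlg k n) Ad)
    (M : Matrix (Fin k) (Fin n) ℝ) (Z : soAlg (Fin n)) :
    offBlock P (M * Z.1) = offBlock P M * Z.1 := by
  have := map_bot_lie hP Z (off M)
  rw [bot_lie_off, map_off hn hP, map_off hn hP, bot_lie_off, map_neg] at this
  exact neg_injective (off_injective this)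

/-- For n ≥ 3 the skew matrices generate the full matrix algebra: with a third index z, the matrix
unit at (x, y) is a product of two skew units. For n = 2 they only generate a copy of ℂ. Commuting
with all right multiplications, `P` must act on this block by a left multiplication. -/
lemma offBlock_mul_single (hn : 3 ≤ n)
    (hP : P ∈ projAlg (traceForm (Fin k ⊕ Fin n)) (blockAlg k n) Ad)
    (M : Matrix (Fin k) (Fin n) ℝ) (x y : Fin n) :
    offBlock P (M * Matrix.single x y (1 : ℝ)) = offBlock P M * Matrix.single x y (1 : ℝ) := by
  have key : ∀ (M : Matrix (Fin k) (Fin n) ℝ) (x y : Fin n), x ≠ y →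
      offBlock P (M * Matrix.single x y (1 : ℝ)) = offBlock P M * Matrix.single x y (1 : ℝ) := by
    intro M x y hxy
    obtain ⟨z, hzx, hzy⟩ : ∃ z : Fin n, z ≠ x ∧ z ≠ y := by
      have : ({x, y} : Finset (Fin n)).card < Fintype.card (Fin n) := by
        rw [Fintype.card_fin]; exact (Finset.card_le_two).trans_lt (by omega)
      obtain ⟨z, hz⟩ := Finset.exists_mem_notMem_of_card_lt_card (t := Finset.univ) this
      exact ⟨z, by simpa [not_or] using hz.2⟩
    have e : (Matrix.single x y 1 : Matrix (Fin n) (Fin n) ℝ) =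
        (skewUnit x z).1 * (skewUnit z y).1 := by
      simp [coe_skewUnit, Matrix.sub_mul, Matrix.mul_sub, hzy, hxy, hzx.symm]
    rw [e, ← Matrix.mul_assoc, offBlock_mul_skew (by omega) hP, offBlock_mul_skew (by omega) hP,
      Matrix.mul_assoc]
  rcases eq_or_ne x y with rfl | hxy
  · have : Nontrivial (Fin n) := Fin.nontrivial_iff_two_le.2 (by omega)
    obtain ⟨z, hz⟩ := exists_ne x
    have e : (Matrix.single x x 1 : Matrix (Fin n) (Fin n) ℝ) =
        Matrix.single x z (1 : ℝ) * Matrix.single z x (1 : ℝ) := by simp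
    rw [e, ← Matrix.mul_assoc, key _ _ _ hz, key _ _ _ hz.symm, Matrix.mul_assoc]
  · exact key M x y hxy

/-- The symmetric matrix through which an equivariant endomorphism acts on `ℝᵏ ⊗ ℝⁿ`. -/
noncomputable def symbol (x : Fin n) (B : soAlg (Fin k ⊕ Fin n) →L[ℝ] soAlg (Fin k ⊕ Fin n)) :
    Matrix (Fin k) (Fin k) ℝ :=
  Matrix.of fun a b => (B (off (Matrix.single b x (1 : ℝ)))).1 (Sum.inl a) (Sum.inr x)

lemma map_off_eq_symbol (hn : 3 ≤ n) (x : Fin n)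
    (hP : P ∈ projAlg (traceForm (Fin k ⊕ Fin n)) (blockAlg k n) Ad)
    (M : Matrix (Fin k) (Fin n) ℝ) : P (off M) = off (symbol x P * M) := by
  rw [map_off (by omega) hP]
  congr 1
  ext a y
  have h1 : offBlock P M a y = offBlock P (M * Matrix.single y x (1 : ℝ)) a x := by
    rw [offBlock_mul_single hn hP]; simp
  have h2 : M * Matrix.single y x (1 : ℝ) = ∑ b, M b y • Matrix.single b x (1 : ℝ) := by
    ext c z
    rcases eq_or_ne z x with rfl | hz
    · simp [Matrix.sum_apply, Matrix.single_apply]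
    · simp [hz, Matrix.sum_apply, hz.symm]
  rw [h1, h2, map_sum, Matrix.sum_apply, Matrix.mul_apply]
  refine Finset.sum_congr rfl fun b _ => ?_
  rw [map_smul, Matrix.smul_apply, smul_eq_mul, mul_comm]
  rfl

lemma symbol_eq_of_map_off {x : Fin n} {p : Matrix (Fin k) (Fin k) ℝ}
    (h : ∀ M, P (off M) = off (p * M)) : symbol x P = p := by
  ext a b
  change (P (off (Matrix.single b x (1 : ℝ)))).1 (Sum.inl a) (Sum.inr x) = _
  rw [h]
  simp [coe_off]

lemma symbol_mul_self (hn : 3 ≤ n) (x : Fin n)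
    (hP : P ∈ projAlg (traceForm (Fin k ⊕ Fin n)) (blockAlg k n) Ad) :
    symbol x P * symbol x P = symbol x P := by
  refine (symbol_eq_of_map_off (P := P) (x := x) fun M => ?_).symm
  rw [← hP.2.1 (off M), map_off_eq_symbol hn x hP, map_off_eq_symbol hn x hP, Matrix.mul_assoc]

lemma symbol_transpose (hn : 3 ≤ n) (x : Fin n)
    (hP : P ∈ projAlg (traceForm (Fin k ⊕ Fin n)) (blockAlg k n) Ad) :
    (symbol x P)ᵀ = symbol x P := by
  ext a b
  have h := hP.1.1 (off (Matrix.single a x (1 : ℝ))) (off (Matrix.single b x (1 : ℝ)))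
  rw [map_off_eq_symbol hn x hP, map_off_eq_symbol hn x hP, traceForm_off_off,
    traceForm_off_off, transpose_mul, Matrix.mul_assoc,
    ← Matrix.mul_assoc (Matrix.single a x (1 : ℝ)), transpose_single, single_mul_single_same, trace_mul_comm] at h
  simpa [Matrix.trace_single_mul] using h

end Structure

/-! ### Continuity of families of endomorphisms. -/

section Topology

variable {V : Type*} [AddCommGroup V] [Module ℝ V] [TopologicalSpace V] [IsTopologicalAddGroup V]
  [ContinuousSMul ℝ V] [T2Space V] [FiniteDimensional ℝ V]

instance finiteDimensional_clm : FiniteDimensional ℝ (V →L[ℝ] V) :=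
  FiniteDimensional.of_injective (ContinuousLinearMap.coeLM ℝ : (V →L[ℝ] V) →ₗ[ℝ] V →ₗ[ℝ] V)
    ContinuousLinearMap.coe_injective

/-- Evaluation at all vectors is an injective linear map on a finite-dimensional space, hence an
embedding for the topology of pointwise convergence. -/
lemma continuous_clm_of_apply {T : Type*} [TopologicalSpace T] {F : T → V →L[ℝ] V}
    (h : ∀ v, Continuous fun t => F t v) : Continuous F := by
  let ev : (V →L[ℝ] V) →ₗ[ℝ] (V → V) :=
    { toFun := fun B => B, map_add' := fun _ _ => rfl, map_smul' := fun _ _ => rfl }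
  have hev : Topology.IsClosedEmbedding ev :=
    LinearMap.isClosedEmbedding_of_injective (LinearMap.ker_eq_bot.2 DFunLike.coe_injective)
  rw [hev.isInducing.continuous_iff]
  exact continuous_pi h

end Topology

/-! ### Flag simplices and their dependence on the symbol alone. -/

section Flags

variable {k n m : ℕ}

lemma sum_smul_mem_symEnd {𝔤 : Type*} [LieRing 𝔤] [LieAlgebra ℝ 𝔤]
    [TopologicalSpace 𝔤] [IsTopologicalAddGroup 𝔤] [ContinuousSMul ℝ 𝔤]
    {Q : LinearMap.BilinForm ℝ 𝔤} {H : Type*} [Group H] {Ad : Representation ℝ H 𝔤}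
    {ι : Type*} [Fintype ι] {P : ι → 𝔤 →L[ℝ] 𝔤} (hP : ∀ i, P i ∈ symEnd Q Ad) (c : ι → ℝ) :
    ∑ i, c i • P i ∈ symEnd Q Ad := by
  constructor
  · intro X Y
    simp only [_root_.sum_apply, _root_.smul_apply, map_sum,
      LinearMap.sum_apply, map_smul, LinearMap.smul_apply, (hP _).1]
  · intro a X
    simp only [_root_.sum_apply, _root_.smul_apply, map_sum,
      map_smul, (hP _).2]

lemma projOf_off (p : Matrix (Fin k) (Fin k) ℝ) (M : Matrix (Fin k) (Fin n) ℝ) :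
    projOf (hat p) (off M) = off (p * M) := by
  apply Subtype.ext
  rw [coe_projOf, coe_off, coe_off, hat, ← fromBlocks_one, sub_eq_add_neg _ (fromBlocks p 0 0 0),
    fromBlocks_neg, fromBlocks_add, fromBlocks_transpose, fromBlocks_multiply, fromBlocks_multiply,
    sub_eq_add_neg, fromBlocks_neg, fromBlocks_add]
  simp [Matrix.add_mul, Matrix.mul_add, transpose_mul]

lemma projOf_bot {p : Matrix (Fin k) (Fin k) ℝ} (Z : soAlg (Fin n)) :
    projOf (hat p) (bot Z) = 0 := by
  apply Subtype.ext
  rw [coe_projOf, coe_bot, hat, ← fromBlocks_one, sub_eq_add_neg _ (fromBlocks p 0 0 0),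
    fromBlocks_neg, fromBlocks_add, fromBlocks_transpose, fromBlocks_multiply, fromBlocks_multiply,
    sub_eq_add_neg, fromBlocks_neg, fromBlocks_add]
  simp

lemma projOf_top {p : Matrix (Fin k) (Fin k) ℝ} (hp : pᵀ = p) (X : soAlg (Fin k)) :
    (projOf (hat p) (top X : soAlg (Fin k ⊕ Fin n))).1 =
      fromBlocks (p * X.1 + X.1 * p - p * X.1 * p) 0 0 0 := by
  rw [coe_projOf, coe_top, hat, ← fromBlocks_one, sub_eq_add_neg _ (fromBlocks p 0 0 0),
    fromBlocks_neg, fromBlocks_add, fromBlocks_transpose, fromBlocks_multiply, fromBlocks_multiply,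
    sub_eq_add_neg, fromBlocks_neg, fromBlocks_add]
  congr 1
  · simp only [neg_zero, add_zero, Matrix.mul_zero, transpose_add, transpose_neg,
      transpose_one, hp, transpose_zero, Matrix.add_mul, Matrix.mul_add, Matrix.one_mul,
      Matrix.mul_one, Matrix.neg_mul, Matrix.mul_neg]
    abel
  all_goals simp

/-- The conjugate of a diagonal matrix. -/
def conjDiag (g : Matrix (Fin k) (Fin k) ℝ) (d : Fin k → ℝ) : Matrix (Fin k) (Fin k) ℝ :=
  g * diagonal d * gᵀ

lemma conjDiag_transpose (g : Matrix (Fin k) (Fin k) ℝ) (d : Fin k → ℝ) :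
    (conjDiag g d)ᵀ = conjDiag g d := by
  simp [conjDiag, transpose_mul, Matrix.mul_assoc]

lemma conjDiag_mul_conjDiag {g : Matrix (Fin k) (Fin k) ℝ} (hg : gᵀ * g = 1) (d e : Fin k → ℝ) :
    conjDiag g d * conjDiag g e = conjDiag g (d * e) := by
  calc g * diagonal d * gᵀ * (g * diagonal e * gᵀ)
      = g * diagonal d * (gᵀ * g) * diagonal e * gᵀ := by simp only [Matrix.mul_assoc]
    _ = conjDiag g (d * e) := by
        rw [hg, Matrix.mul_one, Matrix.mul_assoc g, diagonal_mul_diagonal]; rfl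

lemma transpose_mul_conjDiag_mul {g : Matrix (Fin k) (Fin k) ℝ} (hg : gᵀ * g = 1)
    (d : Fin k → ℝ) : gᵀ * conjDiag g d * g = diagonal d := by
  calc gᵀ * (g * diagonal d * gᵀ) * g = (gᵀ * g) * diagonal d * (gᵀ * g) := by
        simp only [Matrix.mul_assoc]
    _ = diagonal d := by rw [hg, Matrix.one_mul, Matrix.mul_one]

lemma conjDiag_injective {g : Matrix (Fin k) (Fin k) ℝ} (hg : gᵀ * g = 1) :
    Function.Injective (conjDiag g) := fun d e h =>
  diagonal_injective (by
    rw [← transpose_mul_conjDiag_mul hg d, h, transpose_mul_conjDiag_mul hg e])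

lemma conjDiag_sum (g : Matrix (Fin k) (Fin k) ℝ) {ι : Type*} [Fintype ι] (c : ι → ℝ)
    (d : ι → Fin k → ℝ) : ∑ j, c j • conjDiag g (d j) = conjDiag g (∑ j, c j • d j) := by
  have : diagonal (∑ j, c j • d j) = ∑ j, c j • diagonal (d j) := by
    simp only [← diagonal_smul]
    exact map_sum (diagonalAddMonoidHom (Fin k) ℝ) _ _
  rw [conjDiag, this, Matrix.mul_sum, Matrix.sum_mul]
  simp [conjDiag]

lemma conjDiag_one {g : Matrix (Fin k) (Fin k) ℝ} (hg : gᵀ * g = 1) : conjDiag g 1 = 1 := by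
  rw [conjDiag, show diagonal (1 : Fin k → ℝ) = 1 from diagonal_one, Matrix.mul_one,
    mul_eq_one_comm.1 hg]

lemma conjDiag_zero (g : Matrix (Fin k) (Fin k) ℝ) : conjDiag g 0 = 0 := by
  rw [conjDiag, show diagonal (0 : Fin k → ℝ) = 0 from diagonal_zero]; simp

/-- The indicator function of the coordinates after `j`. -/
def after (j : Fin (m + 1)) (a : Fin (m + 2)) : ℝ := if j.castSucc < a then 1 else 0

lemma after_mul_after {i j : Fin (m + 1)} (h : i ≤ j) : after j * after i = after j := by
  funext a
  simp only [Pi.mul_apply, after]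
  split_ifs with h1 h2 <;> simp
  exact h2 ((Fin.castSucc_le_castSucc_iff.2 h).trans_lt h1)

/-- The endomorphism attached to an orthonormal frame and barycentric coordinates on the flag that
it spans. -/
noncomputable def flagEnd (n : ℕ) (g : Matrix (Fin (m + 2)) (Fin (m + 2)) ℝ) (c : Fin (m + 1) → ℝ) :
    soAlg (Fin (m + 2) ⊕ Fin n) →L[ℝ] soAlg (Fin (m + 2) ⊕ Fin n) :=
  ∑ j, c j • (projOf (hat (conjDiag g (after j))) :
    soAlg (Fin (m + 2) ⊕ Fin n) →L[ℝ] soAlg (Fin (m + 2) ⊕ Fin n))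

lemma conjDiag_after_ne_zero {g : Matrix (Fin (m + 2)) (Fin (m + 2)) ℝ} (hg : gᵀ * g = 1)
    (j : Fin (m + 1)) : conjDiag g (after j) ≠ 0 := by
  rw [← conjDiag_zero g]
  refine (conjDiag_injective hg).ne fun h => ?_
  have := congrFun h j.succ
  simp [after] at this

lemma conjDiag_after_ne_one {g : Matrix (Fin (m + 2)) (Fin (m + 2)) ℝ} (hg : gᵀ * g = 1)
    (j : Fin (m + 1)) : conjDiag g (after j) ≠ 1 := by
  rw [← conjDiag_one hg]
  refine (conjDiag_injective hg).ne fun h => ?_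
  have := congrFun h j.castSucc
  simp [after] at this

lemma conjDiag_after_mul {g : Matrix (Fin (m + 2)) (Fin (m + 2)) ℝ} (hg : gᵀ * g = 1)
    {i j : Fin (m + 1)} (h : i ≤ j) :
    conjDiag g (after j) * conjDiag g (after i) = conjDiag g (after j) := by
  rw [conjDiag_mul_conjDiag hg, after_mul_after h]

lemma projOf_flag_mem (hn : 2 ≤ n) {g : Matrix (Fin (m + 2)) (Fin (m + 2)) ℝ} (hg : gᵀ * g = 1)
    (j : Fin (m + 1)) : projOf (hat (conjDiag g (after j))) ∈
      projNontoral (traceForm (Fin (m + 2) ⊕ Fin n)) (blockAlg (m + 2) n)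
      ((adSO (Fin (m + 2) ⊕ Fin n)).comp (blockSO (m + 2) n)) :=
  projOf_mem_projNontoral hn (conjDiag_transpose _ _) (conjDiag_after_mul hg le_rfl)
    (conjDiag_after_ne_zero hg j) (conjDiag_after_ne_one hg j)

lemma projOf_hat_eq_zero_iff {p : Matrix (Fin k) (Fin k) ℝ} (hp : pᵀ = p) (hp' : p * p = p)
    (W : soAlg (Fin k ⊕ Fin n)) : projOf (hat p) W = 0 ↔ hat p * W.1 = 0 :=
  projOf_eq_zero_iff (hat_transpose hp) (by rw [hat_mul_hat, hp'])

lemma flagEnd_mem (hn : 2 ≤ n) {g : Matrix (Fin (m + 2)) (Fin (m + 2)) ℝ} (hg : gᵀ * g = 1)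
    {c : Fin (m + 1) → ℝ} (hc : c ∈ stdSimplex ℝ (Fin (m + 1))) :
    flagEnd n g c ∈ nerveSO (m + 2) n := by
  have hP := projOf_flag_mem hn hg
  have hmul := fun {i j : Fin (m + 1)} (h : i ≤ j) => conjDiag_after_mul hg h
  have hker := fun (j : Fin (m + 1)) => projOf_hat_eq_zero_iff (n := n)
    (conjDiag_transpose g (after j)) (hmul le_rfl)
  refine ⟨sum_smul_mem_symEnd (fun j => (hP j).1.1) c, m + 1, _, c, hP, fun i j hij => ?_, hc.1,
    hc.2, rfl⟩
  refine lt_of_le_of_ne (fun W hW => ?_) fun he => ?_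
  · refine (hker j W).2 ?_
    rw [← hmul hij.le, ← hat_mul_hat, Matrix.mul_assoc]
    have : hat (conjDiag g (after i)) * W.1 = 0 := (hker i W).1 hW
    rw [this, Matrix.mul_zero]
  · let x : Fin n := ⟨0, by omega⟩
    -- The frame vector of index `j.castSucc` separates the kernels: it lies in the `j`-th subspace
    -- of the flag but not in the `i`-th, as i < j.
    let M : Matrix (Fin (m + 2)) (Fin n) ℝ := g * Matrix.single j.castSucc x (1 : ℝ)
    have hM : ∀ l, conjDiag g (after l) * M =
        g * Matrix.single j.castSucc x (after l j.castSucc) := by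
      intro l
      calc g * diagonal (after l) * gᵀ * (g * Matrix.single j.castSucc x (1 : ℝ))
          = g * (diagonal (after l) * ((gᵀ * g) * Matrix.single j.castSucc x (1 : ℝ))) := by
            simp only [Matrix.mul_assoc]
        _ = g * Matrix.single j.castSucc x (after l j.castSucc) := by
          rw [hg, Matrix.one_mul]
          congr 1
          ext a y
          rw [diagonal_mul, Matrix.single_apply, Matrix.single_apply]
          split_ifs with h
          · rw [h.1, mul_one]
          · rw [mul_zero]
    have h1 : off M ∈ (projOf (hat (conjDiag g (after i))) :
        soAlg (Fin (m + 2) ⊕ Fin n) →L[ℝ] soAlg (Fin (m + 2) ⊕ Fin n)).toLinearMap.ker := by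
      have h0 : projOf (hat (conjDiag g (after j))) (off M) = 0 := by
        rw [projOf_off, hM]; simp [after, off_zero]
      exact (SetLike.ext_iff.1 he (off M)).2 h0
    have h2 : projOf (hat (conjDiag g (after i))) (off M) = 0 := h1
    rw [projOf_off, hM, ← off_zero] at h2
    have h3 := congrArg (gᵀ * ·) (off_injective h2)
    simp only [← Matrix.mul_assoc, hg, Matrix.one_mul, Matrix.mul_zero] at h3
    have h4 := congrFun₂ h3 j.castSucc x
    simp [after, hij] at h4

/-- The eigenvalues of a point of a flag simplex. -/
noncomputable def partialSum (c : Fin (m + 1) → ℝ) : Fin (m + 2) → ℝ := ∑ j, c j • after j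

lemma partialSum_apply (c : Fin (m + 1) → ℝ) (a : Fin (m + 2)) :
    partialSum c a = ∑ j, c j * after j a := by simp [partialSum]

lemma after_nonneg (j : Fin (m + 1)) (a : Fin (m + 2)) : 0 ≤ after j a := by
  rw [after]; split_ifs <;> simp

lemma monotone_after (j : Fin (m + 1)) : Monotone (after j) := fun a b h => by
  by_cases h1 : j.castSucc < a
  · simp [after, h1, h1.trans_le h]
  · rw [after, if_neg h1]; exact after_nonneg _ _

lemma monotone_partialSum {c : Fin (m + 1) → ℝ} (hc : ∀ j, 0 ≤ c j) : Monotone (partialSum c) :=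
  fun a b h => by
    rw [partialSum_apply, partialSum_apply]
    exact Finset.sum_le_sum fun j _ => mul_le_mul_of_nonneg_left (monotone_after j h) (hc j)

lemma partialSum_zero (c : Fin (m + 1) → ℝ) : partialSum c 0 = 0 := by
  simp [partialSum_apply, after]

lemma partialSum_last (c : Fin (m + 1) → ℝ) : partialSum c (Fin.last _) = ∑ j, c j := by
  simp [partialSum_apply, after, Fin.castSucc_lt_last]

lemma flagEnd_off (g : Matrix (Fin (m + 2)) (Fin (m + 2)) ℝ) (c : Fin (m + 1) → ℝ)
    (M : Matrix (Fin (m + 2)) (Fin n) ℝ) :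
    flagEnd n g c (off M) = off (conjDiag g (partialSum c) * M) := by
  have hoff : ∀ (f : Fin (m + 1) → Matrix (Fin (m + 2)) (Fin n) ℝ), ∑ j, off (f j) = off (∑ j, f j) :=
    fun f => (map_sum (⟨⟨off, off_zero⟩, off_add⟩ : Matrix (Fin (m + 2)) (Fin n) ℝ →+ _) f _).symm
  rw [flagEnd, _root_.sum_apply, partialSum, ← conjDiag_sum, Matrix.sum_mul, ← hoff]
  simp only [_root_.smul_apply, projOf_off, Matrix.smul_mul, off_smul]

lemma flagEnd_bot (g : Matrix (Fin (m + 2)) (Fin (m + 2)) ℝ) (c : Fin (m + 1) → ℝ)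
    (Z : soAlg (Fin n)) : flagEnd n g c (bot Z) = 0 := by
  simp [flagEnd, projOf_bot]

lemma symbol_flagEnd (x : Fin n) (g : Matrix (Fin (m + 2)) (Fin (m + 2)) ℝ) (c : Fin (m + 1) → ℝ) :
    symbol x (flagEnd n g c) = conjDiag g (partialSum c) :=
  symbol_eq_of_map_off fun M => flagEnd_off g c M

lemma flagEnd_top (g : Matrix (Fin (m + 2)) (Fin (m + 2)) ℝ) (c : Fin (m + 1) → ℝ)
    (X : soAlg (Fin (m + 2))) : (flagEnd n g c (top X)).1 =
      fromBlocks (conjDiag g (partialSum c) * X.1 + X.1 * conjDiag g (partialSum c) -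
        ∑ j, c j • (conjDiag g (after j) * X.1 * conjDiag g (after j))) 0 0 0 := by
  have h1 : (flagEnd n g c (top X)).1 = ∑ j, c j • (projOf (hat (conjDiag g (after j))) (top X)).1 := by
    rw [flagEnd, _root_.sum_apply]
    exact map_sum (soAlg (Fin (m + 2) ⊕ Fin n)).toSubmodule.subtype _ _
  have h2 : ∀ f : Fin (m + 1) → Matrix (Fin (m + 2)) (Fin (m + 2)) ℝ,
      ∑ j, hat (n := n) (f j) = hat (∑ j, f j) := fun f => by
    refine (map_sum (⟨⟨hat, fromBlocks_zero⟩, fun p q => ?_⟩ :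
      Matrix (Fin (m + 2)) (Fin (m + 2)) ℝ →+ Matrix (Fin (m + 2) ⊕ Fin n) _ ℝ) f _).symm
    simp [hat, fromBlocks_add]
  have h3 : ∀ (r : ℝ) (p : Matrix (Fin (m + 2)) (Fin (m + 2)) ℝ), r • hat (n := n) p = hat (r • p) :=
    fun r p => by simp [hat, fromBlocks_smul]
  rw [h1]
  simp only [projOf_top (conjDiag_transpose _ _)]
  change ∑ j, c j • hat _ = hat _
  simp only [h3, h2, smul_sub, smul_add, Finset.sum_sub_distrib, Finset.sum_add_distrib,
    ← Matrix.smul_mul, ← Matrix.mul_smul X.1, ← Matrix.sum_mul, ← Matrix.mul_sum, conjDiag_sum]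
  rfl

/-- Compression by a flag in terms of the frame. -/
lemma sum_conjDiag_after (g : Matrix (Fin (m + 2)) (Fin (m + 2)) ℝ) (c : Fin (m + 1) → ℝ)
    (X : Matrix (Fin (m + 2)) (Fin (m + 2)) ℝ) :
    ∑ j, c j • (conjDiag g (after j) * X * conjDiag g (after j)) =
      g * Matrix.of (fun a b => partialSum c (min a b) * (gᵀ * X * g) a b) * gᵀ := by
  have h : Matrix.of (fun a b => partialSum c (min a b) * (gᵀ * X * g) a b) =
      ∑ j, c j • (diagonal (after j) * (gᵀ * X * g) * diagonal (after j)) := by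
    ext a b
    rw [Matrix.of_apply, partialSum_apply, Matrix.sum_apply, Finset.sum_mul]
    refine Finset.sum_congr rfl fun j _ => ?_
    rw [Matrix.smul_apply, mul_diagonal, diagonal_mul, smul_eq_mul]
    have : after j (min a b) = after j a * after j b := by
      simp only [after, lt_min_iff]
      split_ifs <;> simp_all
    rw [this]; ring
  rw [h, Matrix.mul_sum, Matrix.sum_mul]
  refine Finset.sum_congr rfl fun j _ => ?_
  simp only [conjDiag, Matrix.mul_smul, Matrix.smul_mul, Matrix.mul_assoc]

/-- The change of frame intertwines the two diagonal matrices, so it only links indices with equal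
eigenvalues. -/
lemma intertwine {g g' : Matrix (Fin k) (Fin k) ℝ} (hg : gᵀ * g = 1) (hg' : g'ᵀ * g' = 1)
    {d d' : Fin k → ℝ} (h : conjDiag g d = conjDiag g' d') {a b : Fin k}
    (hab : (g'ᵀ * g) a b ≠ 0) : d b = d' a := by
  have : (g'ᵀ * g) * diagonal d = diagonal d' * (g'ᵀ * g) := by
    calc (g'ᵀ * g) * diagonal d = g'ᵀ * (g * diagonal d * gᵀ) * g := by
          rw [Matrix.mul_assoc, Matrix.mul_assoc _ _ g, Matrix.mul_assoc _ _ g, hg, Matrix.mul_one]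
      _ = (g'ᵀ * g') * diagonal d' * (g'ᵀ * g) := by
          change g'ᵀ * conjDiag g d * g = _
          rw [h, conjDiag]; simp only [Matrix.mul_assoc]
      _ = diagonal d' * (g'ᵀ * g) := by rw [hg', Matrix.one_mul]
  have := congrFun₂ this a b
  rw [mul_diagonal, diagonal_mul, mul_comm] at this
  exact mul_right_cancel₀ hab this

/-- Only the compression term on the upper left block does not visibly depend on the symbol S. In an
eigenframe it multiplies the (a, b) entry by the smaller of the two eigenvalues, because they
increase with the index. This recipe is independent of the frame, since a change of frame only mixes
indices with the same eigenvalue. -/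
lemma flagEnd_eq_of_symbol_eq {g g' : Matrix (Fin (m + 2)) (Fin (m + 2)) ℝ} (hg : gᵀ * g = 1)
    (hg' : g'ᵀ * g' = 1) {c c' : Fin (m + 1) → ℝ} (hc : ∀ j, 0 ≤ c j) (hc' : ∀ j, 0 ≤ c' j)
    (h : conjDiag g (partialSum c) = conjDiag g' (partialSum c')) :
    flagEnd n g c = flagEnd n g' c' := by
  ext1 W
  obtain ⟨X, M, Z, rfl⟩ := exists_eq_top_add_off_add_bot W
  rw [map_add, map_add, map_add, map_add, flagEnd_bot, flagEnd_bot, flagEnd_off, flagEnd_off, h]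
  congr 2
  apply Subtype.ext
  rw [flagEnd_top, flagEnd_top, h]
  congr 2
  rw [sum_conjDiag_after, sum_conjDiag_after]
  set u := g'ᵀ * g with hu
  have hgg' := mul_eq_one_comm.1 hg'
  have hgg := mul_eq_one_comm.1 hg
  set Y := gᵀ * X.1 * g with hY
  have hY' : g'ᵀ * X.1 * g' = u * Y * uᵀ := by
    calc g'ᵀ * X.1 * g' = g'ᵀ * (g * gᵀ) * X.1 * (g * gᵀ) * g' := by
          rw [hgg, Matrix.mul_one, Matrix.mul_one]
      _ = u * Y * uᵀ := by simp only [hu, hY, transpose_mul, transpose_transpose, Matrix.mul_assoc]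
  have key : u * Matrix.of (fun a b => partialSum c (min a b) * Y a b) * uᵀ =
      Matrix.of (fun a b => partialSum c' (min a b) * (u * Y * uᵀ) a b) := by
    ext a b
    simp only [Matrix.mul_apply, Matrix.of_apply, transpose_apply, Finset.sum_mul, Finset.mul_sum]
    refine Finset.sum_congr rfl fun i _ => Finset.sum_congr rfl fun j _ => ?_
    by_cases h1 : u a j = 0
    · simp [h1]
    by_cases h2 : u b i = 0
    · simp [h2]
    have e1 := intertwine hg hg' h h1
    have e2 := intertwine hg hg' h h2
    rw [(monotone_partialSum hc).map_min, (monotone_partialSum hc').map_min, e1, e2]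
    ring
  have hug : g' * u = g := by rw [hu, ← Matrix.mul_assoc, hgg', Matrix.one_mul]
  rw [hY', ← key, ← Matrix.mul_assoc g', ← Matrix.mul_assoc g', hug, Matrix.mul_assoc _ uᵀ,
    ← transpose_mul, hug]

end Flags

/-! ### Compactness of the frame sphere and sorted diagonalization. -/

section Frames

variable {k n m : ℕ}

lemma isCompact_orthogonal (k : ℕ) : IsCompact {g : Matrix (Fin k) (Fin k) ℝ | gᵀ * g = 1} := by
  have hK : IsCompact (Set.univ.pi fun _ : Fin k => Set.univ.pi fun _ : Fin k =>
      Set.Icc (-1 : ℝ) 1) :=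
    isCompact_univ_pi fun _ => isCompact_univ_pi fun _ => isCompact_Icc
  refine hK.of_isClosed_subset 
    (isClosed_eq (f := fun g : Matrix (Fin k) (Fin k) ℝ => gᵀ * g) (by fun_prop)
      continuous_const) fun (g : Matrix (Fin k) (Fin k) ℝ) hg a _ b _ => ?_
  have h := congrFun₂ (show gᵀ * g = 1 from hg) b b
  rw [Matrix.mul_apply, one_apply_eq] at h
  have h1 : g a b ^ 2 ≤ 1 := by
    rw [← h, sq]
    exact Finset.single_le_sum (f := fun i => gᵀ b i * g i b)
      (fun i _ => mul_self_nonneg (g i b)) (Finset.mem_univ a)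
  exact abs_le.1 ((sq_le_one_iff_abs_le_one _).1 h1)

lemma continuous_flagEnd : Continuous fun p : Matrix (Fin (m + 2)) (Fin (m + 2)) ℝ ×
    (Fin (m + 1) → ℝ) => flagEnd n p.1 p.2 := by
  refine continuous_clm_of_apply fun W => ?_
  simp only [flagEnd, _root_.sum_apply, _root_.smul_apply]
  refine continuous_finsetSum _ fun j _ => Continuous.smul
    ((continuous_apply j).comp continuous_snd) ?_
  refine continuous_induced_rng.2 ?_
  have hc : Continuous fun p : Matrix (Fin (m + 2)) (Fin (m + 2)) ℝ × (Fin (m + 1) → ℝ) =>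
      hat (n := n) (conjDiag p.1 (after j)) := by
    unfold hat conjDiag
    fun_prop
  change Continuous fun p : Matrix (Fin (m + 2)) (Fin (m + 2)) ℝ × (Fin (m + 1) → ℝ) =>
    W.1 - (1 - hat (conjDiag p.1 (after j))) * W.1 * (1 - hat (conjDiag p.1 (after j)))ᵀ
  fun_prop

lemma continuous_symbol (x : Fin n) : Continuous (symbol (k := k) x) := by
  refine continuous_matrix fun a b => ?_
  have : Continuous fun B : soAlg (Fin k ⊕ Fin n) →L[ℝ] soAlg (Fin k ⊕ Fin n) =>
      B (off (Matrix.single b x (1 : ℝ))) := by fun_prop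
  exact (continuous_subtype_val.comp this).matrix_elem _ _

/-- The points of the nerve on the simplices of flags spanned by orthonormal frames. -/
def frameSphere (m n : ℕ) : Set (nerveSO (m + 2) n) :=
  {B | ∃ g : Matrix (Fin (m + 2)) (Fin (m + 2)) ℝ, gᵀ * g = 1 ∧
    ∃ c ∈ stdSimplex ℝ (Fin (m + 1)), B.1 = flagEnd n g c}

lemma isCompact_frameSphere (hn : 2 ≤ n) : IsCompact (frameSphere m n) := by
  rw [Subtype.isCompact_iff]
  convert ((isCompact_orthogonal (m + 2)).prod (isCompact_stdSimplex ℝ (Fin (m + 1)))).image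
    (continuous_flagEnd (n := n)) using 1
  ext B
  constructor
  · rintro ⟨B, ⟨g, hg, c, hc, h⟩, rfl⟩
    exact ⟨(g, c), ⟨hg, hc⟩, h.symm⟩
  · rintro ⟨⟨g, c⟩, ⟨hg, hc⟩, rfl⟩
    exact ⟨⟨_, flagEnd_mem hn hg hc⟩, ⟨g, hg, c, hc, rfl⟩, rfl⟩

lemma partialSum_succ (c : Fin (m + 1) → ℝ) (j : Fin (m + 1)) :
    partialSum c j.succ = partialSum c j.castSucc + c j := by
  have : ∀ i, after i j.succ = after i j.castSucc + if i = j then 1 else 0 := fun i => by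
    rcases lt_trichotomy i j with h | h | h
    · simp [after, h, h.ne, h.le]
    · simp [after, h]
    · simp [after, h.ne', h.not_ge, h.not_gt]
  simp [partialSum_apply, this, mul_add, Finset.sum_add_distrib]

/-- The increments of a non-constant increasing sequence, normalised to have sum one. -/
lemma exists_partialSum {d : Fin (m + 2) → ℝ} (hd : Monotone d) (h : d 0 ≠ d (Fin.last _)) :
    0 < d (Fin.last _) - d 0 ∧ ∃ c ∈ stdSimplex ℝ (Fin (m + 1)),
      d = (d (Fin.last _) - d 0) • partialSum c + d 0 • (1 : Fin (m + 2) → ℝ) := by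
  have ht : 0 < d (Fin.last _) - d 0 := sub_pos.2 ((hd (Fin.zero_le _)).lt_of_ne h)
  set t := d (Fin.last _) - d 0
  let c : Fin (m + 1) → ℝ := fun j => (d j.succ - d j.castSucc) / t
  have key : ∀ a, partialSum c a = (d a - d 0) / t := by
    intro a
    induction a using Fin.induction with
    | zero => rw [partialSum_zero, sub_self, zero_div]
    | succ j ih => rw [partialSum_succ, ih]; simp only [c]; ring
  refine ⟨ht, c, ⟨fun j => div_nonneg (sub_nonneg.2 (hd j.castSucc_lt_succ.le)) ht.le, ?_⟩, ?_⟩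
  · rw [← partialSum_last, key]; exact div_self ht.ne'
  · funext a
    simp only [Pi.add_apply, Pi.smul_apply, key, smul_eq_mul, Pi.one_apply]
    field_simp
    ring

lemma exists_conjDiag {S : Matrix (Fin k) (Fin k) ℝ} (hS : Sᵀ = S) :
    ∃ (g : Matrix (Fin k) (Fin k) ℝ) (d : Fin k → ℝ), gᵀ * g = 1 ∧ Monotone d ∧
      S = conjDiag g d := by
  have hH : S.IsHermitian := by rwa [IsHermitian, conjTranspose_eq_transpose_of_trivial]
  obtain ⟨g, d, hg, h⟩ : ∃ (g : Matrix (Fin k) (Fin k) ℝ) (d : Fin k → ℝ), gᵀ * g = 1 ∧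
      S = conjDiag g d := by
    refine ⟨hH.eigenvectorUnitary, hH.eigenvalues, ?_, ?_⟩
    · have := (mem_unitaryGroup_iff' (A := (hH.eigenvectorUnitary : Matrix (Fin k) (Fin k) ℝ))).1
        hH.eigenvectorUnitary.2
      rwa [star_eq_conjTranspose, conjTranspose_eq_transpose_of_trivial] at this
    · have := hH.spectral_theorem
      rw [Unitary.conjStarAlgAut_apply, star_eq_conjTranspose,
        conjTranspose_eq_transpose_of_trivial] at this
      exact this
  refine ⟨g.submatrix id (Tuple.sort d), d ∘ Tuple.sort d, ?_, Tuple.monotone_sort d, ?_⟩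
  · rw [transpose_submatrix, ← submatrix_mul _ _ _ _ _ Function.bijective_id, hg]
    exact submatrix_one_equiv _
  · rw [h, conjDiag, conjDiag, transpose_submatrix, ← submatrix_diagonal_equiv,
      submatrix_mul_equiv, submatrix_mul_equiv, submatrix_id_id]

lemma conjDiag_smul_add {g : Matrix (Fin k) (Fin k) ℝ} (hg : gᵀ * g = 1) (t s : ℝ)
    (d : Fin k → ℝ) :
    conjDiag g (t • d + s • (1 : Fin k → ℝ)) = t • conjDiag g d + s • (1 : Matrix _ _ ℝ) := by
  rw [← conjDiag_one hg]
  simpa [Fin.sum_univ_two] using (conjDiag_sum g ![t, s] ![d, 1]).symm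

lemma exists_ne_zero_row {u : Matrix (Fin k) (Fin k) ℝ} (hu : uᵀ * u = 1) (b : Fin k) :
    ∃ a, u a b ≠ 0 := by
  by_contra! h
  have := congrFun₂ hu b b
  simp [Matrix.mul_apply, h] at this

end Frames

/-! ### The frame sphere as the space of rays of symmetric matrices modulo scalars. -/

section Sphere

variable {k n m : ℕ}

/-- A compact space that meets each open ray of a normed space exactly once is a sphere. -/
theorem nonempty_homeomorph_sphere {K E : Type*} [TopologicalSpace K] [CompactSpace K]
    [NormedAddCommGroup E] [NormedSpace ℝ E] (F : K → E) (hF : Continuous F) (h0 : ∀ x, F x ≠ 0)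
    (hinj : ∀ x y (t : ℝ), 0 < t → F x = t • F y → x = y)
    (hsurj : ∀ v, v ≠ 0 → ∃ x, ∃ t : ℝ, 0 < t ∧ v = t • F x) :
    Nonempty (K ≃ₜ Metric.sphere (0 : E) 1) := by
  have hn : ∀ x, 0 < ‖F x‖ := fun x => norm_pos_iff.2 (h0 x)
  let f : K → Metric.sphere (0 : E) 1 := fun x => ⟨‖F x‖⁻¹ • F x, by
    rw [mem_sphere_zero_iff_norm, norm_smul, norm_inv, norm_norm, inv_mul_cancel₀ (hn x).ne']⟩
  have hf : Continuous f :=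
    ((hF.norm.inv₀ fun x => (hn x).ne').smul hF).subtype_mk _
  have hbij : Function.Bijective f := by
    constructor
    · intro x y h
      refine hinj x y (‖F x‖ * ‖F y‖⁻¹) (mul_pos (hn x) (inv_pos.2 (hn y))) ?_
      have h1 : ‖F x‖⁻¹ • F x = ‖F y‖⁻¹ • F y := congrArg Subtype.val h
      rw [mul_smul, ← h1, smul_inv_smul₀ (hn x).ne']
    · intro v
      have hv := mem_sphere_zero_iff_norm.1 v.2
      obtain ⟨x, t, ht, h⟩ := hsurj v.1 (norm_pos_iff.1 (by rw [hv]; exact one_pos))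
      refine ⟨x, Subtype.ext ?_⟩
      rw [h, norm_smul, Real.norm_of_nonneg ht.le] at hv
      change ‖F x‖⁻¹ • F x = v.1
      rw [h, eq_inv_of_mul_eq_one_left hv]
  exact ⟨hf.homeoOfEquivCompactToT2 (f := Equiv.ofBijective f hbij)⟩

/-- The index set of the coordinates on symmetric matrices modulo scalars. -/
abbrev SymIndex (m : ℕ) : Type := {z : Sym2 (Fin (m + 2)) // z ≠ s(0, 0)}

lemma card_symIndex (m q : ℕ) (hq : (m + 2) * (m + 2 + 1) / 2 - 2 = q + 1) :
    Fintype.card (SymIndex m) = q + 2 := by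
  rw [Fintype.card_subtype_compl, Fintype.card_subtype_eq, Sym2.card, Fintype.card_fin,
    Nat.choose_two_right, Nat.add_sub_cancel, Nat.mul_comm]
  omega

/-- The coordinates of a symmetric matrix modulo scalars. -/
noncomputable def symCoord (S : Matrix (Fin (m + 2)) (Fin (m + 2)) ℝ) (z : SymIndex m) : ℝ :=
  (S - S 0 0 • (1 : Matrix (Fin (m + 2)) (Fin (m + 2)) ℝ)) (Quot.out z.1).1 (Quot.out z.1).2

lemma symCoord_smul_add (t s : ℝ) (S : Matrix (Fin (m + 2)) (Fin (m + 2)) ℝ) :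
    symCoord (t • S + s • 1) = t • symCoord S := by
  funext z
  simp only [symCoord, Matrix.sub_apply, Matrix.add_apply, Matrix.smul_apply, one_apply_eq,
    Pi.smul_apply, smul_eq_mul]
  ring

lemma symCoord_sub (S T : Matrix (Fin (m + 2)) (Fin (m + 2)) ℝ) :
    symCoord (S - T) = symCoord S - symCoord T := by
  funext z
  simp only [symCoord, Matrix.sub_apply, Matrix.smul_apply, Pi.sub_apply, smul_eq_mul]
  ring

lemma eq_of_symCoord_eq_zero {S : Matrix (Fin (m + 2)) (Fin (m + 2)) ℝ} (hS : Sᵀ = S)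
    (h : symCoord S = 0) : S = S 0 0 • 1 := by
  rw [← sub_eq_zero]
  set T := S - S 0 0 • (1 : Matrix (Fin (m + 2)) (Fin (m + 2)) ℝ) with hT
  have hT' : Tᵀ = T := by rw [hT, transpose_sub, transpose_smul, transpose_one, hS]
  ext a b
  by_cases hab : s(a, b) = s(0, 0)
  · rcases Sym2.eq_iff.1 hab with ⟨rfl, rfl⟩ | ⟨rfl, rfl⟩ <;> simp [hT]
  · have h1 : T (Quot.out s(a, b)).1 (Quot.out s(a, b)).2 = 0 := congrFun h ⟨s(a, b), hab⟩
    have h2 : s((Quot.out s(a, b)).1, (Quot.out s(a, b)).2) = s(a, b) := Quot.out_eq _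
    rcases Sym2.eq_iff.1 h2 with ⟨e1, e2⟩ | ⟨e1, e2⟩
    · rwa [e1, e2] at h1
    · rw [e1, e2] at h1
      rw [← hT']; exact h1

lemma exists_symCoord_eq (v : SymIndex m → ℝ) :
    ∃ S : Matrix (Fin (m + 2)) (Fin (m + 2)) ℝ, Sᵀ = S ∧ symCoord S = v := by
  let S : Matrix (Fin (m + 2)) (Fin (m + 2)) ℝ := Matrix.of fun a b =>
    if h : s(a, b) ≠ s(0, 0) then v ⟨s(a, b), h⟩ else 0
  refine ⟨S, ?_, ?_⟩
  · ext a b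
    simp only [S, transpose_apply, Matrix.of_apply, Sym2.eq_swap (a := b)]
  · have h00 : S 0 0 = 0 := by simp [S]
    funext z
    have h2 : s((Quot.out z.1).1, (Quot.out z.1).2) = z.1 := Quot.out_eq _
    simp only [symCoord, h00, zero_smul, sub_zero, S, Matrix.of_apply, h2]
    rw [dif_pos z.2]

/-- The hypothesis says S = t S' + s·1. Both spectra have minimum 0 and maximum 1, and an increasing
affine map matching them must be the identity. -/
lemma eq_of_symCoord_smul {g g' : Matrix (Fin (m + 2)) (Fin (m + 2)) ℝ} (hg : gᵀ * g = 1)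
    (hg' : g'ᵀ * g' = 1) {c c' : Fin (m + 1) → ℝ} (hc : c ∈ stdSimplex ℝ (Fin (m + 1)))
    (hc' : c' ∈ stdSimplex ℝ (Fin (m + 1))) {t : ℝ} (ht : 0 < t)
    (h : symCoord (conjDiag g (partialSum c)) = t • symCoord (conjDiag g' (partialSum c'))) :
    conjDiag g (partialSum c) = conjDiag g' (partialSum c') := by
  set d := partialSum c with hd
  set d' := partialSum c' with hd'
  have hdm := monotone_partialSum hc.1
  have hdm' := monotone_partialSum hc'.1
  have hd0 : d 0 = 0 := partialSum_zero c
  have hd0' : d' 0 = 0 := partialSum_zero c'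
  have hd1 : d (Fin.last _) = 1 := (partialSum_last c).trans hc.2
  have hd1' : d' (Fin.last _) = 1 := (partialSum_last c').trans hc'.2
  have h1 : symCoord (conjDiag g d - t • conjDiag g' d') = 0 := by
    have := symCoord_smul_add t 0 (conjDiag g' d')
    rw [zero_smul, add_zero] at this
    rw [symCoord_sub, this, h, sub_self]
  have h2 := eq_of_symCoord_eq_zero (by
    rw [transpose_sub, transpose_smul, conjDiag_transpose, conjDiag_transpose]) h1
  set s := (conjDiag g d - t • conjDiag g' d') 0 0
  have h3 : conjDiag g d = conjDiag g' (t • d' + s • (1 : Fin (m + 2) → ℝ)) := by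
    rw [conjDiag_smul_add hg', ← h2]; abel
  set u := g'ᵀ * g with hu
  have huu : uᵀ * u = 1 := by
    calc uᵀ * u = gᵀ * (g' * g'ᵀ) * g := by
          simp only [hu, transpose_mul, transpose_transpose, Matrix.mul_assoc]
      _ = 1 := by rw [mul_eq_one_comm.1 hg', Matrix.mul_one, hg]
  have huu' : uᵀᵀ * uᵀ = 1 := by rw [transpose_transpose]; exact mul_eq_one_comm.1 huu
  have key : ∀ a b, u a b ≠ 0 → d b = t * d' a + s := fun a b hab => by
    simpa using intertwine hg hg' h3 hab
  -- The eigenvalue 0 of S is t d'ₐ + s with d'ₐ ≥ 0, so s ≤ 0; the eigenvalue 0 of S' corresponds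
  -- to the eigenvalue s of S, so s ≥ 0.
  have hs : s = 0 := by
    obtain ⟨a, ha⟩ := exists_ne_zero_row huu 0
    obtain ⟨b, hb⟩ := exists_ne_zero_row huu' 0
    have e1 := key _ _ ha
    have e2 := key _ _ hb
    have n1 : 0 ≤ d' a := hd0' ▸ hdm' (Fin.zero_le a)
    have n2 : 0 ≤ d b := hd0 ▸ hdm (Fin.zero_le b)
    rw [hd0] at e1
    rw [hd0'] at e2
    nlinarith [mul_nonneg ht.le n1]
  have ht1 : t = 1 := by
    obtain ⟨a, ha⟩ := exists_ne_zero_row huu (Fin.last _)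
    obtain ⟨b, hb⟩ := exists_ne_zero_row huu' (Fin.last _)
    have e1 := key _ _ ha
    have e2 := key _ _ hb
    have n1 : d' a ≤ 1 := hd1' ▸ hdm' (Fin.le_last a)
    have n2 : d b ≤ 1 := hd1 ▸ hdm (Fin.le_last b)
    rw [hd1, hs] at e1
    rw [hd1', hs] at e2
    nlinarith [mul_le_mul_of_nonneg_left n1 ht.le]
  rw [h3, hs, ht1, zero_smul, one_smul, add_zero]

theorem nonempty_frameSphere_homeomorph (hn : 3 ≤ n) {q : ℕ}
    (hq : (m + 2) * (m + 2 + 1) / 2 - 2 = q + 1) :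
    Nonempty (frameSphere m n ≃ₜ Metric.sphere (0 : EuclideanSpace ℝ (Fin (q + 2))) 1) := by
  let x : Fin n := ⟨0, by omega⟩
  let e : Fin (q + 2) ≃ SymIndex m :=
    (finCongr (card_symIndex m q hq).symm).trans (Fintype.equivFin _).symm
  have : CompactSpace (frameSphere m n) :=
    isCompact_iff_compactSpace.1 (isCompact_frameSphere (by omega))
  let F : frameSphere m n → EuclideanSpace ℝ (Fin (q + 2)) := fun B =>
    WithLp.toLp 2 (symCoord (symbol x B.1.1) ∘ e)
  have hF : ∀ B B' (t : ℝ), F B = t • F B' ↔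
      symCoord (symbol x B.1.1) = t • symCoord (symbol x B'.1.1) := by
    intro B B' t
    constructor
    · intro h
      funext z
      have := congrArg (fun w : EuclideanSpace ℝ (Fin (q + 2)) => w (e.symm z)) h
      simpa [F] using this
    · intro h
      ext i
      simpa [F] using congrFun h (e i)
  refine nonempty_homeomorph_sphere F ?_ ?_ ?_ ?_
  · refine (PiLp.continuous_toLp 2 _).comp (continuous_pi fun i => ?_)
    have hS : Continuous fun B : frameSphere m n => symbol x B.1.1 :=
      (continuous_symbol x).comp (continuous_subtype_val.comp continuous_subtype_val)
    have hS0 := hS.matrix_elem 0 0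
    exact (hS.sub (hS0.smul continuous_const)).matrix_elem _ _
  · rintro ⟨B, g, hg, c, hc, hB⟩ h0
    have h1 := (hF ⟨B, g, hg, c, hc, hB⟩ ⟨B, g, hg, c, hc, hB⟩ 0).1 (by rw [h0, smul_zero])
    rw [zero_smul] at h1
    simp only [hB, symbol_flagEnd] at h1
    have h2 := eq_of_symCoord_eq_zero (conjDiag_transpose _ _) h1
    set s := conjDiag g (partialSum c) 0 0
    have h3 : conjDiag g (partialSum c) = conjDiag g (s • (1 : Fin (m + 2) → ℝ)) := by
      rw [h2]
      simpa using (conjDiag_smul_add hg 0 s 0).symm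
    have h4 := conjDiag_injective hg h3
    have e0 := congrFun h4 0
    have e1 := congrFun h4 (Fin.last _)
    rw [partialSum_zero] at e0
    rw [partialSum_last, hc.2] at e1
    simp at e0 e1
    exact one_ne_zero (e1.trans e0.symm)
  · rintro ⟨B, g, hg, c, hc, hB⟩ ⟨B', g', hg', c', hc', hB'⟩ t ht h
    have h1 := (hF _ _ t).1 h
    simp only [hB, hB', symbol_flagEnd] at h1
    have h2 := eq_of_symCoord_smul hg hg' hc hc' ht h1
    apply Subtype.ext
    apply Subtype.ext
    rw [hB, hB']
    exact flagEnd_eq_of_symbol_eq hg hg' hc.1 hc'.1 h2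
  · intro v hv
    obtain ⟨S, hS, hSv⟩ := exists_symCoord_eq (fun z => v (e.symm z))
    obtain ⟨g, d, hg, hd, rfl⟩ := exists_conjDiag hS
    -- Equal extreme eigenvalues would make S scalar, and its coordinates `v` would vanish.
    have hne : d 0 ≠ d (Fin.last _) := by
      intro h
      apply hv
      have hconst : d = (0 : ℝ) • d + d 0 • (1 : Fin (m + 2) → ℝ) := by
        funext a
        have h1 := hd (Fin.zero_le a)
        have h2 := hd (Fin.le_last a)
        simpa using le_antisymm (h2.trans h.ge) h1
      rw [hconst, conjDiag_smul_add hg, symCoord_smul_add, zero_smul] at hSv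
      ext i
      simpa using (congrFun hSv (e i)).symm
    obtain ⟨ht, c, hc, hdc⟩ := exists_partialSum hd hne
    refine ⟨⟨⟨flagEnd n g c, flagEnd_mem (by omega) hg hc⟩, g, hg, c, hc, rfl⟩, _, ht, ?_⟩
    rw [hdc, conjDiag_smul_add hg, symCoord_smul_add] at hSv
    ext i
    have := (congrFun hSv (e i)).symm
    simpa [F, symbol_flagEnd] using this

end Sphere

/-! ### Simple spectrum: openness and commuting matrices. -/

section Diagonal

variable {k m : ℕ}

lemma eq_conjDiag_iff {g : Matrix (Fin k) (Fin k) ℝ} (hg : gᵀ * g = 1) (d : Fin k → ℝ)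
    {S : Matrix (Fin k) (Fin k) ℝ} : S = conjDiag g d ↔ gᵀ * S * g = diagonal d := by
  refine ⟨fun h => h ▸ transpose_mul_conjDiag_mul hg d, fun h => ?_⟩
  have hg' := mul_eq_one_comm.1 hg
  calc S = (g * gᵀ) * S * (g * gᵀ) := by rw [hg', Matrix.one_mul, Matrix.mul_one]
    _ = g * (gᵀ * S * g) * gᵀ := by simp only [Matrix.mul_assoc]
    _ = conjDiag g d := by rw [h, conjDiag]

/-- The symmetric matrices with a multiple eigenvalue. -/
def multipleSpectrum (k : ℕ) : Set (Matrix (Fin k) (Fin k) ℝ) :=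
  {S | ∃ (g : Matrix (Fin k) (Fin k) ℝ) (d : Fin k → ℝ), gᵀ * g = 1 ∧ ¬ Function.Injective d ∧
    S = conjDiag g d}

/-- The set is the projection, along the compact orthogonal group, of the closed set of pairs (S, g)
such that gᵀSg is diagonal with a repeated entry. -/
lemma isClosed_multipleSpectrum (k : ℕ) : IsClosed (multipleSpectrum k) := by
  let K := {g : Matrix (Fin k) (Fin k) ℝ | gᵀ * g = 1}
  have : CompactSpace K := isCompact_iff_compactSpace.1 (isCompact_orthogonal k)
  let T : Matrix (Fin k) (Fin k) ℝ × K → Matrix (Fin k) (Fin k) ℝ := fun p => p.2.1ᵀ * p.1 * p.2.1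
  have hT : Continuous T := by
    have h2 : Continuous fun p : Matrix (Fin k) (Fin k) ℝ × K => p.2.1 :=
      continuous_subtype_val.comp continuous_snd
    exact (h2.matrix_transpose.matrix_mul continuous_fst).matrix_mul h2
  have hC : IsClosed (⋃ a, ⋃ b, {p | a ≠ b ∧ T p = diagonal (T p).diag ∧ T p a a = T p b b}) := by
    refine isClosed_iUnion_of_finite fun a => isClosed_iUnion_of_finite fun b => ?_
    refine isClosed_const.inter ((isClosed_eq hT ?_).inter
      (isClosed_eq (hT.matrix_elem a a) (hT.matrix_elem b b)))
    exact hT.matrix_diag.matrix_diagonal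
  convert isClosedMap_fst_of_compactSpace _ hC using 1
  ext S
  constructor
  · rintro ⟨g, d, hg, hd, h⟩
    rw [eq_conjDiag_iff hg] at h
    simp only [Function.Injective, not_forall] at hd
    obtain ⟨a, b, hab, hne⟩ := hd
    refine ⟨(S, ⟨g, hg⟩), ?_, rfl⟩
    have hTd : T (S, ⟨g, hg⟩) = diagonal d := h
    simp only [Set.mem_iUnion]
    refine ⟨a, b, hne, ?_, ?_⟩
    · rw [hTd, diag_diagonal]
    · rw [hTd, diagonal_apply_eq, diagonal_apply_eq, hab]
  · rintro ⟨⟨S', ⟨g, hg⟩⟩, hp, rfl⟩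
    simp only [Set.mem_iUnion] at hp
    obtain ⟨a, b, hne, h, hab⟩ := hp
    exact ⟨g, _, hg, fun hinj => hne (hinj hab), (eq_conjDiag_iff hg _).2 h⟩

/-- If two entries of `d'` agreed, the corresponding rows of the change of frame would be supported
in one and the same column and could not be orthogonal. -/
lemma injective_of_conjDiag_eq {g g' : Matrix (Fin k) (Fin k) ℝ} (hg : gᵀ * g = 1)
    (hg' : g'ᵀ * g' = 1) {d d' : Fin k → ℝ} (hd : Function.Injective d)
    (h : conjDiag g d = conjDiag g' d') : Function.Injective d' := by
  intro a a' haa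
  set u := g'ᵀ * g with hu
  have huu : u * uᵀ = 1 := by
    calc u * uᵀ = g'ᵀ * (g * gᵀ) * g' := by
          simp only [hu, transpose_mul, transpose_transpose, Matrix.mul_assoc]
      _ = 1 := by rw [mul_eq_one_comm.1 hg, Matrix.mul_one, hg']
  have hu' : uᵀᵀ * uᵀ = 1 := by rwa [transpose_transpose]
  obtain ⟨b, hb⟩ := exists_ne_zero_row hu' a
  obtain ⟨b', hb'⟩ := exists_ne_zero_row hu' a'
  rw [transpose_apply] at hb hb'
  have e := intertwine hg hg' h hb
  have huniq : ∀ c, u a' c ≠ 0 → c = b := fun c hc =>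
    hd ((intertwine hg hg' h hc).trans (haa.symm.trans e.symm))
  by_contra hne
  have h0 := congrFun₂ huu a a'
  rw [one_apply_ne hne, Matrix.mul_apply, Finset.sum_eq_single b] at h0
  · rw [transpose_apply] at h0
    exact mul_ne_zero hb (huniq b' hb' ▸ hb') h0
  · intro c _ hc
    rw [transpose_apply, not_imp_comm.1 (huniq c) hc, mul_zero]
  · simp

lemma exists_eq_conjDiag_of_commute {g : Matrix (Fin k) (Fin k) ℝ} (hg : gᵀ * g = 1)
    {d : Fin k → ℝ} (hd : Function.Injective d) {p : Matrix (Fin k) (Fin k) ℝ}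
    (h : p * conjDiag g d = conjDiag g d * p) : ∃ e, p = conjDiag g e := by
  set T := gᵀ * p * g with hT
  have hg' := mul_eq_one_comm.1 hg
  have key : T * diagonal d = diagonal d * T := by
    rw [← transpose_mul_conjDiag_mul hg d, hT]
    calc gᵀ * p * g * (gᵀ * conjDiag g d * g) = gᵀ * (p * (g * gᵀ) * conjDiag g d) * g := by
          simp only [Matrix.mul_assoc]
      _ = gᵀ * (conjDiag g d * (g * gᵀ) * p) * g := by rw [hg', Matrix.mul_one, Matrix.mul_one, h]
      _ = gᵀ * conjDiag g d * g * (gᵀ * p * g) := by simp only [Matrix.mul_assoc]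
  refine ⟨T.diag, (eq_conjDiag_iff hg _).2 ?_⟩
  rw [← hT]
  ext a b
  rcases eq_or_ne a b with rfl | hab
  · rw [diagonal_apply_eq, diag_apply]
  · rw [diagonal_apply_ne _ hab]
    have := congrFun₂ key a b
    rw [mul_diagonal, diagonal_mul, mul_comm, ← sub_eq_zero, ← sub_mul] at this
    exact (mul_eq_zero.1 this).resolve_left (sub_ne_zero.2 (hd.ne hab.symm))

/-- The index is that of the last zero, which exists as e ≠ 1 and is not the last coordinate as e ≠
0. -/
lemma exists_eq_after {e : Fin (m + 2) → ℝ} (he : Monotone e) (h01 : ∀ a, e a = 0 ∨ e a = 1)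
    (h0 : e ≠ 0) (h1 : e ≠ 1) : ∃ j, e = after j := by
  let s : Finset (Fin (m + 2)) := {a | e a = 0}
  have hs : s.Nonempty := by
    obtain ⟨a, ha⟩ := Function.ne_iff.1 h1
    exact ⟨a, by simpa [s] using (h01 a).resolve_right ha⟩
  have hmax : e (s.max' hs) = 0 := by simpa [s] using s.max'_mem hs
  have hlast : s.max' hs ≠ Fin.last _ := by
    intro h
    rw [h] at hmax
    refine h0 (funext fun a => (h01 a).resolve_right fun ha => ?_)
    have := he (Fin.le_last a)
    rw [ha, hmax] at this
    exact absurd this (by norm_num)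
  obtain ⟨j, hj⟩ := Fin.exists_castSucc_eq.2 hlast
  refine ⟨j, funext fun a => ?_⟩
  rw [after, hj]
  split_ifs with ha
  · refine (h01 a).resolve_left fun h => ha.not_ge (s.le_max' a (by simpa [s] using h))
  · refine (h01 a).resolve_right fun h => ?_
    have := he (not_lt.1 ha)
    rw [h, hmax] at this
    exact absurd this (by norm_num)

end Diagonal

/-! ### Kernels of projections in terms of their symbols. -/

section Kernel

variable {k n : ℕ} {P P' : soAlg (Fin k ⊕ Fin n) →L[ℝ] soAlg (Fin k ⊕ Fin n)}
  {H : Type*} [Group H] {Ad : Representation ℝ H (soAlg (Fin k ⊕ Fin n))}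

lemma off_lie_off (M M' : Matrix (Fin k) (Fin n) ℝ) : ∃ Z : soAlg (Fin n), ∃ X : soAlg (Fin k),
    X.1 = M' * Mᵀ - M * M'ᵀ ∧ ⁅off M, off M'⁆ = (top X : soAlg (Fin k ⊕ Fin n)) + bot Z := by
  refine ⟨⟨M'ᵀ * M - Mᵀ * M', ?_⟩, ⟨M' * Mᵀ - M * M'ᵀ, ?_⟩, rfl, ?_⟩
  · rw [LieAlgebra.Orthogonal.mem_so]; simp [transpose_mul]
  · rw [LieAlgebra.Orthogonal.mem_so]; simp [transpose_mul]
  · apply Subtype.ext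
    rw [LieSubalgebra.coe_bracket, Ring.lie_def, coe_off, coe_off, fromBlocks_multiply,
      fromBlocks_multiply, sub_eq_add_neg, fromBlocks_neg, fromBlocks_add]
    change _ = fromBlocks _ _ _ _ + fromBlocks _ _ _ _
    rw [fromBlocks_add]
    congr 1 <;> simp <;> abel

lemma eq_of_map_eq_zero_iff
    (hP : P ∈ symEnd (traceForm (Fin k ⊕ Fin n)) Ad) (hid : ∀ W, P (P W) = P W)
    (hP' : P' ∈ symEnd (traceForm (Fin k ⊕ Fin n)) Ad) (hid' : ∀ W, P' (P' W) = P' W)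
    (h : ∀ W, P W = 0 ↔ P' W = 0) : P = P' := by
  have h1 : ∀ W, P (P' W) = P W := fun W => by
    rw [← sub_eq_zero, ← map_sub, h, map_sub, hid', sub_self]
  have h2 : ∀ W, P' (P W) = P' W := fun W => by
    rw [← sub_eq_zero, ← map_sub, ← h, map_sub, hid, sub_self]
  ext1 W
  refine sub_eq_zero.1 (eq_zero_of_traceForm_self ?_)
  rw [LinearMap.map_sub₂, sub_eq_zero]
  generalize P W - P' W = V
  rw [hP.1, ← h1 V, ← hP.1, ← hP'.1, h2]

lemma symbol_mul_symbol (hn : 3 ≤ n) (x : Fin n)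
    (hP : P ∈ projAlg (traceForm (Fin k ⊕ Fin n)) (blockAlg k n) Ad)
    (hP' : P' ∈ projAlg (traceForm (Fin k ⊕ Fin n)) (blockAlg k n) Ad)
    (h : ∀ W, P W = 0 → P' W = 0) : symbol x P' * symbol x P = symbol x P' := by
  refine (symbol_eq_of_map_off fun M => ?_).symm
  have : P' (off M) = P' (P (off M)) := by
    rw [← sub_eq_zero, ← map_sub]
    exact h _ (by rw [map_sub, hP.2.1, sub_self])
  rw [this, map_off_eq_symbol hn x hP, map_off_eq_symbol hn x hP', Matrix.mul_assoc]

/-- The kernel is closed under brackets, and 𝔰𝔬(ker p) is produced by brackets of its off-diagonal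
elements: with the columns `E a`, the brackets of `(1 - p) * E a` and `X * E a` have upper left
blocks summing to X(1 - p) + (1 - p)X = 2X, and their lower blocks lie in 𝔥. -/
lemma map_top_eq_zero_of_mul_eq_zero (hn : 3 ≤ n) (x : Fin n)
    (hP : P ∈ projAlg (traceForm (Fin k ⊕ Fin n)) (blockAlg k n) Ad) {X : soAlg (Fin k)}
    (hX : symbol x P * X.1 = 0) : P (top X) = 0 := by
  set p := symbol x P with hp
  have hpp : p * p = p := symbol_mul_self hn x hP
  have hpt : pᵀ = p := symbol_transpose hn x hP
  have hXp : X.1 * p = 0 := by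
    have := congrArg transpose hX
    rw [transpose_mul, hpt, so_transpose, transpose_zero, Matrix.neg_mul, neg_eq_zero] at this
    exact this
  have hoff : ∀ M : Matrix (Fin k) (Fin n) ℝ, p * M = 0 → P (off M) = 0 := fun M hM => by
    rw [map_off_eq_symbol hn x hP, ← hp, hM, off_zero]
  let E : Fin k → Matrix (Fin k) (Fin n) ℝ := fun a => Matrix.single a x (1 : ℝ)
  choose Z Y hY hlie using fun a => off_lie_off ((1 - p) * E a) (X.1 * E a)
  have hz : ∀ a, P (top (Y a)) = 0 := fun a => by
    have h1 : P ⁅off ((1 - p) * E a), off (X.1 * E a)⁆ = 0 := by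
      refine hP.2.2.2.2 _ _ (hoff _ ?_) (hoff _ ?_)
      · rw [← Matrix.mul_assoc, Matrix.mul_sub, Matrix.mul_one, hpp, sub_self, Matrix.zero_mul]
      · rw [← Matrix.mul_assoc, hX, Matrix.zero_mul]
    rwa [hlie, map_add, map_bot_eq_zero hP, add_zero] at h1
  have hE : ∑ a, E a * (E a)ᵀ = 1 := by
    simp only [E, transpose_single, single_mul_single_same, mul_one]
    ext a b
    simp [Matrix.sum_apply, Matrix.single_apply, Matrix.one_apply, ite_and]
  have hsum : ∑ a, (Y a).1 = (2 : ℝ) • X.1 := by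
    have h1 : ∀ a, (Y a).1 = X.1 * (E a * (E a)ᵀ) * (1 - p) + (1 - p) * (E a * (E a)ᵀ) * X.1 := by
      intro a
      rw [hY, transpose_mul, transpose_mul, so_transpose, transpose_sub, transpose_one, hpt,
        Matrix.mul_neg, Matrix.mul_neg, sub_neg_eq_add]
      simp only [Matrix.mul_assoc]
    simp only [h1]
    rw [Finset.sum_add_distrib, ← Matrix.sum_mul, ← Matrix.mul_sum, ← Matrix.sum_mul,
      ← Matrix.mul_sum, hE, Matrix.mul_one, Matrix.mul_one, Matrix.mul_sub, Matrix.sub_mul, hX, hXp,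
      Matrix.mul_one, Matrix.one_mul, sub_zero, two_smul]
  have htop : (2 : ℝ) • (top X : soAlg (Fin k ⊕ Fin n)) = ∑ a, top (Y a) := by
    apply Subtype.ext
    have h1 : (∑ a, (top (Y a) : soAlg (Fin k ⊕ Fin n))).1 = ∑ a, (top (Y a)).1 :=
      map_sum (soAlg (Fin k ⊕ Fin n)).toSubmodule.subtype _ _
    have h2 : ((2 : ℝ) • (top X : soAlg (Fin k ⊕ Fin n))).1 = (2 : ℝ) • (top X).1 := rfl
    rw [h1, h2]
    ext (a | y) (b | z)
    · have := congrFun₂ hsum a b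
      rw [Matrix.sum_apply] at this ⊢
      simpa [coe_top] using this.symm
    all_goals simp [coe_top, Matrix.sum_apply]
  have h2 : (2 : ℝ) • P (top X) = 0 := by
    rw [← map_smul, htop, map_sum]; exact Finset.sum_eq_zero fun a _ => hz a
  exact (smul_eq_zero.1 h2).resolve_left two_ne_zero

/-- Bracketing with `top X` preserves the off-diagonal part of the kernel, so X maps ker p to
itself. As X is skew, it preserves the orthogonal complement too. -/
lemma symbol_commute_of_map_top_eq_zero (hn : 3 ≤ n) (x : Fin n)
    (hP : P ∈ projAlg (traceForm (Fin k ⊕ Fin n)) (blockAlg k n) Ad) {X : soAlg (Fin k)}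
    (hX : P (top X) = 0) : symbol x P * X.1 = X.1 * symbol x P := by
  set p := symbol x P with hp
  have hpp : p * p = p := symbol_mul_self hn x hP
  have hpt : pᵀ = p := symbol_transpose hn x hP
  have h1 : p * X.1 = p * X.1 * p := by
    have : ∀ M : Matrix (Fin k) (Fin n) ℝ, P (off (X.1 * ((1 - p) * M))) = 0 := fun M => by
      rw [← top_lie_off]
      refine hP.2.2.2.2 _ _ hX ?_
      rw [map_off_eq_symbol hn x hP, ← hp, ← Matrix.mul_assoc, Matrix.mul_sub, Matrix.mul_one, hpp,
        sub_self, Matrix.zero_mul, off_zero]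
    have h2 : ∀ M : Matrix (Fin k) (Fin n) ℝ, (p * X.1 * (1 - p)) * M = 0 := fun M => by
      have := this M
      rw [map_off_eq_symbol hn x hP, ← hp, ← off_zero] at this
      simpa only [Matrix.mul_assoc] using off_injective this
    rw [← sub_eq_zero]
    ext a b
    have := congrFun₂ (h2 (Matrix.single b x (1 : ℝ))) a x
    simpa [Matrix.mul_sub] using this
  have h2 := congrArg transpose h1
  simp only [transpose_mul, hpt, so_transpose, Matrix.neg_mul, Matrix.mul_neg, neg_inj] at h2
  rw [h1, h2, Matrix.mul_assoc]

lemma hat_mul_eq_zero_iff (p : Matrix (Fin k) (Fin k) ℝ) (X : soAlg (Fin k))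
    (M : Matrix (Fin k) (Fin n) ℝ) (Z : soAlg (Fin n)) :
    hat p * (top X + off M + bot Z : soAlg (Fin k ⊕ Fin n)).1 = 0 ↔ p * X.1 = 0 ∧ p * M = 0 := by
  have h : (top X + off M + bot Z : soAlg (Fin k ⊕ Fin n)).1 = fromBlocks X.1 M (-Mᵀ) Z.1 := by
    change fromBlocks _ _ _ _ + fromBlocks _ _ _ _ + fromBlocks _ _ _ _ = _
    simp [fromBlocks_add]
  rw [h, hat, fromBlocks_multiply, ← fromBlocks_zero, fromBlocks_inj]
  simp

/-- A projection of the nerve is determined by its symbol as soon as its kernel is. -/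
lemma eq_projOf_of_map_top (hn : 3 ≤ n) (x : Fin n)
    (hP : P ∈ projAlg (traceForm (Fin k ⊕ Fin n)) (blockAlg k n)
      ((adSO (Fin k ⊕ Fin n)).comp (blockSO k n)))
    (h : ∀ X : soAlg (Fin k), P (top X) = 0 → symbol x P * X.1 = 0) :
    P = projOf (hat (symbol x P)) ∧ symbol x P ≠ 0 ∧ symbol x P ≠ 1 := by
  have hpt := symbol_transpose hn x hP
  have hpp := symbol_mul_self hn x hP
  have hker : ∀ W, P W = 0 ↔ hat (symbol x P) * W.1 = 0 := by
    intro W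
    obtain ⟨X, M, Z, rfl⟩ := exists_eq_top_add_off_add_bot W
    rw [hat_mul_eq_zero_iff, map_add, map_add, map_bot_eq_zero hP, add_zero,
      map_off_eq_symbol hn x hP]
    constructor
    · intro h0
      obtain ⟨X', hX'⟩ := exists_map_top (by omega) hP X
      rw [hX'] at h0
      have h1 : (top X' + off (symbol x P * M) : soAlg (Fin k ⊕ Fin n)).1 =
          fromBlocks X'.1 (symbol x P * M) (-(symbol x P * M)ᵀ) 0 := by
        change fromBlocks _ _ _ _ + fromBlocks _ _ _ _ = _
        simp [fromBlocks_add]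
      rw [h0] at h1
      change 0 = _ at h1
      rw [← fromBlocks_zero, fromBlocks_inj] at h1
      have hX0 : X' = 0 := Subtype.ext h1.1.symm
      exact ⟨h X (by rw [hX', hX0, top_zero]), h1.2.1.symm⟩
    · rintro ⟨h1, h2⟩
      rw [map_top_eq_zero_of_mul_eq_zero hn x hP h1, h2, off_zero, add_zero]
  refine ⟨?_, fun h0 => ?_, fun h1 => ?_⟩
  · refine eq_of_map_eq_zero_iff hP.1 hP.2.1 (projOf_mem_symEnd hpt)
      (projOf_projOf (hat_transpose hpt) (by rw [hat_mul_hat, hpp])) fun W => ?_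
    rw [hker, projOf_hat_eq_zero_iff hpt hpp]
  · refine hP.2.2.2.1.ne (eq_top_iff.2 fun W _ => (hker W).2 ?_)
    rw [h0, hat, fromBlocks_zero, Matrix.zero_mul]
  · refine hP.2.2.1.not_ge fun W hW => ?_
    obtain ⟨X, M, Z, rfl⟩ := exists_eq_top_add_off_add_bot W
    have h2 := (hat_mul_eq_zero_iff _ X M Z).1 ((hker _).1 hW)
    rw [h1, Matrix.one_mul, Matrix.one_mul] at h2
    have hX0 : X = 0 := Subtype.ext h2.1
    rw [hX0, h2.2, top_zero, off_zero, zero_add, zero_add]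
    exact bot_mem Z

end Kernel

/-! ### Points with simple spectrum lie on the frame sphere. -/

section Interior

variable {n m : ℕ}

/-- If a combination of a decreasing chain of diagonal idempotents has simple spectrum, then a skew
matrix that commutes with all idempotents from the `i`-th on is annihilated by the `i`-th. -/
lemma mul_eq_zero_of_commute {k r : ℕ} {g : Matrix (Fin k) (Fin k) ℝ} (hg : gᵀ * g = 1)
    {e : Fin r → Fin k → ℝ} {c : Fin r → ℝ} (hinj : Function.Injective (∑ i, c i • e i))
    (hmul : ∀ i j, i ≤ j → e j * e i = e j) (i : Fin r) {X : soAlg (Fin k)}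
    (hX : ∀ j, i ≤ j → conjDiag g (e j) * X.1 = X.1 * conjDiag g (e j)) :
    conjDiag g (e i) * X.1 = 0 := by
  set Y := gᵀ * X.1 * g with hY
  have hg' := mul_eq_one_comm.1 hg
  have hXY : X.1 = g * Y * gᵀ := by
    calc X.1 = (g * gᵀ) * X.1 * (g * gᵀ) := by rw [hg', Matrix.one_mul, Matrix.mul_one]
      _ = g * Y * gᵀ := by simp only [hY, Matrix.mul_assoc]
  have hYt : ∀ a, Y a a = 0 := fun a => by
    have : Yᵀ = -Y := by
      simp only [hY, transpose_mul, transpose_transpose, so_transpose, Matrix.mul_neg,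
        Matrix.neg_mul, Matrix.mul_assoc]
    have := congrFun₂ this a a
    rw [transpose_apply, Matrix.neg_apply] at this
    linarith
  have hl : ∀ d, conjDiag g d * X.1 = g * (diagonal d * Y) * gᵀ := fun d => by
    calc conjDiag g d * X.1 = g * diagonal d * (gᵀ * g) * Y * gᵀ := by
          rw [hXY, conjDiag]; simp only [Matrix.mul_assoc]
      _ = _ := by rw [hg, Matrix.mul_one]; simp only [Matrix.mul_assoc]
  have hr : ∀ d, X.1 * conjDiag g d = g * (Y * diagonal d) * gᵀ := fun d => by
    calc X.1 * conjDiag g d = g * Y * (gᵀ * g) * diagonal d * gᵀ := by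
          rw [hXY, conjDiag]; simp only [Matrix.mul_assoc]
      _ = _ := by rw [hg, Matrix.mul_one]; simp only [Matrix.mul_assoc]
  have hcancel : ∀ T T' : Matrix (Fin k) (Fin k) ℝ, g * T * gᵀ = g * T' * gᵀ → T = T' := by
    intro T T' h
    have h1 : ∀ T, gᵀ * (g * T * gᵀ) * g = T := fun T => by
      calc gᵀ * (g * T * gᵀ) * g = (gᵀ * g) * T * (gᵀ * g) := by simp only [Matrix.mul_assoc]
        _ = T := by rw [hg, Matrix.one_mul, Matrix.mul_one]
    rw [← h1 T, h, h1]
  suffices diagonal (e i) * Y = 0 by rw [hl, this, Matrix.mul_zero, Matrix.zero_mul]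
  ext a b
  rw [diagonal_mul, Matrix.zero_apply]
  by_contra hne
  have hea := left_ne_zero_of_mul hne
  have hYab := right_ne_zero_of_mul hne
  -- Commutation forces the j-th values at `a` and `b` to agree wherever the entry of Y is non-zero.
  -- For j ≤ i both values are 1, as the i-th idempotent is non-zero at both indices. So all
  -- idempotents agree at `a` and `b`; simplicity gives a = b, contradicting the zero diagonal of Y.
  have hcomm : ∀ j, i ≤ j → e j a = e j b := fun j hj => by
    have h1 := hX j hj
    rw [hl, hr] at h1
    have h2 := congrFun₂ (hcancel _ _ h1) a b
    rw [diagonal_mul, mul_diagonal, mul_comm] at h2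
    exact mul_left_cancel₀ hYab h2
  have hone : ∀ j, j ≤ i → ∀ a, e i a ≠ 0 → e j a = 1 := fun j hj a ha =>
    mul_left_cancel₀ ha ((congrFun (hmul j i hj) a).trans (mul_one _).symm)
  have hall : ∀ j, e j a = e j b := fun j => by
    rcases le_total i j with h | h
    · exact hcomm j h
    · rw [hone j h a hea, hone j h b (hcomm i le_rfl ▸ hea)]
  have hab : a = b := hinj (by simp [hall])
  exact hYab (hab ▸ hYt a)

lemma flagEnd_eq_sum {r : ℕ} (g : Matrix (Fin (m + 2)) (Fin (m + 2)) ℝ) (c : Fin r → ℝ)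
    (j : Fin r → Fin (m + 1)) :
    flagEnd n g (fun l => ∑ i with j i = l, c i) =
      ∑ i, c i • (projOf (hat (conjDiag g (after (j i)))) :
        soAlg (Fin (m + 2) ⊕ Fin n) →L[ℝ] soAlg (Fin (m + 2) ⊕ Fin n)) := by
  rw [flagEnd, ← Finset.sum_fiberwise Finset.univ j]
  refine Finset.sum_congr rfl fun l _ => ?_
  rw [Finset.sum_smul]
  refine Finset.sum_congr rfl fun i hi => ?_
  rw [(Finset.mem_filter.1 hi).2]

/-- Increasing kernels give a decreasing chain of symbols. These commute with their combination,
hence are diagonal in its unique eigenframe, and sorting the eigenvalues turns them into the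
projections of the standard flag of that frame. -/
lemma mem_frameSphere_of_symbol_notMem (hn : 3 ≤ n) (x : Fin n) {B : nerveSO (m + 2) n}
    (hB : symbol x B.1 ∉ multipleSpectrum (m + 2)) : B ∈ frameSphere m n := by
  obtain ⟨B, hsym, r, P, c, hP, hker, hc, hsum, rfl⟩ := B
  change symbol x (∑ i, c i • P i) ∉ _ at hB
  have hP' := fun i => (hP i).1
  have hS : symbol x (∑ i, c i • P i) = ∑ i, c i • symbol x (P i) := by
    ext a b
    simp [symbol, Matrix.sum_apply, _root_.sum_apply, _root_.smul_apply]
  have hmulP : ∀ i j, i ≤ j → symbol x (P j) * symbol x (P i) = symbol x (P j) := fun i j hij =>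
    symbol_mul_symbol hn x (hP' i) (hP' j) fun W hW => hker.monotone hij hW
  have ht := fun i => symbol_transpose hn x (hP' i)
  have hmulP' : ∀ i j, i ≤ j → symbol x (P i) * symbol x (P j) = symbol x (P j) := by
    intro i j hij
    have := congrArg transpose (hmulP i j hij)
    rwa [transpose_mul, ht, ht] at this
  rw [hS] at hB
  have hSt : (∑ i, c i • symbol x (P i))ᵀ = ∑ i, c i • symbol x (P i) := by
    simp [transpose_sum, transpose_smul, ht]
  obtain ⟨g, d, hg, hd, hSd⟩ := exists_conjDiag hSt
  have hinj : Function.Injective d := by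
    by_contra h
    exact hB ⟨g, d, hg, h, hSd⟩
  have hcomm : ∀ i, symbol x (P i) * conjDiag g d = conjDiag g d * symbol x (P i) := by
    intro i
    rw [← hSd, Matrix.mul_sum, Matrix.sum_mul]
    refine Finset.sum_congr rfl fun j _ => ?_
    rw [Matrix.mul_smul, Matrix.smul_mul]
    rcases le_total i j with h | h
    · rw [hmulP i j h, hmulP' i j h]
    · rw [hmulP j i h, hmulP' j i h]
  choose e he using fun i => exists_eq_conjDiag_of_commute hg hinj (hcomm i)
  have hde : d = ∑ i, c i • e i := by
    refine conjDiag_injective hg ?_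
    rw [← hSd, ← conjDiag_sum]
    exact Finset.sum_congr rfl fun i _ => by rw [he]
  have hemul : ∀ i j, i ≤ j → e j * e i = e j := fun i j hij => by
    refine conjDiag_injective hg ?_
    rw [← conjDiag_mul_conjDiag hg, ← he, ← he, hmulP i j hij]
  have h01 : ∀ i a, e i a = 0 ∨ e i a = 1 := fun i a => by
    have h1 : e i a * e i a = e i a := congrFun (hemul i i le_rfl) a
    have h2 : e i a * (e i a - 1) = 0 := by rw [mul_sub, h1, mul_one, sub_self]
    exact (mul_eq_zero.1 h2).imp_right sub_eq_zero.1
  have hmono : ∀ i, Monotone (e i) := by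
    intro i
    refine fun a b hab => ?_
    by_contra! hlt
    have ha : e i a = 1 := (h01 i a).resolve_left fun h => by
      rcases h01 i b with h' | h' <;> norm_num [h, h'] at hlt
    have hb : e i b = 0 := (h01 i b).resolve_right fun h => by
      rw [ha, h] at hlt; exact lt_irrefl _ hlt
    -- A descent of one idempotent from 1 to 0 forces every member of the chain to be weakly smaller
    -- at `b`: later members vanish at `b`, earlier ones are 1 at `a`. The sorted eigenvalues would
    -- then coincide.
    have hle : ∀ j, e j b ≤ e j a := fun j => by
      rcases le_total i j with h | h
      · have h1 : e j b = 0 := by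
          have : e j b * e i b = e j b := congrFun (hemul i j h) b
          rw [← this, hb, mul_zero]
        rw [h1]
        rcases h01 j a with h' | h' <;> norm_num [h']
      · have h1 : e j a = 1 := by
          have : e i a * e j a = e i a := congrFun (hemul j i h) a
          rwa [ha, one_mul] at this
        rw [h1]
        rcases h01 j b with h' | h' <;> norm_num [h']
    have hdba : d b ≤ d a := by
      rw [hde]
      simpa using Finset.sum_le_sum fun j (_ : j ∈ Finset.univ) =>
        mul_le_mul_of_nonneg_left (hle j) (hc j)
    have hab' : a = b := hinj (le_antisymm (hd hab) hdba)
    rw [hab'] at hlt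
    exact lt_irrefl _ hlt
  -- An element of ker Pᵢ lies in all later kernels, so it commutes with all later symbols; this
  -- excludes kernels larger than 𝔰𝔬(ker pᵢ ⊕ ℝⁿ).
  have hproj := fun i => eq_projOf_of_map_top hn x (hP' i) fun X hX => by
    rw [he i]
    refine mul_eq_zero_of_commute hg (hde ▸ hinj) hemul i fun j hij => ?_
    rw [← he]
    exact symbol_commute_of_map_top_eq_zero hn x (hP' j) (hker.monotone hij hX)
  choose j hj using fun i => exists_eq_after (hmono i) (h01 i)
    (fun h => (hproj i).2.1 (by rw [he, h, conjDiag_zero]))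
    (fun h => (hproj i).2.2 (by rw [he, h, conjDiag_one hg]))
  -- The chain may skip members of the full flag; these receive the empty sum as weight.
  refine ⟨g, hg, fun l => ∑ i with j i = l, c i,
    ⟨fun l => Finset.sum_nonneg fun i _ => hc i, ?_⟩, ?_⟩
  · rw [Finset.sum_fiberwise, hsum]
  · refine (Finset.sum_congr rfl fun i _ => ?_).trans (flagEnd_eq_sum g c j).symm
    rw [← hj, ← he]
    rw [← (hproj i).1]

theorem nonempty_interior_frameSphere (m : ℕ) (hn : 3 ≤ n) :
    (interior (frameSphere m n)).Nonempty := by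
  let x : Fin n := ⟨0, by omega⟩
  have hU : IsOpen {B : nerveSO (m + 2) n | symbol x B.1 ∉ multipleSpectrum (m + 2)} :=
    (isClosed_multipleSpectrum _).isOpen_compl.preimage
      ((continuous_symbol x).comp continuous_subtype_val)
  -- The barycenter of the simplex of the standard flag has eigenvalues 0, 1/(m+1), ..., 1, all
  -- distinct.
  let c : Fin (m + 1) → ℝ := fun _ => ((m + 1 : ℕ) : ℝ)⁻¹
  have hpos : (0 : ℝ) < ((m + 1 : ℕ) : ℝ)⁻¹ := by positivity
  have hc : c ∈ stdSimplex ℝ (Fin (m + 1)) := by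
    refine ⟨fun _ => hpos.le, ?_⟩
    simp only [c, Finset.sum_const, Finset.card_univ, Fintype.card_fin, nsmul_eq_mul]
    exact mul_inv_cancel₀ (by positivity)
  have h1 : (1 : Matrix (Fin (m + 2)) (Fin (m + 2)) ℝ)ᵀ * 1 = 1 := by simp
  refine ⟨⟨flagEnd n 1 c, flagEnd_mem (by omega) h1 hc⟩, mem_interior.2 ⟨_, fun B hB =>
    mem_frameSphere_of_symbol_notMem hn x hB, hU, ?_⟩⟩
  rintro ⟨g, d, hg, hd, h⟩
  rw [symbol_flagEnd] at h
  refine hd (injective_of_conjDiag_eq h1 hg (StrictMono.injective ?_) h)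
  refine Fin.strictMono_iff_lt_succ.2 fun j => ?_
  rw [partialSum_succ]
  exact lt_add_of_pos_right _ hpos

end Interior

end Homogeneous

theorem mainTheorem11 (n k : ℕ) (hn : 3 ≤ n) (hk : 2 ≤ k) :
    (∃ A : Set (Homogeneous.nerveSO k n),
      Nonempty (A ≃ₜ Metric.sphere
        (0 : EuclideanSpace ℝ (Fin (k * (k + 1) / 2 - 2 + 1))) 1) ∧
      (interior A).Nonempty ∧
      ¬ (⟨Subtype.val, continuous_subtype_val⟩ :
          C(A, Homogeneous.nerveSO k n)).Nullhomotopic) ∧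
    (∀ (R : Type) [CommRing R] [Nontrivial R],
      Nontrivial (Homogeneous.singularHomology R (k * (k + 1) / 2 - 2)
        (Homogeneous.nerveSO k n))) ∧
    ¬ ContractibleSpace (Homogeneous.nerveSO k n) := by
  obtain ⟨m, rfl⟩ : ∃ m, k = m + 2 := ⟨k - 2, by omega⟩
  -- As k ≥ 2, k(k+1)/2 is at least 3, so the truncated subtraction is exact and the sphere has
  -- positive dimension; in positive degree contractible spaces have no homology.
  obtain ⟨q, hq⟩ : ∃ q, (m + 2) * (m + 2 + 1) / 2 - 2 = q + 1 := by
    have : 6 ≤ (m + 2) * (m + 2 + 1) := by nlinarith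
    exact ⟨(m + 2) * (m + 2 + 1) / 2 - 3, by omega⟩
  rw [hq]
  obtain ⟨φ⟩ := Homogeneous.nonempty_frameSphere_homeomorph hn hq
  have hint := Homogeneous.nonempty_interior_frameSphere m hn
  obtain ⟨h1, h2, h3⟩ := sphere_with_interior φ hint
  exact ⟨⟨_, ⟨φ⟩, hint, h1⟩, h2, h3⟩
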